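/- **Setting.** Let $n\ge 4$, let $\Omega\subseteq\mathbb R^n$ be open, $x_0\in\Omega$, and let $\omega=(\omega_{ij})$ be an analytic pseudo-Riemannian metric on $\Omega$ with inverse $(\omega^{ij})$, Christoffel symbols $\gamma^k_{ij}$ and Ricci tensor $\rho_{\mathrm{ic}}$. Assume that $\omega$ is S-admissible with constant $k_0\in\mathbb R$: its Weyl tensor vanishes and $\rho_{\mathrm{ic}}=(n-1)k_0\,\omega$. The *c system* is the system of partial differential equations $$\partial_i\partial_j\alpha=F_{ij}(x,\alpha,\partial_1\alpha,\dots,\partial_n\alpha),\qquad 1\le i,j\le n,$$ $$F_{ij}(x,c_0,c_1,\dots,c_n)=\tfrac12\Big\{k_0(1-e^{2c_0})-\sum_{k,h}\omega^{kh}(x)c_hc_k\Big\}\omega_{ij}(x)+c_ic_j+\sum_k c_k\gamma^k_{ij}(x).$$ For $C^\infty$ functions $\rho_0,\rho_1,\dots,\rho_n$ on an open subset of $\Omega$, pulling back the Pfaff system $P_c$ generated by $dc_0-\sum_i c_i\,dx^i$ and $dc_i-\sum_j F_{ij}\,dx^j$ by the section $c_\nu=\rho_\nu(x)$ gives the 1-forms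 $\sigma_0=\sum_i\mathcal A_i\,dx^i$ and $\sigma_i=\sum_j\mathcal B_{j,i}\,dx^j$, with the $n(n+1)$ potential functions $$\mathcal A_i=\partial_i\rho_0-\rho_i,\qquad \mathcal B_{j,i}=\partial_j\rho_i-F_{ij}(x,\rho_0,\rho_1,\dots,\rho_n).$$ **Theorem 1.** There are an open set $W\subseteq\Omega\times\mathbb R^{n+1}$, a single analytic function $u:W\to\mathbb R$ and $\tau=(\tau_0,\dots,\tau_n)$ with $(x_0,\tau)\in W$, such that * each $u(\cdot,\tau')$ solves the c system on $\{x:(x,\tau')\in W\}$; the map $(x,\tau')\mapsto(x,u(x,\tau'),\partial_{x^1}u(x,\tau'),\dots,\partial_{x^n}u(x,\tau'))$ is injective on $W$; and $u(x,\tau)=0$ whenever $(x,\tau)\in W$, in particular $u(x_0,\tau)=0$; * for every analytic solution $\alpha$ of the c system on an open neighbourhood $V\subseteq\Omega$ of $x_0$ there are an open set $U\subseteq V$ containing $x_0$ and starlike with respect to $x_0$, a point $x_0'\in U$, and $C^\infty$ functions $\rho_0,\rho_1,\dots,\rho_n$ on $U$ with $\rho_0(x_0)=\rho_i(x_0)=0$,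 $\rho_0(x_0')=\alpha(x_0')$ and $\rho_i(x_0')=\partial_i\alpha(x_0')$ for $1\le i\le n$, such that for all $x\in U$ $$\alpha(x)=u\Big(x,\ \tau_0+\int_{x_0}^{x_0'}\sum_i\mathcal A_i\,dx'^i,\ \tau_1+\int_{x_0}^{x_0'}\sum_j\mathcal B_{j,1}\,dx'^j,\ \dots,\ \tau_n+\int_{x_0}^{x_0'}\sum_j\mathcal B_{j,n}\,dx'^j\Big),$$ where the integrals are taken along the straight segment from $x_0$ to $x_0'$ and the point on the right lies in $W$. Moreover $x_0'$ may be replaced by $v(x)$ in this formula for every $C^1$ map $v:U\to U$ with $v(x_0)=x_0'$ whose derivatives are annihilated by $\sigma_0,\dots,\sigma_n$, that is, $\sum_i\mathcal A_i(v(x))\,\partial_kv^i(x)=0$ and $\sum_j\mathcal B_{j,i}(v(x))\,\partial_kv^j(x)=0$ for all $i$, all $k$ and all $x\in U$; the integrals are then taken along the segment from $x_0$ to $x_0'$ followed by the curve $t\mapsto v(x_0+t(x-x_0))$, $0\le t\le1$. -/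

import Mathlib

noncomputable section

/-- The partial derivative `∂ᵢ f` of a real function on `ℝⁿ`. -/
def partialD {n : ℕ} (i : Fin n) (f : (Fin n → ℝ) → ℝ) (x : Fin n → ℝ) : ℝ :=
  fderiv ℝ f x (Pi.single i 1)

/-- `ω` is an analytic pseudo-Riemannian metric (of any signature) on the set `Ω ⊆ ℝⁿ`, given by
its matrix of components. -/
structure IsAnalyticMetric {n : ℕ} (ω : (Fin n → ℝ) → Matrix (Fin n) (Fin n) ℝ)
    (Ω : Set (Fin n → ℝ)) : Prop where
  symm : ∀ x ∈ Ω, (ω x).IsSymm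
  nondegenerate : ∀ x ∈ Ω, (ω x).det ≠ 0
  analytic : ∀ i j, AnalyticOnNhd ℝ (fun x => ω x i j) Ω

/-- The Christoffel symbol `γᵏᵢⱼ` of the Levi-Civita connection of `ω`. -/
def christoffel {n : ℕ} (ω : (Fin n → ℝ) → Matrix (Fin n) (Fin n) ℝ) (k i j : Fin n)
    (x : Fin n → ℝ) : ℝ :=
  1 / 2 * ∑ l, (ω x)⁻¹ k l *
    (partialD i (fun y => ω y l j) x + partialD j (fun y => ω y l i) x
      - partialD l (fun y => ω y i j) x)

/-- The component of `∂ₗ` in `R(∂ᵢ, ∂ⱼ) ∂ₖ`, where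
`R(X, Y) Z = ∇_X ∇_Y Z - ∇_Y ∇_X Z - ∇_[X,Y] Z`. -/
def riemann {n : ℕ} (ω : (Fin n → ℝ) → Matrix (Fin n) (Fin n) ℝ) (l k i j : Fin n)
    (x : Fin n → ℝ) : ℝ :=
  partialD i (christoffel ω l j k) x - partialD j (christoffel ω l i k) x
    + ∑ m, (christoffel ω l i m x * christoffel ω m j k x
      - christoffel ω l j m x * christoffel ω m i k x)

/-- The Ricci tensor: `Ric(Y, Z)` is the trace of `X ↦ R(X, Y) Z`. -/
def ricci {n : ℕ} (ω : (Fin n → ℝ) → Matrix (Fin n) (Fin n) ℝ) (j k : Fin n)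
    (x : Fin n → ℝ) : ℝ :=
  ∑ i, riemann ω i k i j x

/-- The scalar curvature. -/
def scalarCurvature {n : ℕ} (ω : (Fin n → ℝ) → Matrix (Fin n) (Fin n) ℝ)
    (x : Fin n → ℝ) : ℝ :=
  ∑ j, ∑ k, (ω x)⁻¹ j k * ricci ω j k x

/-- The tensor `σ = Ric - S / (2 (n - 1)) ω`, with `S` the scalar curvature. -/
def sigmaTensor {n : ℕ} (ω : (Fin n → ℝ) → Matrix (Fin n) (Fin n) ℝ) (i j : Fin n)
    (x : Fin n → ℝ) : ℝ :=
  ricci ω i j x - scalarCurvature ω x / (2 * ((n : ℝ) - 1)) * ω x i j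

/-- S-admissibility of `ω` on `Ω` with constant `k₀`: the Weyl tensor of `ω` vanishes, i.e. the
Riemann tensor is the expression in `σ` below, and `Ric = (n - 1) k₀ ω`. -/
structure IsSAdmissible {n : ℕ} (k₀ : ℝ) (ω : (Fin n → ℝ) → Matrix (Fin n) (Fin n) ℝ)
    (Ω : Set (Fin n → ℝ)) : Prop where
  weyl_eq_zero : ∀ x ∈ Ω, ∀ i j k l : Fin n,
    ∑ m, ω x l m * riemann ω m k i j x =
      1 / ((n : ℝ) - 2) *
        (ω x i l * sigmaTensor ω j k x - ω x j l * sigmaTensor ω i k x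
          + ω x j k * sigmaTensor ω i l x - ω x i k * sigmaTensor ω j l x)
  ricci_eq : ∀ x ∈ Ω, ∀ i j : Fin n, ricci ω i j x = ((n : ℝ) - 1) * k₀ * ω x i j

/-- `Fᵢⱼ(x, c₀, c₁)`: the value which the c system prescribes for the second derivative `∂ᵢ∂ⱼα` at
a point `x` where `α` and its gradient take the values `c₀` and `c`. -/
def cRHS {n : ℕ} (k₀ : ℝ) (ω : (Fin n → ℝ) → Matrix (Fin n) (Fin n) ℝ) (i j : Fin n)
    (x : Fin n → ℝ) (c₀ : ℝ) (c : Fin n → ℝ) : ℝ :=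
  1 / 2 * (k₀ * (1 - Real.exp (2 * c₀)) - ∑ k, ∑ h, (ω x)⁻¹ k h * c h * c k) * ω x i j
    + c i * c j + ∑ k, c k * christoffel ω k i j x

/-- The gradient `(∂₁α, …, ∂ₙα)`, in components. -/
def gradient₁ {n : ℕ} (α : (Fin n → ℝ) → ℝ) (x : Fin n → ℝ) : Fin n → ℝ :=
  fun i => partialD i α x

/-- `α` satisfies the equations `∂ᵢ∂ⱼα = Fᵢⱼ(x, α, ∂₁α, …, ∂ₙα)` of the c system at `x`. -/
def CSystemAt {n : ℕ} (k₀ : ℝ) (ω : (Fin n → ℝ) → Matrix (Fin n) (Fin n) ℝ)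
    (α : (Fin n → ℝ) → ℝ) (x : Fin n → ℝ) : Prop :=
  ∀ i j : Fin n, partialD i (partialD j α) x = cRHS k₀ ω i j x (α x) (gradient₁ α x)

/-- The potential functions `𝒜ᵢ = ∂ᵢρ₀ - ρᵢ`. -/
def potentialA {n : ℕ} (ρ₀ : (Fin n → ℝ) → ℝ) (ρ : Fin n → (Fin n → ℝ) → ℝ) (i : Fin n)
    (x : Fin n → ℝ) : ℝ :=
  partialD i ρ₀ x - ρ i x

/-- The potential functions `ℬⱼᵢ = ∂ⱼρᵢ - Fᵢⱼ(x, ρ₀, ρ₁, …, ρₙ)`. -/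
def potentialB {n : ℕ} (k₀ : ℝ) (ω : (Fin n → ℝ) → Matrix (Fin n) (Fin n) ℝ)
    (ρ₀ : (Fin n → ℝ) → ℝ) (ρ : Fin n → (Fin n → ℝ) → ℝ) (j i : Fin n) (x : Fin n → ℝ) : ℝ :=
  partialD j (ρ i) x - cRHS k₀ ω i j x (ρ₀ x) (fun k => ρ k x)

/-- The 1-form `∑ᵢ θᵢ dxⁱ` on `ℝⁿ`. -/
def oneForm {n : ℕ} (θ : Fin n → (Fin n → ℝ) → ℝ) (x : Fin n → ℝ) : (Fin n → ℝ) →L[ℝ] ℝ :=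
  ∑ i, θ i x • ContinuousLinearMap.proj (R := ℝ) (φ := fun _ : Fin n => ℝ) i

/-- The pull-back `σ₀ = ∑ᵢ 𝒜ᵢ dxⁱ` of the form `dc₀ - ∑ᵢ cᵢ dxⁱ` by the section `(ρ₀, ρ)`. -/
def sigma₀ {n : ℕ} (ρ₀ : (Fin n → ℝ) → ℝ) (ρ : Fin n → (Fin n → ℝ) → ℝ) :
    (Fin n → ℝ) → (Fin n → ℝ) →L[ℝ] ℝ :=
  oneForm (potentialA ρ₀ ρ)

/-- The pull-back `σᵢ = ∑ⱼ ℬⱼᵢ dxʲ` of the form `dcᵢ - ∑ⱼ Fᵢⱼ(x, c₀, c₁, …, cₙ) dxʲ` by the section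
`(ρ₀, ρ)`. -/
def sigma₁ {n : ℕ} (k₀ : ℝ) (ω : (Fin n → ℝ) → Matrix (Fin n) (Fin n) ℝ)
    (ρ₀ : (Fin n → ℝ) → ℝ) (ρ : Fin n → (Fin n → ℝ) → ℝ) (i : Fin n) :
    (Fin n → ℝ) → (Fin n → ℝ) →L[ℝ] ℝ :=
  oneForm (fun j => potentialB k₀ ω ρ₀ ρ j i)

/-- The parameters `(τ₀ + ∫ σ₀, τ₁ + ∫ σ₁, …, τₙ + ∫ σₙ)`, with integrals along the path `γ`. -/
def shiftedParam {n : ℕ} (k₀ : ℝ) (ω : (Fin n → ℝ) → Matrix (Fin n) (Fin n) ℝ)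
    (ρ₀ : (Fin n → ℝ) → ℝ) (ρ : Fin n → (Fin n → ℝ) → ℝ) (τ : ℝ × (Fin n → ℝ))
    {a b : Fin n → ℝ} (γ : Path a b) : ℝ × (Fin n → ℝ) :=
  (τ.1 + curveIntegral (sigma₀ ρ₀ ρ) γ,
    fun i => τ.2 i + curveIntegral (sigma₁ k₀ ω ρ₀ ρ i) γ)

end

/-! The nonlinear c system is a linear system in disguise. For a solution `α` put `f = exp (-α)`, `p
= df` and `h = ½ exp (-α) (k₀ (exp (2α) - 1) + |dα|²)`. Then `∂ᵢf = pᵢ`, `∂ᵢpⱼ = h ωᵢⱼ + ∑ₖ γᵏᵢⱼ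
pₖ`, `∂ᵢh = -k₀ pᵢ`: the state `(f, p, h)` is parallel for `cConnection`. S-admissibility forces
constant sectional curvature `k₀` (`riemann_eq`), and this makes the connection flat
(`cConnection_flat`). The quantity `2fh + k₀f² - |p|²` is a first integral; among states with `f >
0`, those coming from 1-jets are exactly its level `k₀`.

A flat analytic connection has an analytic fundamental solution `Φ` near `x₀`
(`exists_fundamental_solution`). Hence `u(x, τ) = -log` of the first entry of `Φ x (jetState τ)` is
a general solution whose parameter `τ` is the 1-jet at `x₀`. Injectivity comes from invertibility of
`Φ x`, and `τ = 0` labels the null solution. A given `α` is represented by its own 1-jet at `x₀`, so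
what remains is to find a section whose integrals of `σ₀, …, σₙ` are exactly `α(x₀), ∂₁α(x₀), …,
∂ₙα(x₀)`.

Along a short segment from `x₀` to `x₀ + εd`, take `ρ₀ = α - θ α(x₀)` and `ρᵢ = ∂ᵢα - θ ∂ᵢα(x₀) + φ
aᵢ + ψ bᵢ`. Here `θ` has mean zero and falls from 1 to 0, while the bumps `φ`, `ψ` vanish at both
ends and have mean zero. The boundary values then already give the wanted integrals, up to the mean
of `Fᵢⱼ(ρ) - Fᵢⱼ(∂α)` contracted with the segment. After division by `ε`, orthonormality of the
bumps reduces its vanishing at `ε = 0` to `Q(a) + Q(b) = const`, with `Q(c) = -½|c|² ω d + ⟨c, d⟩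
c`. Choosing `d` with an orthogonal `e` of squared length of the same sign, possible from dimension
3 on, makes this solvable at a point where the derivative is surjective
(`exists_cQuadratic_add_eq`), and the solution persists for small `ε`. Following `v` adds nothing,
since the forms vanish on its derivatives. -/

noncomputable section

open Filter Topology unitInterval BoundedContinuousFunction

/-! ### Radial linear differential equations depending analytically on the ray. -/

section Linear

variable {E X X' Y : Type*} [NormedAddCommGroup E] [NormedSpace ℝ E] [NormedAddCommGroup X]
  [NormedSpace ℝ X] [NormedAddCommGroup X'] [NormedSpace ℝ X'] [NormedAddCommGroup Y]
  [NormedSpace ℝ Y]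

theorem AnalyticAt.clm_const_apply {A : E → X} {x₀ : E} (hA : AnalyticAt ℝ A x₀) (b : X →L[ℝ] Y) :
    AnalyticAt ℝ (fun x => b (A x)) x₀ :=
  AnalyticAt.comp (b.analyticAt _) hA

theorem AnalyticAt.bilinear_apply {A : E → X} {g : E → X'} {x₀ : E} (hA : AnalyticAt ℝ A x₀)
    (hg : AnalyticAt ℝ g x₀) (b : X →L[ℝ] X' →L[ℝ] Y) :
    AnalyticAt ℝ (fun x => b (A x) (g x)) x₀ :=
  AnalyticAt.comp (g := fun q : X × X' => b q.1 q.2) (f := fun x => (A x, g x))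
    (b.analyticAt_bilinear _) (hA.prod hg)

end Linear

/-- The path `t ↦ t ^ m • e` on the unit interval, as a continuous linear function of `e`. -/
def monomialPath (F : Type*) [NormedAddCommGroup F] [NormedSpace ℝ F] (m : ℕ) :
    F →L[ℝ] (I →ᵇ F) :=
  LinearMap.mkContinuous
    { toFun := fun e => mkOfCompact ⟨fun t => (t : ℝ) ^ m • e, by fun_prop⟩
      map_add' := fun a b => by ext t; simp
      map_smul' := fun c a => by ext t; simp [smul_comm c] } 1 (by
    intro e
    refine (BoundedContinuousFunction.norm_le (by positivity)).2 fun t => ?_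
    change ‖(t : ℝ) ^ m • e‖ ≤ _
    rw [norm_smul, norm_pow, Real.norm_of_nonneg t.2.1]
    gcongr
    exact pow_le_one₀ t.2.1 t.2.2)

@[simp] theorem monomialPath_apply {F : Type*} [NormedAddCommGroup F] [NormedSpace ℝ F] (m : ℕ)
    (e : F) (t : I) : monomialPath F m e t = (t : ℝ) ^ m • e := rfl

theorem norm_monomialPath_le (F : Type*) [NormedAddCommGroup F] [NormedSpace ℝ F] (m : ℕ) :
    ‖monomialPath F m‖ ≤ 1 :=
  LinearMap.mkContinuous_norm_le _ zero_le_one _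

/-- An analytic function restricted to the rays from a point is an analytic function of the ray,
with values in the space of continuous paths. -/
theorem AnalyticAt.exists_analyticAt_rays {E F : Type*} [NormedAddCommGroup E] [NormedSpace ℝ E]
    [NormedAddCommGroup F] [NormedSpace ℝ F] [CompleteSpace F] {f : E → F} {x₀ : E}
    (hf : AnalyticAt ℝ f x₀) :
    ∃ A : E → (I →ᵇ F), AnalyticAt ℝ A 0 ∧
      ∀ᶠ x in 𝓝 (0 : E), ∀ t : I, A x t = f (x₀ + (t : ℝ) • x) := by
  obtain ⟨p, r, hp⟩ := hf
  -- The term of degree `m` of the expansion at `t • x` is `t ^ m` times that at `x`, so the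
  -- expansion along the whole ray is a power series in `x` with values in paths, of no smaller
  -- radius.
  let q : FormalMultilinearSeries ℝ E (I →ᵇ F) := fun m =>
    (monomialPath F m).compContinuousMultilinearMap (p m)
  have hq : p.radius ≤ q.radius := by
    refine FormalMultilinearSeries.radius_le_of_le fun m => ?_
    refine (ContinuousLinearMap.norm_compContinuousMultilinearMap_le _ _).trans ?_
    exact mul_le_of_le_one_left (norm_nonneg _) (norm_monomialPath_le F m)
  have hr : r ≤ q.radius := hp.r_le.trans hq
  have hsum := q.hasFPowerSeriesOnBall (hp.r_pos.trans_le hr)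
  refine ⟨q.sum, hsum.analyticAt, ?_⟩
  filter_upwards [Metric.eball_mem_nhds (0 : E) hp.r_pos] with x hx t
  have h1 : HasSum (fun m => q m fun _ => x) (q.sum x) := by
    simpa using hsum.hasSum (Metric.eball_subset_eball hr hx)
  have h2 : HasSum (fun m => (q m fun _ => x) t) (q.sum x t) :=
    h1.map (BoundedContinuousFunction.evalCLM ℝ t) (BoundedContinuousFunction.evalCLM ℝ t).continuous
  have htx : (t : ℝ) • x ∈ Metric.eball (0 : E) r := by
    rw [Metric.mem_eball, edist_zero_right] at hx ⊢
    refine lt_of_le_of_lt ?_ hx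
    rw [enorm_smul]
    refine mul_le_of_le_one_left (by positivity) ?_
    rw [Real.enorm_of_nonneg t.2.1]
    exact ENNReal.ofReal_le_one.2 t.2.2
  have h3 := hp.hasSum htx
  refine h2.unique ?_
  convert h3 using 2 with m
  simp only [q, ContinuousLinearMap.compContinuousMultilinearMap_coe, Function.comp_apply,
    monomialPath_apply]
  rw [ContinuousMultilinearMap.map_smul_univ (p m) (fun _ => (t : ℝ)) (fun _ => x)]
  simp

section Volterra

variable {F : Type*} [NormedAddCommGroup F] [NormedSpace ℝ F] [CompleteSpace F]

/-- The primitive vanishing at `0` of a continuous path. -/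
def primitivePath (F : Type*) [NormedAddCommGroup F] [NormedSpace ℝ F] [CompleteSpace F] :
    (I →ᵇ F) →L[ℝ] (I →ᵇ F) :=
  LinearMap.mkContinuous
    { toFun := fun f => mkOfCompact ⟨fun t => ∫ s in (0 : ℝ)..t, Set.IccExtend zero_le_one f s, by
        have : Continuous (Set.IccExtend (zero_le_one (α := ℝ)) f) := f.continuous.Icc_extend'
        exact (intervalIntegral.continuous_primitive
          (fun a b => this.intervalIntegrable a b) 0).comp continuous_subtype_val⟩
      map_add' := fun f g => by
        have hf : Continuous (Set.IccExtend (zero_le_one (α := ℝ)) f) := f.continuous.Icc_extend'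
        have hg : Continuous (Set.IccExtend (zero_le_one (α := ℝ)) g) := g.continuous.Icc_extend'
        ext t
        exact intervalIntegral.integral_add (hf.intervalIntegrable 0 t) (hg.intervalIntegrable 0 t)
      map_smul' := fun c f => by
        ext t
        exact intervalIntegral.integral_smul c _ } 1 (by
    intro f
    refine (BoundedContinuousFunction.norm_le (by positivity)).2 fun t => ?_
    refine (intervalIntegral.norm_integral_le_of_norm_le_const (C := ‖f‖) fun s _ => ?_).trans ?_
    · exact f.norm_coe_le_norm _
    · rw [sub_zero, abs_of_nonneg t.2.1, one_mul]
      exact mul_le_of_le_one_right (norm_nonneg _) t.2.2)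

theorem primitivePath_apply (f : (I →ᵇ F)) (t : I) :
    primitivePath F f t = ∫ s in (0 : ℝ)..t, Set.IccExtend zero_le_one f s := rfl

end Volterra

section Flat

variable {E 𝔸 : Type*} [NormedAddCommGroup E] [NormedSpace ℝ E] [NormedRing 𝔸]
  [NormedAlgebra ℝ 𝔸] [CompleteSpace 𝔸]

/-- Evaluation of a path of linear maps at a fixed vector, as a bilinear map. -/
def evalPath (E F : Type*) [NormedAddCommGroup E] [NormedSpace ℝ E] [NormedAddCommGroup F]
    [NormedSpace ℝ F] : (I →ᵇ (E →L[ℝ] F)) →L[ℝ] E →L[ℝ] (I →ᵇ F) :=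
  LinearMap.mkContinuous₂
    (LinearMap.mk₂ ℝ (fun (f : (I →ᵇ (E →L[ℝ] F))) x => (mkOfCompact ⟨fun t => f t x, f.continuous.clm_apply continuous_const⟩ : (I →ᵇ F)))
      (fun f g x => by ext t; simp) (fun c f x => by ext t; simp)
      (fun f x y => by ext t; simp) (fun c f x => by ext t; simp)) 1 (by
    intro f x
    rw [one_mul]
    refine (BoundedContinuousFunction.norm_le (by positivity)).2 fun t => ?_
    exact ((f t).le_opNorm x).trans (by gcongr; exact f.norm_coe_le_norm t))

@[simp] theorem evalPath_apply {E F : Type*} [NormedAddCommGroup E] [NormedSpace ℝ E]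
    [NormedAddCommGroup F] [NormedSpace ℝ F] (f : (I →ᵇ (E →L[ℝ] F))) (x : E) (t : I) :
    evalPath E F f x t = f t x := rfl

/-- The fixed points of an analytic family of affine maps, linear part near zero, form an analytic
family. -/
theorem AnalyticAt.exists_fixedPoint {X : Type*} [NormedAddCommGroup X] [NormedSpace ℝ X]
    [CompleteSpace X] {V : E → X →L[ℝ] X} {x₀ : E} (hV : AnalyticAt ℝ V x₀) (hV0 : V x₀ = 0)
    (b : X) :
    ∃ Y : E → X, AnalyticAt ℝ Y x₀ ∧ ∀ᶠ x in 𝓝 x₀, ∀ Z, Z = Y x ↔ Z - V x Z = b := by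
  -- The fixed point is `(1 - V x)⁻¹ b`. Since `V x₀ = 0`, the operator `1 - V x` is invertible near
  -- `x₀`, and inversion in a Banach algebra is analytic at units.
  have hunit : AnalyticAt ℝ (fun x => Ring.inverse (1 - V x)) x₀ := by
    have h1 : AnalyticAt ℝ Ring.inverse (1 - V x₀) := by
      rw [hV0, sub_zero]
      simpa using analyticAt_inverse (𝕜 := ℝ) (1 : (X →L[ℝ] X)ˣ)
    exact h1.comp (f := fun x => 1 - V x) (analyticAt_const.sub hV)
  refine ⟨fun x => Ring.inverse (1 - V x) b,
    (ContinuousLinearMap.analyticAt (ContinuousLinearMap.apply ℝ X b) _).comp hunit, ?_⟩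
  have hu : ∀ᶠ x in 𝓝 x₀, IsUnit (1 - V x) := by
    have hc : ContinuousAt (fun x => 1 - V x) x₀ := (analyticAt_const.sub hV).continuousAt
    refine hc.eventually_mem (Units.isOpen.mem_nhds ?_)
    simp [hV0]
  filter_upwards [hu] with x hux Z
  have hZ : Z - V x Z = (1 - V x) Z := by simp
  rw [hZ]
  constructor
  · rintro rfl
    exact DFunLike.congr_fun (Ring.mul_inverse_cancel _ hux) b
  · intro h
    have := DFunLike.congr_fun (Ring.inverse_mul_cancel _ hux) Z
    rw [_root_.mul_apply_eq_comp, h] at this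
    exact this.symm

/-- The Volterra operator `Z ↦ ∫₀ᵗ B Z`, as a linear function of `B`. -/
def volterra (𝔸 : Type*) [NormedRing 𝔸] [NormedAlgebra ℝ 𝔸] [CompleteSpace 𝔸] :
    (I →ᵇ 𝔸) →L[ℝ] (I →ᵇ 𝔸) →L[ℝ] (I →ᵇ 𝔸) :=
  (ContinuousLinearMap.compL ℝ (I →ᵇ 𝔸) (I →ᵇ 𝔸) (I →ᵇ 𝔸) (primitivePath 𝔸)).comp
    (ContinuousLinearMap.mul ℝ (I →ᵇ 𝔸))

theorem volterra_apply (B Z : (I →ᵇ 𝔸)) (t : I) :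
    volterra 𝔸 B Z t = ∫ s in (0 : ℝ)..t, Set.IccExtend zero_le_one (B * Z) s := by
  rw [volterra, ContinuousLinearMap.comp_apply, ContinuousLinearMap.compL_apply,
    ContinuousLinearMap.comp_apply, ContinuousLinearMap.mul_apply', primitivePath_apply]

/-- The solutions of `y' = M (t x) x y`, `y 0 = 1`, along the rays through the origin depend
analytically on `x`. -/
theorem exists_analyticAt_radial_solution {M : E → E →L[ℝ] 𝔸} (hM : AnalyticAt ℝ M 0) :
    ∃ Y : E → (I →ᵇ 𝔸), AnalyticAt ℝ Y 0 ∧ ∀ᶠ x in 𝓝 (0 : E), ∀ Z : (I →ᵇ 𝔸), (Z = Y x ↔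
        ∀ t : I, Z t = 1 + ∫ s in (0 : ℝ)..t, M (s • x) x * Set.IccExtend zero_le_one Z s) := by
  obtain ⟨A, hA, hAM⟩ := hM.exists_analyticAt_rays
  simp only [zero_add] at hAM
  let B : E → (I →ᵇ 𝔸) := fun x => evalPath E 𝔸 (A x) x
  have hB : AnalyticAt ℝ B 0 :=
    AnalyticAt.bilinear_apply (X := I →ᵇ (E →L[ℝ] 𝔸)) (Y := I →ᵇ 𝔸) hA analyticAt_id
      (evalPath E 𝔸)
  have hV : AnalyticAt ℝ (fun x => volterra 𝔸 (B x)) 0 :=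
    AnalyticAt.clm_const_apply (X := I →ᵇ 𝔸) (Y := (I →ᵇ 𝔸) →L[ℝ] (I →ᵇ 𝔸)) hB (volterra 𝔸)
  -- The coefficient path `B x` is evaluated at the vector `x`, hence zero at `x = 0`; the Volterra
  -- operator is therefore small for short rays.
  obtain ⟨Y, hY, hYx⟩ := hV.exists_fixedPoint (by simp [B]) 1
  refine ⟨Y, hY, ?_⟩
  filter_upwards [hYx, hAM] with x hx hAx Z
  rw [hx Z, BoundedContinuousFunction.ext_iff]
  refine forall_congr' fun t => ?_
  rw [BoundedContinuousFunction.sub_apply, show (1 : I →ᵇ 𝔸) t = 1 from rfl, sub_eq_iff_eq_add, volterra_apply]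
  have : ∫ s in (0 : ℝ)..t, Set.IccExtend zero_le_one (B x * Z) s
      = ∫ s in (0 : ℝ)..t, M (s • x) x * Set.IccExtend zero_le_one Z s := by
    refine intervalIntegral.integral_congr fun s hs => ?_
    rw [Set.uIcc_of_le t.2.1] at hs
    have hs' : s ∈ I := ⟨hs.1, hs.2.trans t.2.2⟩
    simp only [Set.IccExtend_of_mem _ _ hs', BoundedContinuousFunction.mul_apply, B, evalPath_apply, hAx]
  rw [this]

end Flat

end

/-! ### Uniqueness and fundamental solutions of flat linear systems. -/

noncomputable section

open Filter Topology unitInterval BoundedContinuousFunction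

/-- Uniqueness for a linear differential equation with zero initial value. -/
theorem eq_zero_of_hasDerivAt_linear {F : Type*} [NormedAddCommGroup F] [NormedSpace ℝ F]
    {A : ℝ → F →L[ℝ] F} {z : ℝ → F} (hA : ContinuousOn A I)
    (hz : ∀ t ∈ I, HasDerivAt z (A t (z t)) t) (h0 : z 0 = 0) : ∀ t ∈ I, z t = 0 := by
  obtain ⟨K, hK⟩ := isCompact_Icc.exists_bound_of_continuousOn hA
  refine eq_zero_of_abs_deriv_le_mul_abs_self_of_eq_zero_right (K := K)
    (fun t ht => (hz t ht).continuousAt.continuousWithinAt)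
    (fun t ht => (hz t ⟨ht.1, ht.2.le⟩).hasDerivWithinAt) h0 fun t ht => ?_
  exact ((A t).le_opNorm _).trans (by gcongr; exact hK t ⟨ht.1, ht.2.le⟩)

theorem smul_mem_ball_zero {E : Type*} [NormedAddCommGroup E] [NormedSpace ℝ E] {r : ℝ} {x : E}
    (hx : x ∈ Metric.ball (0 : E) r) {t : ℝ} (ht : t ∈ I) : t • x ∈ Metric.ball (0 : E) r := by
  rw [mem_ball_zero_iff] at hx ⊢
  rw [norm_smul, Real.norm_of_nonneg ht.1]
  exact (mul_le_of_le_one_left (norm_nonneg _) ht.2).trans_lt hx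

/-- Uniqueness for the system `Df x h = L x h (f x)` on a star-convex open set. -/
theorem eqOn_zero_of_fderiv_eq_linear {E F : Type*} [NormedAddCommGroup E] [NormedSpace ℝ E]
    [NormedAddCommGroup F] [NormedSpace ℝ F] {s : Set E} {x₀ : E} (hs : StarConvex ℝ x₀ s)
    {L : E → E →L[ℝ] F →L[ℝ] F} (hL : ContinuousOn L s) {f : E → F}
    (hf : ∀ x ∈ s, DifferentiableAt ℝ f x) (hfL : ∀ x ∈ s, ∀ h, fderiv ℝ f x h = L x h (f x))
    (h0 : f x₀ = 0) : ∀ x ∈ s, f x = 0 := by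
  intro x hx
  have hmem : ∀ t ∈ I, x₀ + t • (x - x₀) ∈ s := fun t ht =>
    hs.add_smul_sub_mem hx ht.1 ht.2
  have hline : ∀ t : ℝ, HasDerivAt (fun t : ℝ => x₀ + t • (x - x₀)) (x - x₀) t := fun t => by
    simpa using ((hasDerivAt_id t).smul_const (x - x₀)).const_add x₀
  have := eq_zero_of_hasDerivAt_linear (A := fun t => L (x₀ + t • (x - x₀)) (x - x₀))
    (z := fun t => f (x₀ + t • (x - x₀)))
    ((hL.comp (by fun_prop) hmem).clm_apply continuousOn_const) (fun t ht => by
      have h := (hf _ (hmem t ht)).hasFDerivAt.comp_hasDerivAt t (hline t)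
      rwa [hfL _ (hmem t ht)] at h) (by simpa using h0) 1 ⟨zero_le_one, le_rfl⟩
  simpa using this

section Flat

variable {E 𝔸 : Type*} [NormedAddCommGroup E] [NormedSpace ℝ E] [NormedRing 𝔸]
  [NormedAlgebra ℝ 𝔸] [CompleteSpace 𝔸]

/-- A solution of a flat linear system along the rays from the origin is a solution. -/
theorem fderiv_eq_of_radial {M : E → E →L[ℝ] 𝔸} {y : E → 𝔸} {r : ℝ}
    (hM : ∀ x ∈ Metric.ball (0 : E) r, AnalyticAt ℝ M x)
    (hy : ∀ x ∈ Metric.ball (0 : E) r, AnalyticAt ℝ y x)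
    (hflat : ∀ x ∈ Metric.ball (0 : E) r, ∀ h k,
      fderiv ℝ M x h k + M x k * M x h = fderiv ℝ M x k h + M x h * M x k)
    (hrad : ∀ x ∈ Metric.ball (0 : E) r, fderiv ℝ y x x = M x x * y x) :
    ∀ x ∈ Metric.ball (0 : E) r, ∀ h, fderiv ℝ y x h = M x h * y x := by
  intro x hx h
  have hmem : ∀ t ∈ I, t • x ∈ Metric.ball (0 : E) r := fun t ht => smul_mem_ball_zero hx ht
  have hline : ∀ t : ℝ, HasDerivAt (fun t : ℝ => t • x) x t := fun t => by
    simpa using (hasDerivAt_id t).smul_const x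
  -- The defect `Dy h - M h y` at `t • x`, multiplied by `t`, solves the linear equation `z' = M (t
  -- • x) x z`: flatness is exactly what closes this equation. The factor `t` gives the zero initial
  -- value, and `t = 1` is the claim.
  have hz := eq_zero_of_hasDerivAt_linear
    (A := fun t => ContinuousLinearMap.mul ℝ 𝔸 (M (t • x) x))
    (z := fun t => t • (fderiv ℝ y (t • x) h - M (t • x) h * y (t • x))) ?_ ?_ (by simp) 1
    ⟨zero_le_one, le_rfl⟩
  · simpa [sub_eq_zero] using hz
  · refine (ContinuousLinearMap.mul ℝ 𝔸).continuous.comp_continuousOn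
      (ContinuousOn.clm_apply ?_ continuousOn_const)
    intro t ht
    exact (ContinuousAt.comp (f := fun t : ℝ => t • x) (hM _ (hmem t ht)).continuousAt
      (by fun_prop)).continuousWithinAt
  · intro t ht
    set w := t • x with hw
    have hwr := hmem t ht
    have hyw := (hy w hwr).differentiableAt.hasFDerivAt
    have hMw := (hM w hwr).differentiableAt.hasFDerivAt
    have hy2 := (hy w hwr).fderiv.differentiableAt.hasFDerivAt
    have hsymm : fderiv ℝ (fderiv ℝ y) w w h = fderiv ℝ (fderiv ℝ y) w h w :=
      ((hy w hwr).contDiffAt (n := 2)).isSymmSndFDerivAt (by simp) w h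
    -- the radial equation, differentiated in the direction `h`
    have hR : fderiv ℝ (fderiv ℝ y) w h w + fderiv ℝ y w h =
        (fderiv ℝ M w h w + M w h) * y w + M w w * fderiv ℝ y w h := by
      have h1 := hy2.clm_apply (hasFDerivAt_id w)
      have h2 := (hMw.clm_apply (hasFDerivAt_id w)).mul' hyw
      have h3 : (fun x => fderiv ℝ y x (id x)) =ᶠ[𝓝 w] fun x => M x (id x) * y x := by
        filter_upwards [Metric.isOpen_ball.mem_nhds hwr] with v hv using hrad v hv
      have h4 := DFunLike.congr_fun ((h1.congr_of_eventuallyEq h3.symm).unique h2) h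
      simp only [_root_.add_apply, ContinuousLinearMap.comp_apply,
        ContinuousLinearMap.flip_apply, _root_.smul_apply, id_eq,
        ContinuousLinearMap.id_apply, smul_eq_mul, op_smul_eq_mul] at h4
      rw [add_comm, h4]
      noncomm_ring
    have e1 : HasDerivAt (fun t : ℝ => fderiv ℝ y (t • x) h)
        (fderiv ℝ (fderiv ℝ y) w x h) t := by
      have := hy2.comp_hasDerivAt t (hline t)
      simpa using this.clm_apply (hasDerivAt_const t h)
    have e2 : HasDerivAt (fun t : ℝ => M (t • x) h) (fderiv ℝ M w x h) t := by
      have := hMw.comp_hasDerivAt t (hline t)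
      simpa using this.clm_apply (hasDerivAt_const t h)
    have e3 : HasDerivAt (fun t : ℝ => y (t • x)) (fderiv ℝ y w x) t :=
      hyw.comp_hasDerivAt t (hline t)
    have e4 := (hasDerivAt_id t).smul (e1.sub (e2.mul e3))
    refine e4.congr_deriv ?_
    have hrw := hrad w hwr
    have hD2 : t • fderiv ℝ (fderiv ℝ y) w x h = fderiv ℝ (fderiv ℝ y) w w h := by
      conv_rhs => rw [show fderiv ℝ (fderiv ℝ y) w w = fderiv ℝ (fderiv ℝ y) w (t • x) from rfl]
      simp
    have hDM : t • fderiv ℝ M w x h = fderiv ℝ M w w h := by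
      conv_rhs => rw [show fderiv ℝ M w w = fderiv ℝ M w (t • x) from rfl]
      simp
    have hDy : t • fderiv ℝ y w x = fderiv ℝ y w w := by
      conv_rhs => rw [show fderiv ℝ y w w = fderiv ℝ y w (t • x) from rfl]
      simp
    have hMx : t • M w x = M w w := by
      conv_rhs => rw [show M w w = M w (t • x) from rfl]
      simp
    have hfl := hflat w hwr h w
    have hfl' : fderiv ℝ M w h w = fderiv ℝ M w w h + M w h * M w w - M w w * M w h := by
      rw [← hfl]; abel
    rw [ContinuousLinearMap.mul_apply', mul_smul_comm, ← smul_mul_assoc, hMx]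
    simp only [id, one_smul, smul_sub, smul_add, Pi.sub_apply, Pi.mul_apply]
    rw [← hw, hD2, ← smul_mul_assoc, hDM, ← mul_smul_comm, hDy, hrw, hsymm,
      eq_sub_of_add_eq hR, hfl']
    noncomm_ring

/-- The linear equation `dy = M y` has an analytic solution near `0` along radial directions. -/
theorem exists_analyticAt_radial {M : E → E →L[ℝ] 𝔸} (hM : AnalyticAt ℝ M 0) :
    ∃ y : E → 𝔸, AnalyticAt ℝ y 0 ∧ y 0 = 1 ∧
      ∀ᶠ x in 𝓝 (0 : E), fderiv ℝ y x x = M x x * y x := by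
  obtain ⟨Y, hY, hYx⟩ := exists_analyticAt_radial_solution hM
  have hy : AnalyticAt ℝ (fun x => Y x 1) 0 :=
    AnalyticAt.clm_const_apply (X := I →ᵇ 𝔸) hY (BoundedContinuousFunction.evalCLM ℝ (1 : I))
  refine ⟨fun x => Y x 1, hy, ?_, ?_⟩
  · have := (hYx.self_of_nhds (Y 0)).1 rfl 1
    simpa using this
  obtain ⟨r, hr, hball⟩ := Metric.eventually_nhds_iff_ball.1
    ((hYx.and hM.eventually_analyticAt).and hy.eventually_analyticAt)
  -- The path `t ↦ Y x (τ t)` solves the integral equation of the shorter ray `τ • x`, so uniqueness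
  -- identifies it with `Y (τ • x)`. Radial derivatives of `Y · 1` become derivatives in `τ`.
  have hscale : ∀ x ∈ Metric.ball (0 : E) r, ∀ τ : I, Y ((τ : ℝ) • x) 1 = Y x τ := by
    intro x hx τ
    let Z : I →ᵇ 𝔸 := (Y x).compContinuous ⟨fun t => τ * t, by fun_prop⟩
    have hZ : Z = Y ((τ : ℝ) • x) := by
      refine ((hball _ (smul_mem_ball_zero hx τ.2)).1.1 Z).2 fun t => ?_
      have h1 := ((hball x hx).1.1 (Y x)).1 rfl (τ * t)
      change Y x (τ * t) = _
      rw [h1]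
      congr 1
      have h2 := intervalIntegral.smul_integral_comp_mul_left (a := 0) (b := (t : ℝ))
        (fun s => M (s • x) x * Set.IccExtend zero_le_one (Y x) s) (τ : ℝ)
      rw [mul_zero] at h2
      rw [Set.Icc.coe_mul, ← h2, ← intervalIntegral.integral_smul]
      refine intervalIntegral.integral_congr fun s hs => ?_
      rw [Set.uIcc_of_le t.2.1] at hs
      have hs' : s ∈ I := ⟨hs.1, hs.2.trans t.2.2⟩
      have hs'' : (τ : ℝ) * s ∈ I := unitInterval.mul_mem τ.2 hs'
      simp only [Set.IccExtend_of_mem _ _ hs', Set.IccExtend_of_mem _ _ hs'', map_smul,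
        smul_mul_assoc, smul_smul]
      rw [mul_comm s]
      rfl
    rw [← hZ]
    change Y x (τ * 1) = _
    rw [mul_one]
  filter_upwards [Metric.ball_mem_nhds (0 : E) (half_pos hr)] with x hx
  -- The point `x` is treated as the midpoint of the ray to `2 • x`: the parameter `1/2` is interior
  -- to the unit interval, so two-sided derivatives are available. The factor 2 cancels at the end.
  have hx2 : (2 : ℝ) • x ∈ Metric.ball (0 : E) r := by
    rw [mem_ball_zero_iff] at hx ⊢
    rw [norm_smul, Real.norm_of_nonneg zero_le_two]
    linarith
  have hxr : x ∈ Metric.ball (0 : E) r := Metric.ball_subset_ball (half_le_self hr.le) hx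
  have hd := (hball x hxr).2.differentiableAt.hasFDerivAt
  set x' := (2 : ℝ) • x with hx'
  have hxx : x = (1 / 2 : ℝ) • x' := by rw [hx', smul_smul]; norm_num
  have hcont : ContinuousOn (fun s : ℝ => M (s • x') x' * Set.IccExtend zero_le_one (Y x') s) I := by
    refine ContinuousOn.mul (ContinuousOn.clm_apply ?_ continuousOn_const)
      ((Y x').continuous.Icc_extend' : Continuous (Set.IccExtend (zero_le_one (α := ℝ)) (Y x'))).continuousOn
    intro t ht
    exact (ContinuousAt.comp (f := fun t : ℝ => t • x')
      (hball _ (smul_mem_ball_zero hx2 ht)).1.2.continuousAt (by fun_prop)).continuousWithinAt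
  have hI : I ∈ 𝓝 (1 / 2 : ℝ) := Icc_mem_nhds (by norm_num) (by norm_num)
  have hF : HasDerivAt (fun τ : ℝ => 1 + ∫ s in (0 : ℝ)..τ,
      M (s • x') x' * Set.IccExtend zero_le_one (Y x') s)
      (M ((1 / 2 : ℝ) • x') x' * Set.IccExtend zero_le_one (Y x') (1 / 2)) (1 / 2) := by
    refine (intervalIntegral.integral_hasDerivAt_right ?_ ?_ (hcont.continuousAt hI)).const_add 1
    · refine (hcont.mono ?_).intervalIntegrable
      rw [Set.uIcc_of_le (by norm_num)]
      exact Set.Icc_subset_Icc le_rfl (by norm_num)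
    · exact hcont.stronglyMeasurableAtFilter_nhdsWithin measurableSet_Icc _ |>.filter_mono
        (by rw [nhdsWithin_eq_nhds.2 hI])
  have hG : HasDerivAt (fun τ : ℝ => Y (τ • x') 1) (fderiv ℝ (fun x => Y x 1) x x') (1 / 2) := by
    have hline : HasDerivAt (fun t : ℝ => t • x') x' (1 / 2) := by
      simpa using (hasDerivAt_id (1 / 2 : ℝ)).smul_const x'
    rw [hxx] at hd ⊢
    exact hd.comp_hasDerivAt (1 / 2 : ℝ) hline
  have hev : (fun τ : ℝ => Y (τ • x') 1) =ᶠ[𝓝 (1 / 2 : ℝ)] fun τ : ℝ => 1 + ∫ s in (0 : ℝ)..τ,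
      M (s • x') x' * Set.IccExtend zero_le_one (Y x') s := by
    filter_upwards [hI] with τ hτ
    rw [hscale x' hx2 ⟨τ, hτ⟩]
    exact ((hball x' hx2).1.1 (Y x')).1 rfl ⟨τ, hτ⟩
  have huniq := hG.unique (hF.congr_of_eventuallyEq hev)
  have hhalf : (1 / 2 : ℝ) ∈ I := ⟨by norm_num, by norm_num⟩
  rw [Set.IccExtend_of_mem _ _ hhalf, ← hscale x' hx2 ⟨_, hhalf⟩] at huniq
  simp only [← hxx] at huniq
  rw [hx', map_smul, map_smul, smul_mul_assoc] at huniq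
  exact smul_right_injective _ (two_ne_zero' ℝ) huniq

/-- Existence of an analytic fundamental solution of a flat analytic linear system. -/
theorem exists_fundamental_solution {M : E → E →L[ℝ] 𝔸} {x₀ : E} (hM : AnalyticAt ℝ M x₀)
    (hflat : ∀ᶠ x in 𝓝 x₀, ∀ h k,
      fderiv ℝ M x h k + M x k * M x h = fderiv ℝ M x k h + M x h * M x k) :
    ∃ Φ : E → 𝔸, AnalyticAt ℝ Φ x₀ ∧ Φ x₀ = 1 ∧
      ∀ᶠ x in 𝓝 x₀, ∀ h, fderiv ℝ Φ x h = M x h * Φ x := by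
  let M' : E → E →L[ℝ] 𝔸 := fun x => M (x₀ + x)
  have hadd : Tendsto (fun x => x₀ + x) (𝓝 0) (𝓝 x₀) := by
    simpa using (continuous_const_add x₀).tendsto 0
  have hM' : AnalyticAt ℝ M' 0 :=
    AnalyticAt.comp (g := M) (f := fun x => x₀ + x) (by simpa using hM)
      (analyticAt_const.add analyticAt_id)
  obtain ⟨y, hy, hy0, hrad⟩ := exists_analyticAt_radial hM'
  have hflat' : ∀ᶠ x in 𝓝 (0 : E), ∀ h k,
      fderiv ℝ M' x h k + M' x k * M' x h = fderiv ℝ M' x k h + M' x h * M' x k := by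
    filter_upwards [hadd.eventually hflat] with x hx
    simpa only [M', fderiv_comp_add_left] using hx
  obtain ⟨r, hr, hball⟩ := Metric.eventually_nhds_iff_ball.1
    ((hrad.and hflat').and (hy.eventually_analyticAt.and hM'.eventually_analyticAt))
  have hsol := fderiv_eq_of_radial (fun x hx => (hball x hx).2.2) (fun x hx => (hball x hx).2.1)
    (fun x hx => (hball x hx).1.2) (fun x hx => (hball x hx).1.1)
  have hsub : Tendsto (fun x => x - x₀) (𝓝 x₀) (𝓝 0) := by
    simpa using (continuous_sub_right x₀).tendsto x₀
  refine ⟨fun x => y (x - x₀), ?_, by simpa using hy0, ?_⟩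
  · exact AnalyticAt.comp (g := y) (f := fun x => x - x₀) (by simpa using hy)
      (analyticAt_id.sub analyticAt_const)
  · filter_upwards [hsub.eventually (Metric.ball_mem_nhds (0 : E) hr)] with x hx h
    rw [fderiv_comp_sub, hsol _ hx]
    simp [M']

end Flat

end

/-! ### Partial derivatives, the Levi-Civita connection and constant curvature. -/

noncomputable section

open Filter Topology

section PartialDerivatives

variable {n : ℕ} {f g : (Fin n → ℝ) → ℝ} {x : Fin n → ℝ}

theorem partialD_add (hf : DifferentiableAt ℝ f x) (hg : DifferentiableAt ℝ g x) (i : Fin n) :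
    partialD i (fun y => f y + g y) x = partialD i f x + partialD i g x := by
  simp [partialD, fderiv_fun_add hf hg]

theorem partialD_sub (hf : DifferentiableAt ℝ f x) (hg : DifferentiableAt ℝ g x) (i : Fin n) :
    partialD i (fun y => f y - g y) x = partialD i f x - partialD i g x := by
  simp [partialD, fderiv_fun_sub hf hg]

theorem partialD_mul (hf : DifferentiableAt ℝ f x) (hg : DifferentiableAt ℝ g x) (i : Fin n) :
    partialD i (fun y => f y * g y) x = f x * partialD i g x + g x * partialD i f x := by
  simp [partialD, fderiv_fun_mul hf hg]

theorem partialD_const (c : ℝ) (i : Fin n) : partialD i (fun _ => c) x = 0 := by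
  simp [partialD]

theorem partialD_const_mul (hf : DifferentiableAt ℝ f x) (c : ℝ) (i : Fin n) :
    partialD i (fun y => c * f y) x = c * partialD i f x := by
  rw [partialD_mul (differentiableAt_const c) hf i, partialD_const, mul_zero, add_zero]

theorem partialD_mul_const (hf : DifferentiableAt ℝ f x) (c : ℝ) (i : Fin n) :
    partialD i (fun y => f y * c) x = partialD i f x * c := by
  rw [partialD_mul hf (differentiableAt_const c) i, partialD_const]
  ring

theorem partialD_neg (i : Fin n) : partialD i (fun y => -f y) x = -partialD i f x := by
  simp [partialD, fderiv_fun_neg]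

theorem partialD_sum {ι : Type*} {s : Finset ι} {F : ι → (Fin n → ℝ) → ℝ}
    (hF : ∀ k ∈ s, DifferentiableAt ℝ (F k) x) (i : Fin n) :
    partialD i (fun y => ∑ k ∈ s, F k y) x = ∑ k ∈ s, partialD i (F k) x := by
  simp [partialD, fderiv_fun_sum hF]

theorem partialD_congr (h : f =ᶠ[𝓝 x] g) (i : Fin n) : partialD i f x = partialD i g x := by
  rw [partialD, h.fderiv_eq, partialD]

theorem AnalyticAt.partialD (hf : AnalyticAt ℝ f x) (i : Fin n) :
    AnalyticAt ℝ (_root_.partialD i f) x :=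
  hf.fderiv.clm_const_apply (ContinuousLinearMap.apply ℝ ℝ (Pi.single i 1))

/-- The derivative in the direction `h`, from the partial derivatives. -/
theorem fderiv_apply_eq_sum_partialD (i : Fin n → ℝ) :
    fderiv ℝ f x i = ∑ a, i a * partialD a f x := by
  conv_lhs => rw [pi_eq_sum_univ' i]
  simp [partialD, map_sum]

end PartialDerivatives

section Metric

variable {n : ℕ} {Ω : Set (Fin n → ℝ)} {ω : (Fin n → ℝ) → Matrix (Fin n) (Fin n) ℝ}
  {x : Fin n → ℝ}

theorem AnalyticAt.matrix_det {E ι : Type*} [NormedAddCommGroup E] [NormedSpace ℝ E] [Fintype ι]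
    [DecidableEq ι] {A : E → Matrix ι ι ℝ} {x : E}
    (hA : ∀ i j, AnalyticAt ℝ (fun y => A y i j) x) : AnalyticAt ℝ (fun y => (A y).det) x := by
  simp only [Matrix.det_apply]
  refine Finset.analyticAt_fun_sum _ fun σ _ => ?_
  simp only [Units.smul_def, zsmul_eq_mul]
  exact analyticAt_const.mul (Finset.analyticAt_fun_prod _ fun i _ => hA _ _)

theorem AnalyticAt.matrix_inv {E ι : Type*} [NormedAddCommGroup E] [NormedSpace ℝ E] [Fintype ι]
    [DecidableEq ι] {A : E → Matrix ι ι ℝ} {x : E}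
    (hA : ∀ i j, AnalyticAt ℝ (fun y => A y i j) x) (hdet : (A x).det ≠ 0) (i j : ι) :
    AnalyticAt ℝ (fun y => (A y)⁻¹ i j) x := by
  simp only [Matrix.inv_def, Ring.inverse_eq_inv', Matrix.smul_apply, Matrix.adjugate_apply,
    smul_eq_mul]
  refine ((AnalyticAt.matrix_det hA).inv hdet).mul (AnalyticAt.matrix_det fun k l => ?_)
  by_cases hk : k = j
  · subst hk; simpa using analyticAt_const
  · simpa [Matrix.updateRow_ne hk] using hA k l

theorem IsAnalyticMetric.analyticAt_inv (hω : IsAnalyticMetric ω Ω) (hx : x ∈ Ω) (i j : Fin n) :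
    AnalyticAt ℝ (fun y => (ω y)⁻¹ i j) x :=
  AnalyticAt.matrix_inv (fun i j => hω.analytic i j x hx) (hω.nondegenerate x hx) i j

theorem IsAnalyticMetric.analyticAt_christoffel (hω : IsAnalyticMetric ω Ω) (hx : x ∈ Ω)
    (k i j : Fin n) : AnalyticAt ℝ (christoffel ω k i j) x := by
  have h := fun i j => hω.analytic i j x hx
  unfold christoffel
  exact analyticAt_const.mul (Finset.analyticAt_fun_sum _ fun l _ =>
    (hω.analyticAt_inv hx k l).mul ((((h l j).partialD i).add ((h l i).partialD j)).sub
      ((h i j).partialD l)))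

theorem IsAnalyticMetric.partialD_symm (hω : IsAnalyticMetric ω Ω) (hΩ : IsOpen Ω) (hx : x ∈ Ω)
    (a i j : Fin n) : partialD a (fun y => ω y i j) x = partialD a (fun y => ω y j i) x := by
  refine partialD_congr ?_ a
  filter_upwards [hΩ.mem_nhds hx] with y hy using (hω.symm y hy).apply j i

theorem IsAnalyticMetric.christoffel_symm (hω : IsAnalyticMetric ω Ω) (hΩ : IsOpen Ω) (hx : x ∈ Ω)
    (k i j : Fin n) : christoffel ω k i j x = christoffel ω k j i x := by
  unfold christoffel
  congr 1
  refine Finset.sum_congr rfl fun l _ => ?_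
  rw [hω.partialD_symm hΩ hx l i j]
  ring

theorem IsAnalyticMetric.isUnit_det (hω : IsAnalyticMetric ω Ω) (hx : x ∈ Ω) :
    IsUnit (ω x).det := (hω.nondegenerate x hx).isUnit

theorem IsAnalyticMetric.sum_mul_christoffel (hω : IsAnalyticMetric ω Ω) (hx : x ∈ Ω)
    (m i j : Fin n) :
    ∑ k, ω x m k * christoffel ω k i j x = 1 / 2 * (partialD i (fun y => ω y m j) x
      + partialD j (fun y => ω y m i) x - partialD m (fun y => ω y i j) x) := by
  set v : Fin n → ℝ := fun l => partialD i (fun y => ω y l j) x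
      + partialD j (fun y => ω y l i) x - partialD l (fun y => ω y i j) x with hv
  have h1 : ∀ k, christoffel ω k i j x = 1 / 2 * ((ω x)⁻¹.mulVec v) k := fun k => rfl
  have h2 : (ω x).mulVec ((ω x)⁻¹.mulVec v) = v := by
    rw [Matrix.mulVec_mulVec, Matrix.mul_nonsing_inv _ (hω.isUnit_det hx), Matrix.one_mulVec]
  have h3 : ∑ k, ω x m k * ((ω x)⁻¹.mulVec v) k = v m := congrFun h2 m
  calc ∑ k, ω x m k * christoffel ω k i j x
      = ∑ k, 1 / 2 * (ω x m k * ((ω x)⁻¹.mulVec v) k) :=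
        Finset.sum_congr rfl fun k _ => by rw [h1]; ring
    _ = 1 / 2 * v m := by rw [← Finset.mul_sum, h3]

/-- The Levi-Civita connection is compatible with the metric. -/
theorem IsAnalyticMetric.partialD_metric (hω : IsAnalyticMetric ω Ω) (hΩ : IsOpen Ω) (hx : x ∈ Ω)
    (a b j : Fin n) : partialD a (fun y => ω y b j) x =
      ∑ m, ω x j m * christoffel ω m a b x + ∑ m, ω x b m * christoffel ω m a j x := by
  rw [hω.sum_mul_christoffel hx, hω.sum_mul_christoffel hx, hω.partialD_symm hΩ hx a j b,
    hω.partialD_symm hΩ hx b a j, hω.partialD_symm hΩ hx j a b]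
  ring

/-- An S-admissible metric has constant sectional curvature. -/
theorem riemann_eq (hn : 4 ≤ n) {k₀ : ℝ} (hω : IsAnalyticMetric ω Ω) (hS : IsSAdmissible k₀ ω Ω)
    (hx : x ∈ Ω) (m k i j : Fin n) :
    riemann ω m k i j x =
      k₀ * ((if m = i then ω x j k else 0) - (if m = j then ω x i k else 0)) := by
  have hn' : (4 : ℝ) ≤ n := by exact_mod_cast hn
  have hu := hω.isUnit_det hx
  -- The Einstein condition gives scalar curvature `n (n - 1) k₀`, hence `σ = ½ (n - 2) k₀ ω`; the
  -- factor `n - 2` cancels in the Weyl condition. Nondegeneracy of `ω` then raises the lowered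
  -- index.
  have hscal : scalarCurvature ω x = n * ((n - 1) * k₀) := by
    have : ∀ j k, (ω x)⁻¹ j k * ricci ω j k x = (n - 1) * k₀ * ((ω x)⁻¹ j k * ω x k j) := by
      intro j k
      rw [hS.ricci_eq x hx, (hω.symm x hx).apply k j]; ring
    simp only [scalarCurvature, this, ← Finset.mul_sum]
    have h2 : ∀ j, ∑ k, (ω x)⁻¹ j k * ω x k j = 1 := fun j => by
      rw [← Matrix.mul_apply, Matrix.nonsing_inv_mul _ hu, Matrix.one_apply_eq]
    simp only [h2]
    simp
    ring
  have hσ : ∀ i j, sigmaTensor ω i j x = ((n : ℝ) - 2) / 2 * k₀ * ω x i j := by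
    intro i j
    have : (n : ℝ) - 1 ≠ 0 := by linarith
    rw [sigmaTensor, hscal, hS.ricci_eq x hx]
    field_simp
    ring
  have hlow : ∀ l, ∑ m, ω x l m * riemann ω m k i j x
      = k₀ * (ω x i l * ω x j k - ω x j l * ω x i k) := by
    intro l
    have : (n : ℝ) - 2 ≠ 0 := by linarith
    rw [hS.weyl_eq_zero x hx i j k l]
    simp only [hσ]
    field_simp
    ring
  set R : Fin n → ℝ := fun m => riemann ω m k i j x
  set R' : Fin n → ℝ := fun m =>
    k₀ * ((if m = i then ω x j k else 0) - (if m = j then ω x i k else 0))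
  have h1 : (ω x).mulVec R = (ω x).mulVec R' := by
    ext l
    have h2 : ((ω x).mulVec R) l = _ := hlow l
    rw [h2]
    simp only [R', Matrix.mulVec, dotProduct]
    have : ∀ m, ω x l m * (k₀ * ((if m = i then ω x j k else 0) - if m = j then ω x i k else 0))
        = (if m = i then k₀ * ω x l m * ω x j k else 0)
          - (if m = j then k₀ * ω x l m * ω x i k else 0) := by
      intro m; split_ifs <;> ring
    simp only [this, Finset.sum_sub_distrib, Finset.sum_ite_eq', Finset.mem_univ, if_true]
    rw [(hω.symm x hx).apply l i, (hω.symm x hx).apply l j]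
    ring
  have h2 := Matrix.mulVec_injective_of_isUnit ((Matrix.isUnit_iff_isUnit_det _).2 hu) h1
  exact congrFun h2 m

end Metric

/-! ### The linear connection behind the c system. -/

section Connection

variable {n : ℕ}

/-- The state space of the linear system for `(e ^ (-α), d (e ^ (-α)), h)`. -/
abbrev CState (n : ℕ) : Type := ℝ × (Fin n → ℝ) × ℝ

/-- The component `p_k` of a state `(f, p, h)`. -/
def cStateP (n : ℕ) (k : Fin n) : CState n →L[ℝ] ℝ :=
  (ContinuousLinearMap.proj k).comp
    ((ContinuousLinearMap.fst ℝ _ _).comp (ContinuousLinearMap.snd ℝ _ _))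

/-- The component `h` of a state `(f, p, h)`. -/
def cStateH (n : ℕ) : CState n →L[ℝ] ℝ :=
  (ContinuousLinearMap.snd ℝ _ _).comp (ContinuousLinearMap.snd ℝ _ _)

/-- The rank one operator `(h, s) ↦ φ h • ψ s • v`. -/
def rankOne (φ : (Fin n → ℝ) →L[ℝ] ℝ) (ψ : CState n →L[ℝ] ℝ) (v : CState n) :
    (Fin n → ℝ) →L[ℝ] CState n →L[ℝ] CState n :=
  φ.smulRight (ψ.smulRight v)

/-- The connection on states which encodes `∂ᵢ f = pᵢ`, `∂ᵢ pⱼ = h ωᵢⱼ + ∑ₖ γᵏᵢⱼ pₖ`,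
`∂ᵢ h = -k₀ pᵢ`. -/
def cConnection (k₀ : ℝ) (ω : (Fin n → ℝ) → Matrix (Fin n) (Fin n) ℝ) (x : Fin n → ℝ) :
    (Fin n → ℝ) →L[ℝ] CState n →L[ℝ] CState n :=
  ∑ i, rankOne (ContinuousLinearMap.proj i) (cStateP n i) (1, 0, -k₀)
    + ∑ i, ∑ j, ω x i j • rankOne (ContinuousLinearMap.proj i) (cStateH n) (0, Pi.single j 1, 0)
    + ∑ i, ∑ j, ∑ k, christoffel ω k i j x •
        rankOne (ContinuousLinearMap.proj i) (cStateP n k) (0, Pi.single j 1, 0)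

theorem cConnection_single (k₀ : ℝ) (ω : (Fin n → ℝ) → Matrix (Fin n) (Fin n) ℝ)
    (x : Fin n → ℝ) (a : Fin n) (s : CState n) :
    cConnection k₀ ω x (Pi.single a 1) s =
      (s.2.1 a, fun j => s.2.2 * ω x a j + ∑ k, christoffel ω k a j x * s.2.1 k,
        -k₀ * s.2.1 a) := by
  have hite : ∀ i (c : ℝ), (Pi.single a (1 : ℝ) : Fin n → ℝ) i * c = if i = a then c else 0 := by
    intro i c
    by_cases h : i = a
    · subst h; simp
    · simp [h]
  refine Prod.ext ?_ (Prod.ext (funext fun l => ?_) ?_)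
  · simp [cConnection, rankOne, cStateP, cStateH, Prod.fst_sum, hite, _root_.sum_apply]
  · have hl : ∀ j (c d : ℝ), c * (d * (Pi.single j (1 : ℝ) : Fin n → ℝ) l) =
        if j = l then c * d else 0 := by
      intro j c d
      by_cases h : j = l
      · subst h; simp
      · simp [h, Ne.symm h]
    simp [cConnection, rankOne, cStateP, cStateH, Prod.fst_sum, Prod.snd_sum, Finset.sum_apply,
      _root_.sum_apply, hite, hl]
    exact mul_comm _ _
  · simp [cConnection, rankOne, cStateP, cStateH, Prod.snd_sum, _root_.sum_apply, hite, mul_comm]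

end Connection

end

/-! ### Flatness of the connection on states. -/

noncomputable section

open Filter Topology

section Linear

variable {E X Y Z : Type*} [NormedAddCommGroup E] [NormedSpace ℝ E] [NormedAddCommGroup X]
  [NormedSpace ℝ X] [NormedAddCommGroup Y] [NormedSpace ℝ Y] [NormedAddCommGroup Z]
  [NormedSpace ℝ Z]

theorem AnalyticAt.smul_const_right {f : E → ℝ} {x : E} (hf : AnalyticAt ℝ f x) (y : Y) :
    AnalyticAt ℝ (fun z => f z • y) x := by
  simpa using hf.clm_const_apply (ContinuousLinearMap.smulRight (1 : ℝ →L[ℝ] ℝ) y)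

theorem fderiv_clm_const_apply {G : E → Y} {x : E} (hG : DifferentiableAt ℝ G x) (T : Y →L[ℝ] Z)
    (h : E) : fderiv ℝ (fun y => T (G y)) x h = T (fderiv ℝ G x h) :=
  DFunLike.congr_fun (T.hasFDerivAt.comp x hG.hasFDerivAt).fderiv h

theorem fderiv_clm_apply_apply {G : E → X →L[ℝ] Y →L[ℝ] Z} {x : E}
    (hG : DifferentiableAt ℝ G x) (v : X) (s : Y) (ℓ : Z →L[ℝ] ℝ) (h : E) :
    fderiv ℝ (fun y => ℓ (G y v s)) x h = ℓ (fderiv ℝ G x h v s) :=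
  fderiv_clm_const_apply (Y := X →L[ℝ] Y →L[ℝ] Z) hG (ℓ.comp ((ContinuousLinearMap.apply ℝ Z s).comp
    (ContinuousLinearMap.apply ℝ (Y →L[ℝ] Z) v))) h

end Linear

section Flatness

variable {n : ℕ} {k₀ : ℝ} {Ω : Set (Fin n → ℝ)} {ω : (Fin n → ℝ) → Matrix (Fin n) (Fin n) ℝ}
  {x : Fin n → ℝ}

theorem IsAnalyticMetric.analyticAt_cConnection (hω : IsAnalyticMetric ω Ω) (hx : x ∈ Ω) :
    AnalyticAt ℝ (cConnection k₀ ω) x := by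
  unfold cConnection
  refine (analyticAt_const.add ?_).add ?_
  · exact Finset.analyticAt_fun_sum _ fun i _ => Finset.analyticAt_fun_sum _ fun j _ =>
      (hω.analytic i j x hx).smul_const_right _
  · exact Finset.analyticAt_fun_sum _ fun i _ => Finset.analyticAt_fun_sum _ fun j _ =>
      Finset.analyticAt_fun_sum _ fun k _ => (hω.analyticAt_christoffel hx k i j).smul_const_right _

theorem fderiv_cConnection_single (hω : IsAnalyticMetric ω Ω) (hx : x ∈ Ω) (a b : Fin n)
    (s : CState n) :
    fderiv ℝ (cConnection k₀ ω) x (Pi.single a 1) (Pi.single b 1) s =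
      (0, fun j => s.2.2 * partialD a (fun y => ω y b j) x
        + ∑ k, partialD a (christoffel ω k b j) x * s.2.1 k, 0) := by
  have hd := (hω.analyticAt_cConnection (k₀ := k₀) hx).differentiableAt
  have hdω : ∀ j, DifferentiableAt ℝ (fun y => ω y b j) x := fun j =>
    (hω.analytic b j x hx).differentiableAt
  have hdγ : ∀ k j, DifferentiableAt ℝ (christoffel ω k b j) x := fun k j =>
    (hω.analyticAt_christoffel hx k b j).differentiableAt
  have hℓ : ∀ ℓ : CState n →L[ℝ] ℝ,
      ℓ (fderiv ℝ (cConnection k₀ ω) x (Pi.single a 1) (Pi.single b 1) s) =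
        partialD a (fun y => ℓ (cConnection k₀ ω y (Pi.single b 1) s)) x :=
    fun ℓ => (fderiv_clm_apply_apply hd _ _ _ _).symm
  refine Prod.ext ?_ (Prod.ext (funext fun l => ?_) ?_)
  · have := hℓ (ContinuousLinearMap.fst ℝ _ _)
    simp only [cConnection_single, ContinuousLinearMap.coe_fst', partialD_const] at this
    exact this
  · have := hℓ (cStateP n l)
    simp only [cConnection_single] at this
    refine this.trans ?_
    change partialD a (fun y => s.2.2 * ω y b l + ∑ k, christoffel ω k b l y * s.2.1 k) x = _
    rw [partialD_add ((hdω l).const_mul _)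
      (DifferentiableAt.fun_sum fun k _ => (hdγ k l).mul_const _), partialD_const_mul (hdω l),
      partialD_sum fun k _ => (hdγ k l).mul_const _]
    simp only [partialD_mul_const (hdγ _ l)]
  · have := hℓ (cStateH n)
    simp only [cConnection_single] at this
    refine this.trans ?_
    change partialD a (fun _ => -k₀ * s.2.1 b) x = _
    rw [partialD_const]

/-- Reduces the flatness identity, bilinear in the two directions, to coordinate vectors. -/
theorem bilinear_eq_zero_of_single {A : Type*} [AddCommGroup A] [Module ℝ A]
    (B : (Fin n → ℝ) →ₗ[ℝ] (Fin n → ℝ) →ₗ[ℝ] A)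
    (h : ∀ a b, B (Pi.single a 1) (Pi.single b 1) = 0) : B = 0 := by
  refine LinearMap.pi_ext' fun a => LinearMap.ext_ring (LinearMap.pi_ext' fun b =>
    LinearMap.ext_ring ?_)
  simpa using h a b

/-- The connection on states is flat. -/
theorem cConnection_flat (hn : 4 ≤ n) (hΩ : IsOpen Ω) (hω : IsAnalyticMetric ω Ω)
    (hS : IsSAdmissible k₀ ω Ω) (hx : x ∈ Ω) (h k : Fin n → ℝ) :
    fderiv ℝ (cConnection k₀ ω) x h k + cConnection k₀ ω x k * cConnection k₀ ω x h =
      fderiv ℝ (cConnection k₀ ω) x k h + cConnection k₀ ω x h * cConnection k₀ ω x k := by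
  set M := cConnection k₀ ω
  let B : (Fin n → ℝ) →ₗ[ℝ] (Fin n → ℝ) →ₗ[ℝ] (CState n →L[ℝ] CState n) :=
    LinearMap.mk₂ ℝ (fun h k => fderiv ℝ M x h k + M x k * M x h
        - (fderiv ℝ M x k h + M x h * M x k))
      (fun a b c => by simp only [map_add, _root_.add_apply]; noncomm_ring)
      (fun c a b => by simp [smul_sub])
      (fun a b c => by simp only [map_add, _root_.add_apply]; noncomm_ring)
      (fun c a b => by simp [smul_sub])
  have hB : B = 0 := by
    refine bilinear_eq_zero_of_single B fun a b => ContinuousLinearMap.ext fun s => ?_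
    simp only [B, LinearMap.mk₂_apply, _root_.sub_apply, _root_.add_apply,
      _root_.mul_apply_eq_comp, M, fderiv_cConnection_single hω hx, cConnection_single,
      _root_.zero_apply]
    have hsymmω : ω x a b = ω x b a := (hω.symm x hx).apply b a
    have hγ : ∀ k, christoffel ω k a b x = christoffel ω k b a x := fun k =>
      hω.christoffel_symm hΩ hx k a b
    -- The outer components compare `h ω_ab + ∑ₖ γᵏ_ab pₖ` with its transpose, so they vanish by
    -- symmetry. In the middle component metric compatibility cancels the `h` terms. The `p` terms
    -- form the Riemann tensor applied to `p`, which is `k₀ (p_a ω_bj - p_b ω_aj)` and cancels the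
    -- contribution of `∂h = -k₀ p`.
    refine Prod.ext ?_ (Prod.ext (funext fun j => ?_) ?_)
    · simp [hsymmω, hγ]
    · have hR : ∀ k, partialD a (christoffel ω k b j) x - partialD b (christoffel ω k a j) x
          + ∑ m, (christoffel ω k a m x * christoffel ω m b j x
            - christoffel ω k b m x * christoffel ω m a j x)
          = k₀ * ((if k = a then ω x b j else 0) - if k = b then ω x a j else 0) :=
        fun k => riemann_eq hn hω hS hx k j a b
      have hg1 := hω.partialD_metric hΩ hx a b j
      have hg2 := hω.partialD_metric hΩ hx b a j
      have e1 : ∀ a b, ∑ k, christoffel ω k b j x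
            * (s.2.2 * ω x a k + ∑ m, christoffel ω m a k x * s.2.1 m)
          = s.2.2 * ∑ m, ω x a m * christoffel ω m b j x
            + ∑ k, s.2.1 k * ∑ m, christoffel ω k a m x * christoffel ω m b j x := by
        intro a b
        simp only [mul_add, Finset.sum_add_distrib, Finset.mul_sum]
        congr 1
        · exact Finset.sum_congr rfl fun k _ => by ring
        · rw [Finset.sum_comm]
          exact Finset.sum_congr rfl fun k _ => Finset.sum_congr rfl fun m _ => by ring
      have e2 : ∑ k, partialD a (christoffel ω k b j) x * s.2.1 k
          - ∑ k, partialD b (christoffel ω k a j) x * s.2.1 k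
          + (∑ k, s.2.1 k * ∑ m, christoffel ω k a m x * christoffel ω m b j x
            - ∑ k, s.2.1 k * ∑ m, christoffel ω k b m x * christoffel ω m a j x)
          = k₀ * (s.2.1 a * ω x b j - s.2.1 b * ω x a j) := by
        have e3 : ∑ k, s.2.1 k * (k₀ * ((if k = a then ω x b j else 0)
            - if k = b then ω x a j else 0)) = k₀ * (s.2.1 a * ω x b j - s.2.1 b * ω x a j) := by
          have : ∀ k, s.2.1 k * (k₀ * ((if k = a then ω x b j else 0)
              - if k = b then ω x a j else 0))
              = (if k = a then k₀ * s.2.1 k * ω x b j else 0)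
                - if k = b then k₀ * s.2.1 k * ω x a j else 0 := by
            intro k; split_ifs <;> ring
          simp only [this, Finset.sum_sub_distrib, Finset.sum_ite_eq', Finset.mem_univ, if_true]
          ring
        rw [← e3]
        simp only [← hR, ← Finset.sum_sub_distrib, ← Finset.sum_add_distrib]
        refine Finset.sum_congr rfl fun k _ => ?_
        rw [Finset.sum_sub_distrib]
        ring
      change s.2.2 * partialD a (fun y => ω y b j) x
          + ∑ k, partialD a (christoffel ω k b j) x * s.2.1 k
          + (-k₀ * s.2.1 a * ω x b j + ∑ k, christoffel ω k b j x
            * (s.2.2 * ω x a k + ∑ m, christoffel ω m a k x * s.2.1 m))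
          - (s.2.2 * partialD b (fun y => ω y a j) x
            + ∑ k, partialD b (christoffel ω k a j) x * s.2.1 k
            + (-k₀ * s.2.1 b * ω x a j + ∑ k, christoffel ω k a j x
              * (s.2.2 * ω x b k + ∑ m, christoffel ω m b k x * s.2.1 m))) = 0
      simp only [hγ] at hg1
      rw [e1 a b, e1 b a, hg1, hg2]
      linear_combination e2
    · simp [hsymmω, hγ]
  have := congrArg (fun B => B h k) hB
  exact sub_eq_zero.1 this

end Flatness

end

/-! ### Correspondence between 1-jets of solutions and states on an energy level. -/

noncomputable section

open Filter Topology

section JetState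

variable {n : ℕ} {k₀ : ℝ} {Ω : Set (Fin n → ℝ)} {ω : (Fin n → ℝ) → Matrix (Fin n) (Fin n) ℝ}
  {x : Fin n → ℝ}

/-- The squared length of a covector for the metric `ω`. -/
def covectorNormSq (ω : (Fin n → ℝ) → Matrix (Fin n) (Fin n) ℝ) (x c : Fin n → ℝ) : ℝ :=
  ∑ k, ∑ h, (ω x)⁻¹ k h * c h * c k

theorem covectorNormSq_smul (t : ℝ) (c : Fin n → ℝ) :
    covectorNormSq ω x (fun i => t * c i) = t ^ 2 * covectorNormSq ω x c := by
  simp only [covectorNormSq, Finset.mul_sum]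
  exact Finset.sum_congr rfl fun k _ => Finset.sum_congr rfl fun h _ => by ring

/-- The state `(e ^ (-α), d (e ^ (-α)), h)` of a solution `α` of the c system, in terms of the
1-jet of `α`. -/
def jetState (k₀ : ℝ) (ω : (Fin n → ℝ) → Matrix (Fin n) (Fin n) ℝ) (x : Fin n → ℝ)
    (c : ℝ × (Fin n → ℝ)) : CState n :=
  (Real.exp (-c.1), fun i => -Real.exp (-c.1) * c.2 i,
    1 / 2 * Real.exp (-c.1) * (k₀ * (Real.exp (2 * c.1) - 1) + covectorNormSq ω x c.2))

/-- The first integral of the linear system for states. -/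
def cEnergy (k₀ : ℝ) (ω : (Fin n → ℝ) → Matrix (Fin n) (Fin n) ℝ) (x : Fin n → ℝ)
    (s : CState n) : ℝ :=
  2 * s.1 * s.2.2 + k₀ * s.1 ^ 2 - covectorNormSq ω x s.2.1

theorem exp_neg_sq_mul (a : ℝ) : Real.exp (-a) ^ 2 * Real.exp (2 * a) = 1 := by
  rw [← Real.exp_nat_mul, ← Real.exp_add]
  norm_num

/-- The third entry of `jetState` is designed for this value of the energy. The converse
`eq_jetState` solves the energy relation for that entry. -/
theorem cEnergy_jetState (c : ℝ × (Fin n → ℝ)) : cEnergy k₀ ω x (jetState k₀ ω x c) = k₀ := by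
  simp only [cEnergy, jetState, covectorNormSq_smul]
  linear_combination k₀ * exp_neg_sq_mul c.1

theorem jetState_injective : Function.Injective (jetState k₀ ω x) := by
  intro c c' h
  have h1 : Real.exp (-c.1) = Real.exp (-c'.1) := congrArg Prod.fst h
  have h2 : c.1 = c'.1 := by simpa using h1
  refine Prod.ext h2 (funext fun i => ?_)
  have h3 : -Real.exp (-c.1) * c.2 i = -Real.exp (-c'.1) * c'.2 i :=
    congrFun (congrArg (fun s : CState n => s.2.1) h) i
  rw [h1] at h3
  exact mul_left_cancel₀ (neg_ne_zero.2 (Real.exp_pos _).ne') h3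

theorem jetState_zero : jetState k₀ ω x 0 = (1, 0, 0) := by
  simp only [jetState, covectorNormSq]
  refine Prod.ext ?_ (Prod.ext (funext fun i => ?_) ?_) <;> simp

/-- A state of positive first component on the energy level `k₀` is the state of a 1-jet. -/
theorem eq_jetState {s : CState n} (hs : 0 < s.1) (hE : cEnergy k₀ ω x s = k₀) :
    s = jetState k₀ ω x (-Real.log s.1, fun i => -s.2.1 i / s.1) := by
  have h1 : Real.exp (- -Real.log s.1) = s.1 := by rw [neg_neg, Real.exp_log hs]
  have h2 : Real.exp (2 * -Real.log s.1) = (s.1 ^ 2)⁻¹ := by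
    rw [show 2 * -Real.log s.1 = -((2 : ℕ) * Real.log s.1) by push_cast; ring, Real.exp_neg,
      Real.exp_nat_mul, Real.exp_log hs]
  have h3 : covectorNormSq ω x (fun i => -s.2.1 i / s.1) =
      (s.1⁻¹) ^ 2 * covectorNormSq ω x s.2.1 := by
    have : (fun i => -s.2.1 i / s.1) = fun i => (-s.1⁻¹) * s.2.1 i := by
      funext i; field_simp
    rw [this, covectorNormSq_smul, neg_sq]
  refine Prod.ext ?_ (Prod.ext (funext fun i => ?_) ?_)
  · simp only [jetState, h1]
  · simp only [jetState, h1]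
    field_simp
  · simp only [jetState, h1, h2, h3]
    rw [cEnergy] at hE
    field_simp
    linear_combination hE

/-- The right-hand side of the c system, in terms of `covectorNormSq`. -/
theorem cRHS_eq (i j : Fin n) (c₀ : ℝ) (c : Fin n → ℝ) :
    cRHS k₀ ω i j x c₀ c = 1 / 2 * (k₀ * (1 - Real.exp (2 * c₀)) - covectorNormSq ω x c) * ω x i j
      + c i * c j + ∑ k, c k * christoffel ω k i j x := rfl

theorem differentiableAt_covectorNormSq (hω : IsAnalyticMetric ω Ω) (hx : x ∈ Ω)
    {p : (Fin n → ℝ) → Fin n → ℝ} (hp : ∀ j, DifferentiableAt ℝ (fun y => p y j) x) :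
    DifferentiableAt ℝ (fun y => covectorNormSq ω y (p y)) x := by
  unfold covectorNormSq
  exact DifferentiableAt.fun_sum fun k _ => DifferentiableAt.fun_sum fun h _ =>
    ((hω.analyticAt_inv hx k h).differentiableAt.mul (hp h)).mul (hp k)

/-- The derivative of the squared length of a covector field whose covariant derivative is a
multiple of the metric. -/
theorem partialD_covectorNormSq (hΩ : IsOpen Ω) (hω : IsAnalyticMetric ω Ω) (hx : x ∈ Ω)
    {p : (Fin n → ℝ) → Fin n → ℝ} (hp : ∀ j, DifferentiableAt ℝ (fun y => p y j) x) {η : ℝ}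
    (hη : ∀ a j, partialD a (fun y => p y j) x =
      η * ω x a j + ∑ k, christoffel ω k a j x * p x k) (a : Fin n) :
    partialD a (fun y => covectorNormSq ω y (p y)) x = 2 * η * p x a := by
  -- `P` is `p` with its index raised. Differentiating the relation `ω P = p` avoids differentiating
  -- the inverse matrix; metric compatibility then cancels all Christoffel terms.
  let P : Fin n → (Fin n → ℝ) → ℝ := fun k y => ∑ h, (ω y)⁻¹ k h * p y h
  have hP : ∀ k, DifferentiableAt ℝ (P k) x := fun k => DifferentiableAt.fun_sum fun h _ =>
    (hω.analyticAt_inv hx k h).differentiableAt.mul (hp h)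
  have hωd : ∀ i j, DifferentiableAt ℝ (fun y => ω y i j) x := fun i j =>
    (hω.analytic i j x hx).differentiableAt
  have hlow : ∀ y ∈ Ω, ∀ j, ∑ k, ω y j k * P k y = p y j := by
    intro y hy j
    have : (ω y).mulVec ((ω y)⁻¹.mulVec (p y)) = p y := by
      rw [Matrix.mulVec_mulVec, Matrix.mul_nonsing_inv _ (hω.isUnit_det hy), Matrix.one_mulVec]
    exact congrFun this j
  have hnorm : (fun y => covectorNormSq ω y (p y)) = fun y => ∑ k, P k y * p y k := by
    funext y
    simp only [covectorNormSq, P, Finset.sum_mul]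
  have hdlow : ∀ j, ∑ k, ω x j k * partialD a (P k) x =
      partialD a (fun y => p y j) x - ∑ k, P k x * partialD a (fun y => ω y j k) x := by
    intro j
    have h1 : partialD a (fun y => ∑ k, ω y j k * P k y) x = partialD a (fun y => p y j) x := by
      refine partialD_congr ?_ a
      filter_upwards [hΩ.mem_nhds hx] with y hy using hlow y hy j
    rw [partialD_sum fun k _ => (hωd j k).fun_mul (hP k)] at h1
    simp only [partialD_mul (hωd j _) (hP _), Finset.sum_add_distrib] at h1
    linarith
  rw [hnorm, partialD_sum fun k _ => (hP k).fun_mul (hp k)]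
  simp only [partialD_mul (hP _) (hp _), Finset.sum_add_distrib]
  have e1 : ∑ k, p x k * partialD a (P k) x =
      ∑ j, P j x * (partialD a (fun y => p y j) x
        - ∑ k, P k x * partialD a (fun y => ω y j k) x) := by
    simp only [← hdlow, Finset.mul_sum]
    rw [Finset.sum_comm]
    refine Finset.sum_congr rfl fun k _ => ?_
    rw [← hlow x hx k, Finset.sum_mul]
    refine Finset.sum_congr rfl fun j _ => ?_
    rw [(hω.symm x hx).apply j k]
    ring
  have e2 : ∀ j, ∑ k, P k x * partialD a (fun y => ω y j k) x =
      ∑ m, p x m * christoffel ω m a j x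
        + ∑ k, P k x * ∑ m, ω x j m * christoffel ω m a k x := by
    intro j
    simp only [hω.partialD_metric hΩ hx a j, mul_add, Finset.sum_add_distrib]
    congr 1
    simp only [← hlow x hx, Finset.mul_sum, Finset.sum_mul]
    rw [Finset.sum_comm]
    refine Finset.sum_congr rfl fun m _ => Finset.sum_congr rfl fun k _ => ?_
    rw [(hω.symm x hx).apply m k]
    ring
  have e3 : ∑ j, P j x * ∑ k, P k x * ∑ m, ω x j m * christoffel ω m a k x =
      ∑ k, P k x * ∑ m, p x m * christoffel ω m a k x := by
    simp only [← hlow x hx, Finset.mul_sum, Finset.sum_mul]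
    rw [Finset.sum_comm]
    refine Finset.sum_congr rfl fun k _ => ?_
    rw [Finset.sum_comm]
    refine Finset.sum_congr rfl fun m _ => Finset.sum_congr rfl fun j _ => ?_
    rw [(hω.symm x hx).apply j m]
    ring
  rw [e1]
  simp only [e2, hη, mul_sub, mul_add, Finset.sum_sub_distrib, Finset.sum_add_distrib, e3]
  have e4 : ∑ k, P k x * (η * ω x a k) = η * p x a := by
    rw [← hlow x hx a, Finset.mul_sum]
    exact Finset.sum_congr rfl fun k _ => by ring
  have e5 : ∀ k, ∑ m, christoffel ω m a k x * p x m = ∑ m, p x m * christoffel ω m a k x :=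
    fun k => Finset.sum_congr rfl fun m _ => mul_comm _ _
  simp only [e4, e5]
  ring

/-- The linear system for states, in components. -/
theorem fderiv_eq_cConnection_iff {s : (Fin n → ℝ) → CState n} (hs : DifferentiableAt ℝ s x) :
    (∀ h, fderiv ℝ s x h = cConnection k₀ ω x h (s x)) ↔
      ∀ a, partialD a (fun y => (s y).1) x = (s x).2.1 a ∧
        (∀ j, partialD a (fun y => (s y).2.1 j) x =
          (s x).2.2 * ω x a j + ∑ k, christoffel ω k a j x * (s x).2.1 k) ∧
        partialD a (fun y => (s y).2.2) x = -k₀ * (s x).2.1 a := by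
  have hℓ : ∀ (ℓ : CState n →L[ℝ] ℝ) a,
      partialD a (fun y => ℓ (s y)) x = ℓ (fderiv ℝ s x (Pi.single a 1)) :=
    fun ℓ a => fderiv_clm_const_apply hs ℓ _
  have h1 := hℓ (ContinuousLinearMap.fst ℝ _ _)
  have h2 := fun j => hℓ (cStateP n j)
  have h3 := hℓ (cStateH n)
  have hbasis : (∀ h, fderiv ℝ s x h = cConnection k₀ ω x h (s x)) ↔
      ∀ a, fderiv ℝ s x (Pi.single a 1) = cConnection k₀ ω x (Pi.single a 1) (s x) := by
    refine ⟨fun h a => h _, fun h k => ?_⟩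
    let B : (Fin n → ℝ) →ₗ[ℝ] CState n :=
      { toFun := fun k => cConnection k₀ ω x k (s x)
        map_add' := fun a b => by simp
        map_smul' := fun c a => by simp }
    have : (fderiv ℝ s x : (Fin n → ℝ) →ₗ[ℝ] CState n) = B :=
      LinearMap.pi_ext' fun a => LinearMap.ext_ring (by simpa [B] using h a)
    exact DFunLike.congr_fun this k
  rw [hbasis]
  refine forall_congr' fun a => ?_
  rw [cConnection_single, Prod.ext_iff, Prod.ext_iff, funext_iff]
  refine and_congr ?_ (and_congr (forall_congr' fun j => ?_) ?_)
  · exact Eq.congr_left (h1 a).symm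
  · exact Eq.congr_left (h2 j a).symm
  · exact Eq.congr_left (h3 a).symm

theorem partialD_exp {f : (Fin n → ℝ) → ℝ} (hf : DifferentiableAt ℝ f x) (a : Fin n) :
    partialD a (fun y => Real.exp (f y)) x = Real.exp (f x) * partialD a f x := by
  simp [partialD, fderiv_exp hf]

theorem partialD_log {f : (Fin n → ℝ) → ℝ} (hf : DifferentiableAt ℝ f x) (h0 : f x ≠ 0)
    (a : Fin n) : partialD a (fun y => Real.log (f y)) x = partialD a f x / f x := by
  simp [partialD, fderiv.log hf h0]
  ring

theorem analyticAt_jetState (hω : IsAnalyticMetric ω Ω) (hx : x ∈ Ω)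
    {α : (Fin n → ℝ) → ℝ} {β : (Fin n → ℝ) → (Fin n → ℝ)} (hα : AnalyticAt ℝ α x)
    (hβ : ∀ i, AnalyticAt ℝ (fun y => β y i) x) :
    AnalyticAt ℝ (fun y => jetState k₀ ω y (α y, β y)) x := by
  have hf : AnalyticAt ℝ (fun y => Real.exp (-α y)) x := hα.neg.rexp'
  have hN : AnalyticAt ℝ (fun y => covectorNormSq ω y (β y)) x := by
    unfold covectorNormSq
    exact Finset.analyticAt_fun_sum _ fun k _ => Finset.analyticAt_fun_sum _ fun h _ =>
      ((hω.analyticAt_inv hx k h).mul (hβ h)).mul (hβ k)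
  refine hf.prod (AnalyticAt.prod (analyticAt_pi_iff.2 fun i => hf.neg.mul (hβ i)) ?_)
  exact (analyticAt_const.mul hf).mul ((analyticAt_const.mul
    ((analyticAt_const.mul hα).rexp'.sub analyticAt_const)).add hN)

/-- The states of a solution of the c system solve the linear system. -/
theorem fderiv_jetState (hΩ : IsOpen Ω) (hω : IsAnalyticMetric ω Ω) (hx : x ∈ Ω)
    {α : (Fin n → ℝ) → ℝ} (hα : AnalyticAt ℝ α x) (hc : CSystemAt k₀ ω α x) (h : Fin n → ℝ) :
    fderiv ℝ (fun y => jetState k₀ ω y (α y, gradient₁ α y)) x h =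
      cConnection k₀ ω x h (jetState k₀ ω x (α x, gradient₁ α x)) := by
  have hgrad : ∀ i, AnalyticAt ℝ (fun y => gradient₁ α y i) x := fun i => hα.partialD i
  have hs := (analyticAt_jetState (k₀ := k₀) hω hx hα hgrad).differentiableAt
  set s := fun y => jetState k₀ ω y (α y, gradient₁ α y) with hs_def
  have hαd := hα.differentiableAt
  have hfd : DifferentiableAt ℝ (fun y => Real.exp (-α y)) x := hαd.fun_neg.exp
  have h1 : ∀ a, partialD a (fun y => (s y).1) x = (s x).2.1 a := by
    intro a
    have : partialD a (fun y => Real.exp (-α y)) x = -Real.exp (-α x) * gradient₁ α x a := by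
      rw [partialD_exp hαd.fun_neg, partialD_neg, gradient₁]
      ring
    exact this
  have h2 : ∀ a j, partialD a (fun y => (s y).2.1 j) x =
      (s x).2.2 * ω x a j + ∑ k, christoffel ω k a j x * (s x).2.1 k := by
    intro a j
    have e1 : partialD a (fun y => -Real.exp (-α y) * gradient₁ α y j) x = _ :=
      partialD_mul (f := fun y => -Real.exp (-α y)) (g := fun y => gradient₁ α y j) hfd.fun_neg
        (hgrad j).differentiableAt a
    have e2 : partialD a (fun y => gradient₁ α y j) x = _ := hc a j
    have e3 : partialD a (fun y => -Real.exp (-α y)) x = Real.exp (-α x) * gradient₁ α x a := by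
      rw [partialD_neg, partialD_exp hαd.fun_neg, partialD_neg, gradient₁]
      ring
    have e4 : ∑ k, christoffel ω k a j x * (-Real.exp (-α x) * gradient₁ α x k)
        = -Real.exp (-α x) * ∑ k, gradient₁ α x k * christoffel ω k a j x := by
      rw [Finset.mul_sum]
      exact Finset.sum_congr rfl fun k _ => by ring
    change partialD a (fun y => -Real.exp (-α y) * gradient₁ α y j) x =
      1 / 2 * Real.exp (-α x) * (k₀ * (Real.exp (2 * α x) - 1)
        + covectorNormSq ω x (gradient₁ α x)) * ω x a j
        + ∑ k, christoffel ω k a j x * (-Real.exp (-α x) * gradient₁ α x k)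
    rw [e1, e2, e3, e4, cRHS_eq]
    ring
  refine (fderiv_eq_cConnection_iff hs).2 (fun a => ⟨h1 a, h2 a, ?_⟩) h
  have hd1 : DifferentiableAt ℝ (fun y => (s y).1) x := hs.fst
  have hd2 : ∀ j, DifferentiableAt ℝ (fun y => (s y).2.1 j) x := fun j =>
    differentiableAt_pi.1 hs.snd.fst j
  have hd3 : DifferentiableAt ℝ (fun y => (s y).2.2) x := hs.snd.snd
  have hN := partialD_covectorNormSq hΩ hω hx hd2 h2 a
  -- The equation for `∂h` needs no computation of third derivatives: the energy of a state of a jet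
  -- is identically `k₀`, and its derivative can be solved for `∂h` because `2f ≠ 0`.
  have hE : partialD a (fun y => 2 * (s y).1 * (s y).2.2 + k₀ * ((s y).1 * (s y).1)
      - covectorNormSq ω y (s y).2.1) x = 0 := by
    have : (fun y => 2 * (s y).1 * (s y).2.2 + k₀ * ((s y).1 * (s y).1)
      - covectorNormSq ω y (s y).2.1) = fun _ => k₀ := by
      funext y
      rw [← pow_two]
      exact cEnergy_jetState _
    rw [this, partialD_const]
  rw [partialD_sub (((hd1.const_mul 2).fun_mul hd3).fun_add ((hd1.fun_mul hd1).const_mul k₀))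
      (differentiableAt_covectorNormSq hω hx hd2),
    partialD_add ((hd1.const_mul 2).fun_mul hd3) ((hd1.fun_mul hd1).const_mul k₀),
    partialD_mul (hd1.const_mul 2) hd3, partialD_const_mul hd1, partialD_const_mul (hd1.fun_mul hd1),
    partialD_mul hd1 hd1, hN, h1] at hE
  have hpos : (s x).1 ≠ 0 := (Real.exp_pos _).ne'
  refine mul_left_cancel₀ (mul_ne_zero two_ne_zero hpos) ?_
  linear_combination hE

/-- The first integral is constant along solutions of the linear system. -/
theorem partialD_cEnergy (hΩ : IsOpen Ω) (hω : IsAnalyticMetric ω Ω) (hx : x ∈ Ω)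
    {s : (Fin n → ℝ) → CState n} (hs : DifferentiableAt ℝ s x)
    (hsol : ∀ h, fderiv ℝ s x h = cConnection k₀ ω x h (s x)) (a : Fin n) :
    partialD a (fun y => cEnergy k₀ ω y (s y)) x = 0 := by
  have hsol' := (fderiv_eq_cConnection_iff hs).1 hsol
  have hd1 : DifferentiableAt ℝ (fun y => (s y).1) x := hs.fst
  have hd2 : ∀ j, DifferentiableAt ℝ (fun y => (s y).2.1 j) x := fun j =>
    differentiableAt_pi.1 hs.snd.fst j
  have hd3 : DifferentiableAt ℝ (fun y => (s y).2.2) x := hs.snd.snd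
  have hN := partialD_covectorNormSq hΩ hω hx hd2 (fun a => (hsol' a).2.1) a
  simp only [cEnergy, pow_two]
  rw [partialD_sub (((hd1.const_mul 2).fun_mul hd3).fun_add ((hd1.fun_mul hd1).const_mul k₀))
      (differentiableAt_covectorNormSq hω hx hd2),
    partialD_add ((hd1.const_mul 2).fun_mul hd3) ((hd1.fun_mul hd1).const_mul k₀),
    partialD_mul (hd1.const_mul 2) hd3, partialD_const_mul hd1, partialD_const_mul (hd1.fun_mul hd1),
    partialD_mul hd1 hd1, hN, (hsol' a).1, (hsol' a).2.2]
  ring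

theorem differentiableAt_cEnergy (hω : IsAnalyticMetric ω Ω) (hx : x ∈ Ω)
    {s : (Fin n → ℝ) → CState n} (hs : DifferentiableAt ℝ s x) :
    DifferentiableAt ℝ (fun y => cEnergy k₀ ω y (s y)) x := by
  have hd1 : DifferentiableAt ℝ (fun y => (s y).1) x := hs.fst
  have hd2 : ∀ j, DifferentiableAt ℝ (fun y => (s y).2.1 j) x := fun j =>
    differentiableAt_pi.1 hs.snd.fst j
  have hd3 : DifferentiableAt ℝ (fun y => (s y).2.2) x := hs.snd.snd
  exact (((hd1.const_mul 2).mul hd3).add ((hd1.pow 2).const_mul k₀)).sub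
    (differentiableAt_covectorNormSq hω hx hd2)

theorem gradient₁_neg_log {s : (Fin n → ℝ) → CState n} (hs : DifferentiableAt ℝ s x)
    (hsol : ∀ h, fderiv ℝ s x h = cConnection k₀ ω x h (s x)) (hpos : 0 < (s x).1) (i : Fin n) :
    gradient₁ (fun y => -Real.log (s y).1) x i = -(s x).2.1 i / (s x).1 := by
  rw [gradient₁, partialD_neg, partialD_log hs.fst hpos.ne',
    ((fderiv_eq_cConnection_iff hs).1 hsol i).1, neg_div]

/-- Solutions of the linear system on the energy level `k₀` give solutions of the c system. -/
theorem cSystemAt_neg_log {s : (Fin n → ℝ) → CState n}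
    (hs : ∀ᶠ y in 𝓝 x, DifferentiableAt ℝ s y)
    (hsol : ∀ᶠ y in 𝓝 x, ∀ h, fderiv ℝ s y h = cConnection k₀ ω y h (s y))
    (hpos : 0 < (s x).1) (hE : cEnergy k₀ ω x (s x) = k₀) :
    CSystemAt k₀ ω (fun y => -Real.log (s y).1) x := by
  intro i j
  have hsx := hs.self_of_nhds
  have hposev : ∀ᶠ y in 𝓝 x, 0 < (s y).1 :=
    hsx.fst.continuousAt.eventually (lt_mem_nhds hpos)
  have hgrad : ∀ i, gradient₁ (fun y => -Real.log (s y).1) x i = -(s x).2.1 i / (s x).1 :=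
    gradient₁_neg_log hsx hsol.self_of_nhds hpos
  have h1 : partialD j (fun y => -Real.log (s y).1) =ᶠ[𝓝 x]
      fun y => -((s y).2.1 j * Real.exp (-Real.log (s y).1)) := by
    filter_upwards [hs, hsol, hposev] with y hy hys hyp
    have := gradient₁_neg_log hy hys hyp j
    rw [gradient₁] at this
    rw [this, Real.exp_neg, Real.exp_log hyp, neg_div, div_eq_mul_inv]
  have hd1 : DifferentiableAt ℝ (fun y => -Real.log (s y).1) x := (hsx.fst.log hpos.ne').fun_neg
  have hd2 : DifferentiableAt ℝ (fun y => (s y).2.1 j) x := differentiableAt_pi.1 hsx.snd.fst j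
  have hjet := eq_jetState hpos hE
  have hgrad' : (fun i => -(s x).2.1 i / (s x).1) =
    gradient₁ (fun y => -Real.log (s y).1) x := funext fun i => (hgrad i).symm
  have hsol' := (fderiv_eq_cConnection_iff hsx).1 hsol.self_of_nhds
  set u := fun y => -Real.log (s y).1 with hu
  have hp : ∀ k, (s x).2.1 k = -(s x).1 * gradient₁ u x k := by
    intro k; rw [hgrad]; field_simp
  -- On the level `k₀` the entry `h` is a function of the 1-jet of `u`. Inserting it into the
  -- equation for `∂p` makes the linear system nonlinear and recovers the c system.
  have hη : (s x).2.2 = 1 / 2 * (s x).1 * (k₀ * (Real.exp (2 * u x) - 1)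
      + covectorNormSq ω x (gradient₁ u x)) := by
    have e1 : Real.exp (-u x) = (s x).1 := by rw [hu]; simp [Real.exp_log hpos]
    have e2 := congrArg (fun s : CState n => s.2.2) hjet
    rw [hgrad'] at e2
    rw [← e1]
    exact e2
  rw [partialD_congr h1, partialD_neg, partialD_mul hd2 hd1.exp, partialD_exp hd1,
    (hsol' i).2.1 j, Real.exp_neg, Real.exp_log hpos, cRHS_eq, hη]
  simp only [hp]
  have e4 : ∑ k, christoffel ω k i j x * (-(s x).1 * gradient₁ u x k)
      = -(s x).1 * ∑ k, gradient₁ u x k * christoffel ω k i j x := by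
    rw [Finset.mul_sum]
    exact Finset.sum_congr rfl fun k _ => by ring
  rw [e4, show partialD i u x = gradient₁ u x i from rfl]
  field_simp
  ring

end JetState

end

/-! ### Cosine profiles on the unit interval. -/

noncomputable section

open Filter Topology unitInterval BoundedContinuousFunction

section CosinePaths

/-- The path `t ↦ cos (m π t)`. -/
def cosPath (m : ℕ) : I →ᵇ ℝ :=
  mkOfCompact ⟨fun t => Real.cos (m * Real.pi * t), by fun_prop⟩

@[simp] theorem cosPath_apply (m : ℕ) (t : I) : cosPath m t = Real.cos (m * Real.pi * t) := rfl

/-- The integral over the unit interval, as a linear functional on paths. -/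
def pathIntegral : (I →ᵇ ℝ) →L[ℝ] ℝ :=
  (BoundedContinuousFunction.evalCLM ℝ (1 : I)).comp (primitivePath ℝ)

theorem pathIntegral_eq {f : I →ᵇ ℝ} {g : ℝ → ℝ} (h : ∀ t : I, f t = g t) :
    pathIntegral f = ∫ t in (0 : ℝ)..1, g t := by
  change (∫ s in (0 : ℝ)..(1 : I), Set.IccExtend zero_le_one f s) = _
  refine intervalIntegral.integral_congr fun s hs => ?_
  rw [Set.Icc.coe_one, Set.uIcc_of_le zero_le_one] at hs
  simp only [Set.IccExtend_of_mem _ _ hs, h]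

theorem integral_cos_int_mul_pi {m : ℤ} (hm : m ≠ 0) :
    ∫ t in (0 : ℝ)..1, Real.cos (m * Real.pi * t) = 0 := by
  have h : (m : ℝ) * Real.pi ≠ 0 := mul_ne_zero (by exact_mod_cast hm) Real.pi_ne_zero
  rw [intervalIntegral.integral_comp_mul_left (fun t => Real.cos t) h]
  simp [Real.sin_int_mul_pi]

theorem pathIntegral_cosPath {m : ℕ} (hm : m ≠ 0) : pathIntegral (cosPath m) = 0 := by
  rw [pathIntegral_eq (g := fun t => Real.cos ((m : ℤ) * Real.pi * t)) (by simp),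
    integral_cos_int_mul_pi (by exact_mod_cast hm)]

/-- Every mixed mean below vanishes by this relation, because `cutoff`, `bumpFst` and `bumpSnd` use
the disjoint frequency sets 1, 2 and 3, 5 and 4, 6. Since `cos (m π) = (-1) ^ m`, averaging opposite
parities gives the end values 1 and 0, and subtracting equal parities gives 0 at both ends. Each
bump has mean square `1/2 + 1/2 = 1`. -/
theorem pathIntegral_cosPath_mul {a b : ℕ} (hab : a ≠ b) :
    pathIntegral (cosPath a * cosPath b) = 0 := by
  have hadd : (a : ℤ) + b ≠ 0 := by omega
  have hsub : (a : ℤ) - b ≠ 0 := by omega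
  rw [pathIntegral_eq (g := fun t => 1 / 2 * (Real.cos (((a - b : ℤ) : ℝ) * Real.pi * t)
      + Real.cos (((a + b : ℤ) : ℝ) * Real.pi * t))) (fun t => ?_),
    intervalIntegral.integral_const_mul, intervalIntegral.integral_add,
    integral_cos_int_mul_pi hadd, integral_cos_int_mul_pi hsub]
  · simp
  · exact (by fun_prop : Continuous _).intervalIntegrable _ _
  · exact (by fun_prop : Continuous _).intervalIntegrable _ _
  · change Real.cos (a * Real.pi * t) * Real.cos (b * Real.pi * t) = _
    push_cast
    rw [show ((a : ℝ) - b) * Real.pi * t = a * Real.pi * t - b * Real.pi * t by ring,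
      show ((a : ℝ) + b) * Real.pi * t = a * Real.pi * t + b * Real.pi * t by ring,
      Real.cos_sub, Real.cos_add]
    ring

theorem pathIntegral_cosPath_sq {a : ℕ} (ha : a ≠ 0) :
    pathIntegral (cosPath a * cosPath a) = 1 / 2 := by
  have hadd : (a : ℤ) + a ≠ 0 := by omega
  rw [pathIntegral_eq (g := fun t => 1 / 2 * (1
      + Real.cos (((a + a : ℤ) : ℝ) * Real.pi * t))) (fun t => ?_),
    intervalIntegral.integral_const_mul, intervalIntegral.integral_add,
    integral_cos_int_mul_pi hadd]
  · simp
  · exact (by fun_prop : Continuous _).intervalIntegrable _ _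
  · exact (by fun_prop : Continuous _).intervalIntegrable _ _
  · change Real.cos (a * Real.pi * t) * Real.cos (a * Real.pi * t) = _
    push_cast
    rw [show ((a : ℝ) + a) * Real.pi * t = a * Real.pi * t + a * Real.pi * t by ring,
      Real.cos_add]
    nlinarith [Real.sin_sq_add_cos_sq (a * Real.pi * t)]

/-- A function with value `1` at `0`, value `0` at `1` and mean zero. -/
def cutoff (t : ℝ) : ℝ := 1 / 2 * (Real.cos (1 * Real.pi * t) + Real.cos (2 * Real.pi * t))

/-- The first of two functions which vanish at `0` and `1` and are orthonormal, and orthogonal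
to the constants and to `cutoff`. -/
def bumpFst (t : ℝ) : ℝ := Real.cos (3 * Real.pi * t) - Real.cos (5 * Real.pi * t)

/-- The second of two functions which vanish at `0` and `1` and are orthonormal, and orthogonal
to the constants and to `cutoff`. -/
def bumpSnd (t : ℝ) : ℝ := Real.cos (4 * Real.pi * t) - Real.cos (6 * Real.pi * t)

theorem cutoff_zero : cutoff 0 = 1 := by simp [cutoff]; norm_num

theorem cutoff_one : cutoff 1 = 0 := by simp [cutoff]

theorem bumpFst_zero : bumpFst 0 = 0 := by simp [bumpFst]

theorem bumpSnd_zero : bumpSnd 0 = 0 := by simp [bumpSnd]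

theorem bumpFst_one : bumpFst 1 = 0 := by
  have h3 := Real.cos_nat_mul_pi 3
  have h5 := Real.cos_nat_mul_pi 5
  push_cast at h3 h5
  rw [bumpFst, mul_one, mul_one, h3, h5]; norm_num

theorem bumpSnd_one : bumpSnd 1 = 0 := by
  have h3 := Real.cos_nat_mul_pi 4
  have h5 := Real.cos_nat_mul_pi 6
  push_cast at h3 h5
  rw [bumpSnd, mul_one, mul_one, h3, h5]; norm_num

/-- The path of `cutoff`. -/
def cutoffPath : I →ᵇ ℝ := (1 / 2 : ℝ) • (cosPath 1 + cosPath 2)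

/-- The path of `bumpFst`. -/
def bumpFstPath : I →ᵇ ℝ := cosPath 3 - cosPath 5

/-- The path of `bumpSnd`. -/
def bumpSndPath : I →ᵇ ℝ := cosPath 4 - cosPath 6

theorem cutoffPath_apply (t : I) : cutoffPath t = cutoff t := by
  simp [cutoffPath, cutoff, mul_add]

theorem bumpFstPath_apply (t : I) : bumpFstPath t = bumpFst t := by simp [bumpFstPath, bumpFst]

theorem bumpSndPath_apply (t : I) : bumpSndPath t = bumpSnd t := by simp [bumpSndPath, bumpSnd]

theorem pathIntegral_cutoffPath : pathIntegral cutoffPath = 0 := by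
  simp [cutoffPath, pathIntegral_cosPath]

theorem pathIntegral_bumpFstPath : pathIntegral bumpFstPath = 0 := by
  simp [bumpFstPath, pathIntegral_cosPath]

theorem pathIntegral_bumpSndPath : pathIntegral bumpSndPath = 0 := by
  simp [bumpSndPath, pathIntegral_cosPath]

theorem pathIntegral_cutoffPath_mul_bumpFstPath : pathIntegral (cutoffPath * bumpFstPath) = 0 := by
  simp only [cutoffPath, bumpFstPath, smul_mul_assoc, map_smul, mul_sub, add_mul, map_add, map_sub]
  simp [pathIntegral_cosPath_mul]

theorem pathIntegral_cutoffPath_mul_bumpSndPath : pathIntegral (cutoffPath * bumpSndPath) = 0 := by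
  simp only [cutoffPath, bumpSndPath, smul_mul_assoc, map_smul, mul_sub, add_mul, map_add, map_sub]
  simp [pathIntegral_cosPath_mul]

theorem pathIntegral_bumpFstPath_mul_bumpSndPath :
    pathIntegral (bumpFstPath * bumpSndPath) = 0 := by
  simp [bumpFstPath, bumpSndPath, mul_sub, sub_mul, pathIntegral_cosPath_mul]

theorem pathIntegral_bumpFstPath_sq : pathIntegral (bumpFstPath * bumpFstPath) = 1 := by
  simp [bumpFstPath, mul_sub, sub_mul, pathIntegral_cosPath_mul, pathIntegral_cosPath_sq]
  norm_num

theorem pathIntegral_bumpSndPath_sq : pathIntegral (bumpSndPath * bumpSndPath) = 1 := by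
  simp [bumpSndPath, mul_sub, sub_mul, pathIntegral_cosPath_mul, pathIntegral_cosPath_sq]
  norm_num

end CosinePaths

/-! ### Persistence of zeros at points with surjective derivative. -/

section OpenMapping

/-- Zeros of a family of maps persist where the derivative is surjective. -/
theorem HasStrictFDerivAt.eventually_exists_eq_zero {X Y : Type*} [NormedAddCommGroup X]
    [NormedSpace ℝ X] [CompleteSpace X] [NormedAddCommGroup Y] [NormedSpace ℝ Y] [CompleteSpace Y]
    {f : ℝ × X → Y} {f' : ℝ × X →L[ℝ] Y} {a : X} (hf : HasStrictFDerivAt f f' (0, a))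
    (h0 : f (0, a) = 0) (hsurj : ∀ y, ∃ v, f' (0, v) = y) :
    ∀ᶠ ε in 𝓝 (0 : ℝ), ∃ b, f (ε, b) = 0 := by
  -- With the parameter adjoined, `(ε, b) ↦ (ε, f (ε, b))` has surjective derivative at `(0, a)`, so
  -- its image is a neighbourhood of `(0, 0)` and contains `(ε, 0)` for small `ε`.
  have hF : HasStrictFDerivAt (fun q : ℝ × X => (q.1, f q))
      ((ContinuousLinearMap.fst ℝ ℝ X).prod f') (0, a) := hasStrictFDerivAt_fst.prodMk hf
  have hs : (((ContinuousLinearMap.fst ℝ ℝ X).prod f') : ℝ × X →L[ℝ] ℝ × Y).range = ⊤ := by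
    refine LinearMap.range_eq_top.2 fun z => ?_
    obtain ⟨v, hv⟩ := hsurj (z.2 - f' (z.1, 0))
    refine ⟨(z.1, v), Prod.ext rfl ?_⟩
    have : f' (z.1, v) = f' (z.1, 0) + f' (0, v) := by rw [← map_add]; simp
    simpa [hv] using this
  have hmap := hF.map_nhds_eq_of_surj hs
  have hrange : Set.range (fun q : ℝ × X => (q.1, f q)) ∈ 𝓝 ((0 : ℝ), (0 : Y)) := by
    rw [← h0, ← show (fun q : ℝ × X => (q.1, f q)) (0, a) = (0, f (0, a)) from rfl, ← hmap]
    exact range_mem_map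
  have hcont : Tendsto (fun ε : ℝ => (ε, (0 : Y))) (𝓝 0) (𝓝 (0, 0)) :=
    (by fun_prop : Continuous fun ε : ℝ => (ε, (0 : Y))).tendsto 0
  filter_upwards [hcont hrange] with ε hε
  obtain ⟨q, hq⟩ := hε
  have h1 : q.1 = ε := congrArg Prod.fst hq
  have h2 : f q = 0 := congrArg Prod.snd hq
  exact ⟨q.2, by rw [← h1]; exact h2⟩

end OpenMapping

/-! ### The quadratic equation for the bump coefficients. -/

section QuadraticForm

open Matrix

variable {n : ℕ}

/-- A nondegenerate quadratic form in at least three variables takes values of the same sign at two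
orthogonal vectors. -/
theorem Matrix.IsSymm.exists_orthogonal_same_sign (hn : 3 ≤ n) {G : Matrix (Fin n) (Fin n) ℝ}
    (hG : G.IsSymm) (hdet : G.det ≠ 0) :
    ∃ d e : Fin n → ℝ, d ⬝ᵥ G *ᵥ e = 0 ∧ 0 < (d ⬝ᵥ G *ᵥ d) * (e ⬝ᵥ G *ᵥ e) := by
  have hH : G.IsHermitian := by
    rw [Matrix.IsHermitian, Matrix.conjTranspose_eq_transpose_of_trivial]; exact hG
  have hne : ∀ i, hH.eigenvalues i ≠ 0 := by
    intro i hi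
    apply hdet
    rw [hH.det_eq_prod_eigenvalues]
    exact Finset.prod_eq_zero (Finset.mem_univ i) (by simp [hi])
  let v : Fin n → Fin n → ℝ := fun i => hH.eigenvectorBasis i
  have hv : ∀ i j, v i ⬝ᵥ G *ᵥ v j = hH.eigenvalues j * if i = j then 1 else 0 := by
    intro i j
    have h1 := hH.mulVec_eigenvectorBasis j
    have h2 := orthonormal_iff_ite.1 hH.eigenvectorBasis.orthonormal i j
    have h3 : v i ⬝ᵥ v j = if i = j then 1 else 0 := by
      rw [← h2, dotProduct_comm]
      simp [v, PiLp.inner_apply, dotProduct]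
    change v i ⬝ᵥ G *ᵥ (hH.eigenvectorBasis j) = _
    rw [h1, dotProduct_smul, ← h3, smul_eq_mul]
  have key : ∀ i j : Fin n, i ≠ j → 0 < hH.eigenvalues i * hH.eigenvalues j →
      ∃ d e : Fin n → ℝ, d ⬝ᵥ G *ᵥ e = 0 ∧ 0 < (d ⬝ᵥ G *ᵥ d) * (e ⬝ᵥ G *ᵥ e) := by
    intro i j hij hpos
    exact ⟨v i, v j, by simp [hv, hij], by simpa [hv] using hpos⟩
  have hi : ∀ a b : ℕ, ∀ (ha : a < n) (hb : b < n), a ≠ b →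
      (⟨a, ha⟩ : Fin n) ≠ ⟨b, hb⟩ := fun a b ha hb hab h => hab (by simpa using h)
  -- Eigenvectors are orthogonal for the form. Three nonzero eigenvalues cannot have pairwise
  -- negative products, so two of them share a sign.
  by_contra hcon
  have hneg : ∀ i j : Fin n, i ≠ j → hH.eigenvalues i * hH.eigenvalues j < 0 := fun i j hij =>
    lt_of_le_of_ne (not_lt.1 fun h => hcon (key i j hij h)) (mul_ne_zero (hne i) (hne j))
  have h01 := hneg ⟨0, by omega⟩ ⟨1, by omega⟩ (hi _ _ _ _ (by norm_num))
  have h02 := hneg ⟨0, by omega⟩ ⟨2, by omega⟩ (hi _ _ _ _ (by norm_num))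
  have h12 := hneg ⟨1, by omega⟩ ⟨2, by omega⟩ (hi _ _ _ _ (by norm_num))
  nlinarith [mul_pos_of_neg_of_neg h01 h02,
    mul_nonneg (sq_nonneg (hH.eigenvalues ⟨0, by omega⟩)) (neg_nonneg.2 h12.le)]

/-- The quadratic part, in the gradient, of the right-hand side of the c system contracted
with `d`. -/
def cQuadratic (G : Matrix (Fin n) (Fin n) ℝ) (d c : Fin n → ℝ) : Fin n → ℝ :=
  (-(1 / 2) * (c ⬝ᵥ G⁻¹ *ᵥ c)) • G *ᵥ d + (c ⬝ᵥ d) • c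

/-- Raising the index of the argument removes the inverse matrix; the equation becomes one for
vectors, to be split along `d` and its orthogonal complement. -/
theorem cQuadratic_mulVec {G : Matrix (Fin n) (Fin n) ℝ} (hdet : G.det ≠ 0) (d v : Fin n → ℝ) :
    cQuadratic G d (G *ᵥ v) =
      G *ᵥ ((-(1 / 2) * (v ⬝ᵥ G *ᵥ v)) • d + (d ⬝ᵥ G *ᵥ v) • v) := by
  rw [cQuadratic, mulVec_mulVec, nonsing_inv_mul _ hdet.isUnit, one_mulVec, mulVec_add,
    mulVec_smul, mulVec_smul, dotProduct_comm (G *ᵥ v) v, dotProduct_comm (G *ᵥ v) d]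

/-- Sums of two values of the quadratic part exhaust all covectors, with surjective derivative. -/
theorem exists_cQuadratic_add_eq {G : Matrix (Fin n) (Fin n) ℝ} (hG : G.IsSymm)
    (hdet : G.det ≠ 0) {d e : Fin n → ℝ} (hde : d ⬝ᵥ G *ᵥ e = 0)
    (hpos : 0 < (d ⬝ᵥ G *ᵥ d) * (e ⬝ᵥ G *ᵥ e)) (r : Fin n → ℝ) :
    ∃ a b : Fin n → ℝ, cQuadratic G d a + cQuadratic G d b = r ∧
      ∀ r' : Fin n → ℝ, ∃ a' b' C : Fin n → ℝ, ∀ t : ℝ,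
        cQuadratic G d (a + t • a') + cQuadratic G d (b + t • b') = r + t • r' + t ^ 2 • C := by
  set s := d ⬝ᵥ G *ᵥ d with hs
  set κ := e ⬝ᵥ G *ᵥ e with hκ
  have hs0 : s ≠ 0 := fun h => by simp [h] at hpos
  have hκ0 : κ ≠ 0 := fun h => by simp [h] at hpos
  have hsymm : ∀ v w : Fin n → ℝ, v ⬝ᵥ G *ᵥ w = w ⬝ᵥ G *ᵥ v := by
    intro v w
    rw [dotProduct_mulVec, ← mulVec_transpose, hG.eq, dotProduct_comm]
  have hsq : ∀ (v w : Fin n → ℝ) (t : ℝ), (v + t • w) ⬝ᵥ G *ᵥ (v + t • w) =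
      v ⬝ᵥ G *ᵥ v + 2 * t * (v ⬝ᵥ G *ᵥ w) + t ^ 2 * (w ⬝ᵥ G *ᵥ w) := by
    intro v w t
    rw [mulVec_add, mulVec_smul, dotProduct_add, add_dotProduct, add_dotProduct, dotProduct_smul,
      dotProduct_smul, smul_dotProduct, smul_dotProduct, hsymm w v]
    simp only [smul_eq_mul]
    ring
  -- the decomposition along `d` and its orthogonal complement
  have hdec : ∀ r : Fin n → ℝ, ∃ (c : ℝ) (w : Fin n → ℝ), r = G *ᵥ (c • d + w) ∧
      d ⬝ᵥ G *ᵥ w = 0 := by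
    intro r
    let u := G⁻¹ *ᵥ r
    refine ⟨(d ⬝ᵥ G *ᵥ u) / s, u - ((d ⬝ᵥ G *ᵥ u) / s) • d, ?_, ?_⟩
    · rw [add_sub_cancel, mulVec_mulVec, mul_nonsing_inv _ hdet.isUnit, one_mulVec]
    · rw [mulVec_sub, mulVec_smul, dotProduct_sub, dotProduct_smul, smul_eq_mul,
        div_mul_cancel₀ _ hs0, sub_self]
  obtain ⟨c, w, rfl, hdw⟩ := hdec r
  set N := w ⬝ᵥ G *ᵥ w with hN
  -- The arguments are `G v` and `G (y e)` with `v = x d + (x s)⁻¹ w`. As `d` and `v` pair to `x s`,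
  -- the component `w` comes out right for every `x`. The component along `d` requires `y² κ = x² s
  -- - N / (x s)² - 2c`, which has a solution `y` as soon as `x` is large, because `s` and `κ` have
  -- the same sign.
  obtain ⟨x, hx, hxpos⟩ : ∃ x : ℝ, 1 ≤ x ∧ 0 < (x ^ 2 * s - N / (x * s) ^ 2 - 2 * c) / κ := by
    refine ⟨1 + (|κ * N| / s ^ 2 + 2 * |c * κ|) / (s * κ),
      le_add_of_nonneg_right (by positivity), ?_⟩
    set x := 1 + (|κ * N| / s ^ 2 + 2 * |c * κ|) / (s * κ) with hx
    have hx1 : 1 ≤ x := le_add_of_nonneg_right (by positivity)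
    have h1 : x * (s * κ) = s * κ + |κ * N| / s ^ 2 + 2 * |c * κ| := by
      rw [hx]; field_simp; ring
    have h2 : x * (s * κ) ≤ x ^ 2 * (s * κ) := by
      have : x ≤ x ^ 2 := by nlinarith
      exact mul_le_mul_of_nonneg_right this hpos.le
    have h3 : κ * N / (x * s) ^ 2 ≤ |κ * N| / s ^ 2 := by
      have hs2 : 0 < s ^ 2 := by positivity
      refine (div_le_div_of_nonneg_right (le_abs_self _) (by positivity)).trans ?_
      refine div_le_div_of_nonneg_left (abs_nonneg _) hs2 ?_
      rw [mul_pow]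
      exact le_mul_of_one_le_left hs2.le (one_le_pow₀ hx1)
    have h4 : 0 < κ * (x ^ 2 * s - N / (x * s) ^ 2 - 2 * c) := by
      have : κ * (x ^ 2 * s - N / (x * s) ^ 2 - 2 * c)
          = x ^ 2 * (s * κ) - κ * N / (x * s) ^ 2 - 2 * (c * κ) := by ring
      rw [this]
      linarith [le_abs_self (c * κ)]
    have h5 : (x ^ 2 * s - N / (x * s) ^ 2 - 2 * c) / κ
        = κ * (x ^ 2 * s - N / (x * s) ^ 2 - 2 * c) / κ ^ 2 := by field_simp
    rw [h5]
    positivity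
  have hx0 : x ≠ 0 := by positivity
  set y := Real.sqrt ((x ^ 2 * s - N / (x * s) ^ 2 - 2 * c) / κ) with hy
  have hy2 : y ^ 2 * κ = x ^ 2 * s - N / (x * s) ^ 2 - 2 * c := by
    rw [hy, Real.sq_sqrt hxpos.le, div_mul_cancel₀ _ hκ0]
  have hy0 : y ≠ 0 := (Real.sqrt_pos.2 hxpos).ne'
  set v := x • d + (x * s)⁻¹ • w with hv
  have hdv : d ⬝ᵥ G *ᵥ v = x * s := by
    rw [hv, mulVec_add, mulVec_smul, mulVec_smul, dotProduct_add, dotProduct_smul,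
      dotProduct_smul, hdw, smul_zero, add_zero, smul_eq_mul]
  have hvv : v ⬝ᵥ G *ᵥ v = x ^ 2 * s + N / (x * s) ^ 2 := by
    have h1 : w ⬝ᵥ G *ᵥ v = (x * s)⁻¹ * N := by
      rw [hv, mulVec_add, mulVec_smul, mulVec_smul, dotProduct_add, dotProduct_smul,
        dotProduct_smul, hsymm w d, hdw, smul_zero, zero_add, smul_eq_mul]
    conv_lhs => rw [hv, add_dotProduct, smul_dotProduct, smul_dotProduct, ← hv, hdv, h1]
    simp only [smul_eq_mul]
    field_simp
  have hey : ∀ t : ℝ, d ⬝ᵥ G *ᵥ (t • e) = 0 := fun t => by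
    rw [mulVec_smul, dotProduct_smul, hde, smul_zero]
  have hee : ∀ t : ℝ, (t • e) ⬝ᵥ G *ᵥ (t • e) = t ^ 2 * κ := fun t => by
    rw [mulVec_smul, dotProduct_smul, smul_dotProduct, smul_eq_mul, smul_eq_mul]; ring
  have hval : cQuadratic G d (G *ᵥ v) + cQuadratic G d (G *ᵥ (y • e)) = G *ᵥ (c • d + w) := by
    rw [cQuadratic_mulVec hdet, cQuadratic_mulVec hdet, ← mulVec_add]
    congr 1
    rw [hey, hee, hy2, hdv, hvv]
    funext i
    simp only [hv, Pi.add_apply, Pi.smul_apply, smul_eq_mul]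
    field_simp
    ring
  refine ⟨G *ᵥ v, G *ᵥ (y • e), hval, fun r' => ?_⟩
  obtain ⟨c', w', rfl, hdw'⟩ := hdec r'
  -- Moving `v` orthogonally to `d` keeps its pairing with `d` at `x s`, so `v'` produces `w'`
  -- without a second order term in that direction. The multiple `z` of `e` corrects the component
  -- along `d` to first order.
  set v' := (x * s)⁻¹ • w' with hv'
  set z := -(c' + v ⬝ᵥ G *ᵥ v') / (y * κ) with hz
  refine ⟨G *ᵥ v', G *ᵥ (z • e),
    G *ᵥ ((-(1 / 2) * (v' ⬝ᵥ G *ᵥ v') - 1 / 2 * z ^ 2 * κ) • d), fun t => ?_⟩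
  have hdv' : d ⬝ᵥ G *ᵥ (v + t • v') = x * s := by
    rw [mulVec_add, mulVec_smul, dotProduct_add, dotProduct_smul, hdv, hv', mulVec_smul,
      dotProduct_smul, hdw', smul_zero, smul_zero, add_zero]
  have hvv' : (v + t • v') ⬝ᵥ G *ᵥ (v + t • v') =
      v ⬝ᵥ G *ᵥ v + 2 * t * (v ⬝ᵥ G *ᵥ v') + t ^ 2 * (v' ⬝ᵥ G *ᵥ v') := hsq v v' t
  have hzy : z * (y * κ) = -(c' + v ⬝ᵥ G *ᵥ v') := by
    rw [hz, div_mul_cancel₀ _ (mul_ne_zero hy0 hκ0)]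
  have hw' : w' = (x * s) • v' := by
    rw [hv', smul_smul, mul_inv_cancel₀ (mul_ne_zero hx0 hs0), one_smul]
  rw [← hval]
  simp only [← mulVec_smul, ← mulVec_add, cQuadratic_mulVec hdet, smul_smul, ← add_smul]
  congr 1
  rw [hdv', hvv', hey, hey, hee, hee, hdv]
  funext i
  rw [hw']
  simp only [Pi.add_apply, Pi.smul_apply, smul_eq_mul]
  linear_combination (-t * d i) * hzy

end QuadraticForm

end

/-! ### Annihilating the mean error of the force along a short segment. -/

noncomputable section

open Filter Topology unitInterval BoundedContinuousFunction Matrix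

section Steering

variable {n : ℕ} {k₀ : ℝ} {Ω : Set (Fin n → ℝ)} {ω : (Fin n → ℝ) → Matrix (Fin n) (Fin n) ℝ}
  {x : Fin n → ℝ}

/-- The right-hand side of the c system, contracted with a vector. -/
def cForce (k₀ : ℝ) (ω : (Fin n → ℝ) → Matrix (Fin n) (Fin n) ℝ) (d : Fin n → ℝ) (i : Fin n)
    (x : Fin n → ℝ) (c₀ : ℝ) (c : Fin n → ℝ) : ℝ :=
  ∑ j, cRHS k₀ ω i j x c₀ c * d j

theorem cForce_eq (d : Fin n → ℝ) (i : Fin n) (x : Fin n → ℝ) (c₀ : ℝ) (c : Fin n → ℝ) :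
    cForce k₀ ω d i x c₀ c =
      1 / 2 * (k₀ * (1 - Real.exp (2 * c₀)) - ∑ k, ∑ h, (ω x)⁻¹ k h * c h * c k)
          * (∑ j, ω x i j * d j)
        + c i * (∑ k, c k * d k) + ∑ k, c k * ∑ j, christoffel ω k i j x * d j := by
  have h1 : ∀ j, cRHS k₀ ω i j x c₀ c * d j =
      1 / 2 * (k₀ * (1 - Real.exp (2 * c₀)) - ∑ k, ∑ h, (ω x)⁻¹ k h * c h * c k)
          * (ω x i j * d j) + c i * (c j * d j)
        + ∑ k, c k * (christoffel ω k i j x * d j) := by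
    intro j
    rw [cRHS, add_mul, Finset.sum_mul]
    congr 1
    · ring
    · exact Finset.sum_congr rfl fun k _ => by ring
  simp only [cForce, h1, Finset.sum_add_distrib, ← Finset.mul_sum]
  congr 1
  rw [Finset.sum_comm]
  exact Finset.sum_congr rfl fun k _ => by rw [Finset.mul_sum]

theorem cForce_eq_cQuadratic (d : Fin n → ℝ) (i : Fin n) (x : Fin n → ℝ) (c₀ : ℝ)
    (c : Fin n → ℝ) :
    cForce k₀ ω d i x c₀ c =
      1 / 2 * (k₀ * (1 - Real.exp (2 * c₀))) * (ω x *ᵥ d) i + cQuadratic (ω x) d c i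
        + c ⬝ᵥ fun k => ∑ j, christoffel ω k i j x * d j := by
  have h1 : ∑ k, ∑ h, (ω x)⁻¹ k h * c h * c k = c ⬝ᵥ (ω x)⁻¹ *ᵥ c := by
    simp only [dotProduct, mulVec, Finset.mul_sum]
    exact Finset.sum_congr rfl fun k _ => Finset.sum_congr rfl fun h _ => by ring
  rw [cForce_eq, h1, show (∑ j, ω x i j * d j) = (ω x *ᵥ d) i from rfl, cQuadratic,
    show (∑ k, c k * d k) = c ⬝ᵥ d from rfl]
  simp only [Pi.add_apply, Pi.smul_apply, smul_eq_mul]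
  rw [show (c ⬝ᵥ fun k => ∑ j, christoffel ω k i j x * d j)
    = ∑ k, c k * ∑ j, christoffel ω k i j x * d j from rfl]
  ring

theorem analyticAt_cRHS (hω : IsAnalyticMetric ω Ω) (hx : x ∈ Ω) (i j : Fin n)
    {α : (Fin n → ℝ) → ℝ} {β : (Fin n → ℝ) → Fin n → ℝ} (hα : AnalyticAt ℝ α x)
    (hβ : ∀ i, AnalyticAt ℝ (fun y => β y i) x) :
    AnalyticAt ℝ (fun y => cRHS k₀ ω i j y (α y) (β y)) x := by
  unfold cRHS
  refine ((AnalyticAt.mul (analyticAt_const.mul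
    ((analyticAt_const.mul (analyticAt_const.sub (analyticAt_const.mul hα).rexp')).sub ?_))
    (hω.analytic i j x hx)).add ((hβ i).mul (hβ j))).add ?_
  · exact Finset.analyticAt_fun_sum _ fun k _ => Finset.analyticAt_fun_sum _ fun h _ =>
      ((hω.analyticAt_inv hx k h).mul (hβ h)).mul (hβ k)
  · exact Finset.analyticAt_fun_sum _ fun k _ => (hβ k).mul (hω.analyticAt_christoffel hx k i j)

theorem analyticAt_cForce (hω : IsAnalyticMetric ω Ω) (hx : x ∈ Ω) (d : Fin n → ℝ) (i : Fin n)
    {α : (Fin n → ℝ) → ℝ} {β : (Fin n → ℝ) → Fin n → ℝ} (hα : AnalyticAt ℝ α x)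
    (hβ : ∀ i, AnalyticAt ℝ (fun y => β y i) x) :
    AnalyticAt ℝ (fun y => cForce k₀ ω d i y (α y) (β y)) x :=
  Finset.analyticAt_fun_sum _ fun j _ => (analyticAt_cRHS hω hx i j hα hβ).mul analyticAt_const

/-- The dependence of the contracted right-hand side on coefficients of the gradient. -/
theorem exists_cForce_expansion (d : Fin n → ℝ) (i : Fin n) (x j a b : Fin n → ℝ) :
    ∃ X : Fin 5 → ℝ, ∀ c₀ θ p q : ℝ,
      cForce k₀ ω d i x c₀ (fun k => j k - θ * j k + p * a k + q * b k) =
        cForce k₀ ω d i x c₀ (fun k => j k - θ * j k + p * (0 : Fin n → ℝ) k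
            + q * (0 : Fin n → ℝ) k)
          + cQuadratic (ω x) d a i * (p * p) + cQuadratic (ω x) d b i * (q * q)
          + (X 0 * p + X 1 * q + X 2 * (θ * p) + X 3 * (θ * q) + X 4 * (p * q)) := by
  set L : Fin n → ℝ := fun k => ∑ j, christoffel ω k i j x * d j
  set M := (ω x)⁻¹
  set D := (ω x *ᵥ d) i
  -- `B` polarises the quadratic part of the force. The coefficients `X` belong to the monomials
  -- whose means vanish for the cosine profiles. The base term keeps zero coefficients in place so
  -- that it matches the error at `c = 0`.
  let B : (Fin n → ℝ) → (Fin n → ℝ) → ℝ := fun v w =>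
    -(1 / 2) * (v ⬝ᵥ M *ᵥ w + w ⬝ᵥ M *ᵥ v) * D + (v ⬝ᵥ d) * w i + (w ⬝ᵥ d) * v i
  refine ⟨![B j a + a ⬝ᵥ L, B j b + b ⬝ᵥ L, -B j a, -B j b, B a b], fun c₀ θ p q => ?_⟩
  have e1 : (fun k => j k - θ * j k + p * a k + q * b k) = (1 - θ) • j + p • a + q • b := by
    funext k; simp; ring
  have e2 : (fun k => j k - θ * j k + p * (0 : Fin n → ℝ) k + q * (0 : Fin n → ℝ) k)
      = (1 - θ) • j := by
    funext k; simp; ring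
  have e3 : ∀ c, cQuadratic (ω x) d c i = -(1 / 2) * (c ⬝ᵥ M *ᵥ c) * D + (c ⬝ᵥ d) * c i :=
    fun c => rfl
  rw [e1, e2, cForce_eq_cQuadratic, cForce_eq_cQuadratic]
  simp only [e3, B, mulVec_add, mulVec_smul, dotProduct_add, add_dotProduct, dotProduct_smul,
    smul_dotProduct, Pi.add_apply, Pi.smul_apply, smul_eq_mul, Matrix.cons_val]
  ring

/-- The path `t ↦ exp (c * cutoff t)`. -/
def expCutoffPath (c : ℝ) : I →ᵇ ℝ :=
  mkOfCompact ⟨fun t => Real.exp (c * cutoff t), by unfold cutoff; fun_prop⟩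

theorem expCutoffPath_apply (c : ℝ) (t : I) : expCutoffPath c t = Real.exp (c * cutoff t) := rfl

/-- The mean error of the contracted right-hand side of the c system along a segment, as an
analytic function of the length of the segment and of the coefficients of the bumps. -/
theorem exists_analyticAt_mean_cForce (hω : IsAnalyticMetric ω Ω) {x₀ : Fin n → ℝ} (hx₀ : x₀ ∈ Ω)
    {α : (Fin n → ℝ) → ℝ} (hα : AnalyticAt ℝ α x₀) (d : Fin n → ℝ) (i : Fin n) :
    ∃ E : ℝ × ((Fin n → ℝ) × (Fin n → ℝ)) → ℝ, (∀ c, AnalyticAt ℝ E (0, c)) ∧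
      (∀ c, E (0, c) = E (0, 0) + cQuadratic (ω x₀) d c.1 i + cQuadratic (ω x₀) d c.2 i) ∧
      ∀ᶠ ε in 𝓝 (0 : ℝ), ∀ c, E (ε, c) = ∫ t in (0 : ℝ)..1,
        (cForce k₀ ω d i (x₀ + t • ε • d) (α (x₀ + t • ε • d) - cutoff t * α x₀)
            (fun k => gradient₁ α (x₀ + t • ε • d) k - cutoff t * gradient₁ α x₀ k
              + bumpFst t * c.1 k + bumpSnd t * c.2 k)
          - cForce k₀ ω d i (x₀ + t • ε • d) (α (x₀ + t • ε • d))
              (gradient₁ α (x₀ + t • ε • d))) := by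
  have hgrad : ∀ k, AnalyticAt ℝ (fun y => gradient₁ α y k) x₀ := fun k => hα.partialD k
  have hexpan : AnalyticAt ℝ (fun y => Real.exp (2 * α y)) x₀ :=
    (analyticAt_const.mul hα).rexp'
  obtain ⟨A, hA, hAe⟩ := hexpan.exists_analyticAt_rays
  choose N hN hNe using fun k h => (hω.analyticAt_inv hx₀ k h).exists_analyticAt_rays
  have hDan : AnalyticAt ℝ (fun y => ∑ j, ω y i j * d j) x₀ :=
    Finset.analyticAt_fun_sum _ fun j _ => (hω.analytic i j x₀ hx₀).mul analyticAt_const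
  obtain ⟨D, hD, hDe⟩ := hDan.exists_analyticAt_rays
  choose g hg hge using fun k => (hgrad k).exists_analyticAt_rays
  have hΓan : ∀ k, AnalyticAt ℝ (fun y => ∑ j, christoffel ω k i j y * d j) x₀ := fun k =>
    Finset.analyticAt_fun_sum _ fun j _ =>
      (hω.analyticAt_christoffel hx₀ k i j).mul analyticAt_const
  choose Γ hΓ hΓe using fun k => (hΓan k).exists_analyticAt_rays
  obtain ⟨H, hH, hHe⟩ := (analyticAt_cForce (k₀ := k₀) hω hx₀ d i hα hgrad).exists_analyticAt_rays
  -- `C` is the gradient part of the section and `P` the whole error, both as paths. All data along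
  -- the ray are analytic path-valued functions and `P` is polynomial in them; the exponential fits
  -- because `exp (2α - 2θ α(x₀))` factors into a ray term and a fixed path.
  let C : Fin n → ℝ × ((Fin n → ℝ) × (Fin n → ℝ)) → (I →ᵇ ℝ) := fun k q =>
    g k (q.1 • d) - gradient₁ α x₀ k • cutoffPath + q.2.1 k • bumpFstPath + q.2.2 k • bumpSndPath
  let P : ℝ × ((Fin n → ℝ) × (Fin n → ℝ)) → (I →ᵇ ℝ) := fun q =>
    (1 / 2 : ℝ) • ((k₀ • (1 - A (q.1 • d) * expCutoffPath (-(2 * α x₀)))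
        - ∑ k, ∑ h, N k h (q.1 • d) * C h q * C k q) * D (q.1 • d))
      + C i q * (∑ k, d k • C k q) + ∑ k, C k q * Γ k (q.1 • d) - H (q.1 • d)
  have hray : ∀ (f : (Fin n → ℝ) → (I →ᵇ ℝ)), AnalyticAt ℝ f 0 →
      ∀ c : (Fin n → ℝ) × (Fin n → ℝ), AnalyticAt ℝ (fun q : ℝ × _ => f (q.1 • d)) (0, c) := by
    intro f hf c
    refine AnalyticAt.fun_comp (f := fun q : ℝ × ((Fin n → ℝ) × (Fin n → ℝ)) => q.1 • d)
      (by simpa using hf) ?_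
    exact analyticAt_fst.smul_const_right d
  have hCan : ∀ k c, AnalyticAt ℝ (C k) (0, c) := by
    intro k c
    have h1 : AnalyticAt ℝ (fun q : ℝ × ((Fin n → ℝ) × (Fin n → ℝ)) => q.2.1 k) (0, c) :=
      AnalyticAt.clm_const_apply (A := fun q => q) analyticAt_id
        ((ContinuousLinearMap.proj (R := ℝ) (φ := fun _ : Fin n => ℝ) k).comp
          ((ContinuousLinearMap.fst ℝ (Fin n → ℝ) (Fin n → ℝ)).comp
            (ContinuousLinearMap.snd ℝ ℝ ((Fin n → ℝ) × (Fin n → ℝ)))))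
    have h2 : AnalyticAt ℝ (fun q : ℝ × ((Fin n → ℝ) × (Fin n → ℝ)) => q.2.2 k) (0, c) :=
      AnalyticAt.clm_const_apply (A := fun q => q) analyticAt_id
        ((ContinuousLinearMap.proj (R := ℝ) (φ := fun _ : Fin n => ℝ) k).comp
          ((ContinuousLinearMap.snd ℝ (Fin n → ℝ) (Fin n → ℝ)).comp
            (ContinuousLinearMap.snd ℝ ℝ ((Fin n → ℝ) × (Fin n → ℝ)))))
    exact (((hray _ (hg k) c).sub analyticAt_const).add (h1.smul_const_right _)).add
      (h2.smul_const_right _)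
  have hPan : ∀ c, AnalyticAt ℝ P (0, c) := by
    intro c
    refine AnalyticAt.sub (AnalyticAt.add (AnalyticAt.add ?_ ?_) ?_) (hray _ hH c)
    · refine AnalyticAt.fun_const_smul (AnalyticAt.mul (AnalyticAt.sub (AnalyticAt.fun_const_smul
        (analyticAt_const.sub ((hray _ hA c).mul analyticAt_const))) ?_) (hray _ hD c))
      exact Finset.analyticAt_fun_sum _ fun k _ => Finset.analyticAt_fun_sum _ fun h _ =>
        ((hray _ (hN k h) c).mul (hCan h c)).mul (hCan k c)
    · exact (hCan i c).mul (Finset.analyticAt_fun_sum _ fun k _ => (hCan k c).fun_const_smul)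
    · exact Finset.analyticAt_fun_sum _ fun k _ => (hCan k c).mul (hray _ (hΓ k) c)
  have hline : Tendsto (fun ε : ℝ => ε • d) (𝓝 0) (𝓝 0) := by
    simpa using (by fun_prop : Continuous fun ε : ℝ => ε • d).tendsto 0
  have hval : ∀ᶠ ε in 𝓝 (0 : ℝ), ∀ c, ∀ t : I, P (ε, c) t =
      cForce k₀ ω d i (x₀ + (t : ℝ) • ε • d) (α (x₀ + (t : ℝ) • ε • d) - cutoff t * α x₀)
            (fun k => gradient₁ α (x₀ + (t : ℝ) • ε • d) k - cutoff t * gradient₁ α x₀ k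
              + bumpFst t * c.1 k + bumpSnd t * c.2 k)
          - cForce k₀ ω d i (x₀ + (t : ℝ) • ε • d) (α (x₀ + (t : ℝ) • ε • d))
              (gradient₁ α (x₀ + (t : ℝ) • ε • d)) := by
    filter_upwards [hline.eventually hAe, hline.eventually (eventually_all.2 fun k =>
      eventually_all.2 fun h => hNe k h), hline.eventually hDe,
      hline.eventually (eventually_all.2 hge), hline.eventually (eventually_all.2 hΓe),
      hline.eventually hHe] with ε h1 h2 h3 h4 h5 h6 c t
    have hCt : ∀ k, C k (ε, c) t = gradient₁ α (x₀ + (t : ℝ) • ε • d) k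
        - cutoff t * gradient₁ α x₀ k + bumpFst t * c.1 k + bumpSnd t * c.2 k := by
      intro k
      simp only [C, BoundedContinuousFunction.add_apply, BoundedContinuousFunction.sub_apply,
        BoundedContinuousFunction.smul_apply, smul_eq_mul, h4, cutoffPath_apply,
        bumpFstPath_apply, bumpSndPath_apply]
      ring
    have hexp : Real.exp (2 * (α (x₀ + (t : ℝ) • ε • d) - cutoff t * α x₀)) =
        Real.exp (2 * α (x₀ + (t : ℝ) • ε • d)) * Real.exp (-(2 * α x₀) * cutoff t) := by
      rw [← Real.exp_add]; ring_nf
    simp only [P, BoundedContinuousFunction.add_apply, BoundedContinuousFunction.sub_apply,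
      BoundedContinuousFunction.smul_apply, BoundedContinuousFunction.mul_apply, smul_eq_mul,
      BoundedContinuousFunction.sum_apply, hCt, h1, h2, h3, h5, h6, expCutoffPath_apply]
    rw [cForce_eq (c := fun k => gradient₁ α (x₀ + (t : ℝ) • ε • d) k
      - cutoff t * gradient₁ α x₀ k + bumpFst t * c.1 k + bumpSnd t * c.2 k), hexp]
    simp only [show (1 : I →ᵇ ℝ) t = 1 from rfl, mul_comm (d _), mul_assoc]
  refine ⟨fun q => pathIntegral (P q), fun c => (hPan c).clm_const_apply pathIntegral, fun c => ?_,
    hval.mono fun ε hε c => pathIntegral_eq (hε c)⟩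
  obtain ⟨X, hX⟩ := exists_cForce_expansion (k₀ := k₀) (ω := ω) d i x₀ (gradient₁ α x₀) c.1 c.2
  have h0 := hval.self_of_nhds
  -- At `ε = 0` the metric and the jet of `α` are frozen at `x₀`, so only the profiles vary with
  -- `t`. Integration keeps the two squares and kills the bracket.
  have hP : P (0, c) = P (0, 0) + cQuadratic (ω x₀) d c.1 i • (bumpFstPath * bumpFstPath)
      + cQuadratic (ω x₀) d c.2 i • (bumpSndPath * bumpSndPath)
      + (X 0 • bumpFstPath + X 1 • bumpSndPath + X 2 • (cutoffPath * bumpFstPath)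
        + X 3 • (cutoffPath * bumpSndPath) + X 4 • (bumpFstPath * bumpSndPath)) := by
    ext t
    simp only [BoundedContinuousFunction.add_apply, BoundedContinuousFunction.smul_apply,
      BoundedContinuousFunction.mul_apply, smul_eq_mul, cutoffPath_apply, bumpFstPath_apply,
      bumpSndPath_apply, h0, zero_smul, smul_zero, add_zero, hX, Prod.fst_zero, Prod.snd_zero]
    ring
  change pathIntegral (P (0, c)) = pathIntegral (P (0, 0)) + _ + _
  rw [hP]
  simp only [map_add, map_smul, smul_eq_mul, pathIntegral_bumpFstPath_sq,
    pathIntegral_bumpSndPath_sq, pathIntegral_bumpFstPath, pathIntegral_bumpSndPath,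
    pathIntegral_cutoffPath_mul_bumpFstPath, pathIntegral_cutoffPath_mul_bumpSndPath,
    pathIntegral_bumpFstPath_mul_bumpSndPath]
  ring

/-- For every short segment in a suitable direction there are coefficients of the bumps for which
the mean error of the contracted right-hand side of the c system vanishes. -/
theorem exists_direction_mean_cForce_eq_zero (hn : 3 ≤ n) (hω : IsAnalyticMetric ω Ω)
    {x₀ : Fin n → ℝ} (hx₀ : x₀ ∈ Ω) {α : (Fin n → ℝ) → ℝ} (hα : AnalyticAt ℝ α x₀) :
    ∃ d : Fin n → ℝ, d ≠ 0 ∧ ∀ᶠ ε in 𝓝 (0 : ℝ), ∃ a b : Fin n → ℝ, ∀ i,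
      ∫ t in (0 : ℝ)..1,
        (cForce k₀ ω d i (x₀ + t • ε • d) (α (x₀ + t • ε • d) - cutoff t * α x₀)
            (fun k => gradient₁ α (x₀ + t • ε • d) k - cutoff t * gradient₁ α x₀ k
              + bumpFst t * a k + bumpSnd t * b k)
          - cForce k₀ ω d i (x₀ + t • ε • d) (α (x₀ + t • ε • d))
              (gradient₁ α (x₀ + t • ε • d))) = 0 := by
  have hsymm := hω.symm x₀ hx₀
  have hdet := hω.nondegenerate x₀ hx₀
  obtain ⟨d, e, hde, hpos⟩ := hsymm.exists_orthogonal_same_sign hn hdet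
  refine ⟨d, fun h => by simp [h] at hpos, ?_⟩
  choose E hE hE0 hEe using fun i => exists_analyticAt_mean_cForce (k₀ := k₀) hω hx₀ hα d i
  obtain ⟨a, b, hab, hsurj⟩ := exists_cQuadratic_add_eq hsymm hdet hde hpos
    (fun i => -E i (0, 0))
  let F : ℝ × ((Fin n → ℝ) × (Fin n → ℝ)) → Fin n → ℝ := fun q i => E i q
  have hF : AnalyticAt ℝ F (0, (a, b)) := analyticAt_pi_iff.2 fun i => hE i (a, b)
  have hF0 : ∀ c, F (0, c) = F (0, 0) + (cQuadratic (ω x₀) d c.1 + cQuadratic (ω x₀) d c.2) := by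
    intro c
    funext i
    change E i (0, c) = E i (0, 0) + (_ + _)
    rw [hE0 i c, add_assoc]
  have hzero : F (0, (a, b)) = 0 := by
    rw [hF0, hab]
    funext i
    simp [F]
  have hev := hF.hasStrictFDerivAt.eventually_exists_eq_zero hzero fun r' => by
    -- On the line in direction `(a', b')` the map is a polynomial in `t` with linear coefficient
    -- `r'`; hence its derivative in that direction is `r'`.
    obtain ⟨a', b', C, hC⟩ := hsurj r'
    refine ⟨(a', b'), ?_⟩
    have hline : HasDerivAt (fun t : ℝ => ((0 : ℝ), ((a, b) + t • (a', b'))))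
        ((0 : ℝ), (a', b')) 0 := by
      refine (hasDerivAt_const (0 : ℝ) (0 : ℝ)).prodMk ?_
      simpa using ((hasDerivAt_id (0 : ℝ)).smul_const (a', b')).const_add (a, b)
    have h1 : HasDerivAt (fun t : ℝ => F (0, (a, b) + t • (a', b')))
        (fderiv ℝ F (0, (a, b)) (0, (a', b'))) 0 := by
      have h2 : HasFDerivAt F (fderiv ℝ F (0, (a, b))) (0, (a, b) + (0 : ℝ) • (a', b')) := by
        simpa using hF.differentiableAt.hasFDerivAt
      exact h2.comp_hasDerivAt (0 : ℝ) hline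
    have h3 : (fun t : ℝ => F (0, (a, b) + t • (a', b'))) = fun t : ℝ =>
        (F (0, 0) + fun i => -E i (0, 0)) + t • r' + t ^ 2 • C := by
      funext t
      rw [hF0]
      change F (0, 0) + (cQuadratic (ω x₀) d (a + t • a') + cQuadratic (ω x₀) d (b + t • b')) = _
      rw [hC]
      abel
    rw [h3] at h1
    have h4 : HasDerivAt (fun t : ℝ => (F (0, 0) + fun i => -E i (0, 0)) + t • r' + t ^ 2 • C)
        r' 0 := by
      have h5 := ((hasDerivAt_id (0 : ℝ)).smul_const r').const_add (F (0, 0) + fun i => -E i (0, 0))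
      have h6 := (hasDerivAt_pow 2 (0 : ℝ)).smul_const C
      exact (h5.fun_add h6).congr_deriv (by simp)
    exact h1.unique h4
  filter_upwards [hev, eventually_all.2 hEe] with ε hε hEε
  obtain ⟨c, hc⟩ := hε
  exact ⟨c.1, c.2, fun i => by rw [← hEε i c]; exact congrFun hc i⟩

end Steering

end

/-! ### The general solution of the c system. -/

noncomputable section

open Filter Topology

section GeneralSolution

variable {n : ℕ} {k₀ : ℝ} {Ω : Set (Fin n → ℝ)} {ω : (Fin n → ℝ) → Matrix (Fin n) (Fin n) ℝ}
  {x₀ x : Fin n → ℝ} {r : ℝ} {Φ : (Fin n → ℝ) → CState n →L[ℝ] CState n}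

/-- `Φ` is an analytic fundamental solution, normalized at `x₀`, of the linear system for states on
the ball of radius `r` around `x₀`. -/
structure IsFundamentalSolution (k₀ : ℝ) (Ω : Set (Fin n → ℝ))
    (ω : (Fin n → ℝ) → Matrix (Fin n) (Fin n) ℝ) (x₀ : Fin n → ℝ) (r : ℝ)
    (Φ : (Fin n → ℝ) → CState n →L[ℝ] CState n) : Prop where
  pos : 0 < r
  subset : Metric.ball x₀ r ⊆ Ω
  apply_center : Φ x₀ = 1
  analyticAt : ∀ x ∈ Metric.ball x₀ r, AnalyticAt ℝ Φ x
  isUnit : ∀ x ∈ Metric.ball x₀ r, IsUnit (Φ x)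
  fderiv_eq : ∀ x ∈ Metric.ball x₀ r, ∀ h, fderiv ℝ Φ x h = cConnection k₀ ω x h * Φ x

theorem exists_isFundamentalSolution (hn : 4 ≤ n) (hΩ : IsOpen Ω) (hω : IsAnalyticMetric ω Ω)
    (hS : IsSAdmissible k₀ ω Ω) (hx₀ : x₀ ∈ Ω) :
    ∃ r Φ, IsFundamentalSolution k₀ Ω ω x₀ r Φ := by
  obtain ⟨Φ, hΦ, h1, hd⟩ := exists_fundamental_solution
    (hω.analyticAt_cConnection (k₀ := k₀) hx₀)
    ((hΩ.eventually_mem hx₀).mono fun x hx h k => cConnection_flat hn hΩ hω hS hx h k)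
  have hu : ∀ᶠ x in 𝓝 x₀, IsUnit (Φ x) :=
    hΦ.continuousAt.eventually_mem (Units.isOpen.mem_nhds (by rw [h1]; exact isUnit_one))
  obtain ⟨r, hr, hball⟩ := Metric.eventually_nhds_iff_ball.1
    (((hΩ.eventually_mem hx₀).and hΦ.eventually_analyticAt).and (hu.and hd))
  exact ⟨r, Φ, hr, fun x hx => (hball x hx).1.1, h1, fun x hx => (hball x hx).1.2,
    fun x hx => (hball x hx).2.1, fun x hx => (hball x hx).2.2⟩

namespace IsFundamentalSolution

theorem analyticAt_apply (hΦ : IsFundamentalSolution k₀ Ω ω x₀ r Φ) (hx : x ∈ Metric.ball x₀ r)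
    (w : CState n) : AnalyticAt ℝ (fun y => Φ y w) x :=
  AnalyticAt.clm_const_apply (X := CState n →L[ℝ] CState n) (Y := CState n) (hΦ.analyticAt x hx)
    (ContinuousLinearMap.apply ℝ (CState n) w)

theorem fderiv_apply (hΦ : IsFundamentalSolution k₀ Ω ω x₀ r Φ) (hx : x ∈ Metric.ball x₀ r)
    (w : CState n) (h : Fin n → ℝ) :
    fderiv ℝ (fun y => Φ y w) x h = cConnection k₀ ω x h (Φ x w) := by
  have h1 : fderiv ℝ (fun y => Φ y w) x h = fderiv ℝ Φ x h w :=
    fderiv_clm_const_apply (hΦ.analyticAt x hx).differentiableAt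
      (ContinuousLinearMap.apply ℝ (CState n) w) h
  rw [h1, hΦ.fderiv_eq x hx h]
  rfl

/-- Solutions of the linear system are determined by their value at `x₀`. -/
theorem eq_apply (hΦ : IsFundamentalSolution k₀ Ω ω x₀ r Φ) (hω : IsAnalyticMetric ω Ω)
    {r' : ℝ} (hr' : r' ≤ r) (hr0 : 0 < r') {s : (Fin n → ℝ) → CState n}
    (hs : ∀ x ∈ Metric.ball x₀ r', DifferentiableAt ℝ s x)
    (hsol : ∀ x ∈ Metric.ball x₀ r', ∀ h, fderiv ℝ s x h = cConnection k₀ ω x h (s x)) :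
    ∀ x ∈ Metric.ball x₀ r', s x = Φ x (s x₀) := by
  have hsub := Metric.ball_subset_ball (x := x₀) hr'
  have hd : ∀ x ∈ Metric.ball x₀ r', DifferentiableAt ℝ (fun y => Φ y (s x₀)) x := fun x hx =>
    (hΦ.analyticAt_apply (hsub hx) _).differentiableAt
  intro x hx
  refine sub_eq_zero.1 (eqOn_zero_of_fderiv_eq_linear (F := CState n)
    ((convex_ball x₀ r').starConvex (Metric.mem_ball_self hr0)) (L := cConnection k₀ ω)
    (f := fun y => s y - Φ y (s x₀)) (fun y hy =>
      (hω.analyticAt_cConnection (hΦ.subset (hsub hy))).continuousAt.continuousWithinAt)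
    (fun y hy => (hs y hy).fun_sub (hd y hy)) (fun y hy h => ?_) ?_ x hx)
  · rw [fderiv_fun_sub (hs y hy) (hd y hy), map_sub, ← hsol y hy h,
      ← hΦ.fderiv_apply (hsub hy) _ h]
    rfl
  · rw [hΦ.apply_center]
    exact sub_self _

theorem cEnergy_apply (hΦ : IsFundamentalSolution k₀ Ω ω x₀ r Φ) (hΩ : IsOpen Ω)
    (hω : IsAnalyticMetric ω Ω) (w : CState n) (hx : x ∈ Metric.ball x₀ r) :
    cEnergy k₀ ω x (Φ x w) = cEnergy k₀ ω x₀ w := by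
  have hdiff : ∀ y ∈ Metric.ball x₀ r,
      DifferentiableAt ℝ (fun y => cEnergy k₀ ω y (Φ y w)) y := fun y hy =>
    differentiableAt_cEnergy hω (hΦ.subset hy) (hΦ.analyticAt_apply hy w).differentiableAt
  have hzero : Set.EqOn (fderiv ℝ fun y => cEnergy k₀ ω y (Φ y w)) 0 (Metric.ball x₀ r) := by
    intro y hy
    ext1 h
    rw [fderiv_apply_eq_sum_partialD]
    refine Finset.sum_eq_zero fun a _ => ?_
    rw [partialD_cEnergy hΩ hω (hΦ.subset hy) (hΦ.analyticAt_apply hy w).differentiableAt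
      (hΦ.fderiv_apply hy w), mul_zero]
  have hconst := (convex_ball x₀ r).isPreconnected
  have := Metric.isOpen_ball.is_const_of_fderiv_eq_zero hconst
    (fun y hy => (hdiff y hy).differentiableWithinAt) hzero hx (Metric.mem_ball_self hΦ.pos)
  simpa [hΦ.apply_center] using this

end IsFundamentalSolution

/-- The pairs `(x, τ)` for which the state with 1-jet `τ` at `x₀` is, at `x`, the state of a
1-jet. -/
def generalDomain (k₀ : ℝ) (ω : (Fin n → ℝ) → Matrix (Fin n) (Fin n) ℝ) (x₀ : Fin n → ℝ) (r : ℝ)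
    (Φ : (Fin n → ℝ) → CState n →L[ℝ] CState n) : Set ((Fin n → ℝ) × (ℝ × (Fin n → ℝ))) :=
  {z | z.1 ∈ Metric.ball x₀ r ∧ 0 < (Φ z.1 (jetState k₀ ω x₀ z.2)).1}

/-- The value at `x` of the solution of the c system with 1-jet `τ` at `x₀`. -/
def generalSolution (k₀ : ℝ) (ω : (Fin n → ℝ) → Matrix (Fin n) (Fin n) ℝ) (x₀ : Fin n → ℝ)
    (Φ : (Fin n → ℝ) → CState n →L[ℝ] CState n) (z : (Fin n → ℝ) × (ℝ × (Fin n → ℝ))) : ℝ :=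
  -Real.log (Φ z.1 (jetState k₀ ω x₀ z.2)).1

theorem analyticAt_jetState_right (c : ℝ × (Fin n → ℝ)) :
    AnalyticAt ℝ (fun c => jetState k₀ ω x₀ c) c := by
  have h2 : ∀ i, AnalyticAt ℝ (fun c : ℝ × (Fin n → ℝ) => c.2 i) c := fun i =>
    AnalyticAt.clm_const_apply (A := fun q => q) analyticAt_id
      ((ContinuousLinearMap.proj (R := ℝ) (φ := fun _ : Fin n => ℝ) i).comp
        (ContinuousLinearMap.snd ℝ ℝ (Fin n → ℝ)))
  have hf : AnalyticAt ℝ (fun c : ℝ × (Fin n → ℝ) => Real.exp (-c.1)) c :=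
    analyticAt_fst.neg.rexp'
  refine hf.prod (AnalyticAt.prod (analyticAt_pi_iff.2 fun i => hf.neg.mul (h2 i)) ?_)
  refine (analyticAt_const.mul hf).mul ((analyticAt_const.mul
    ((analyticAt_const.mul analyticAt_fst).rexp'.sub analyticAt_const)).add ?_)
  unfold covectorNormSq
  exact Finset.analyticAt_fun_sum _ fun k _ => Finset.analyticAt_fun_sum _ fun h _ =>
    (analyticAt_const.mul (h2 h)).mul (h2 k)

namespace IsFundamentalSolution

theorem analyticAt_general_state (hΦ : IsFundamentalSolution k₀ Ω ω x₀ r Φ)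
    {z : (Fin n → ℝ) × (ℝ × (Fin n → ℝ))} (hz : z.1 ∈ Metric.ball x₀ r) :
    AnalyticAt ℝ (fun z : (Fin n → ℝ) × (ℝ × (Fin n → ℝ)) =>
      (Φ z.1 (jetState k₀ ω x₀ z.2)).1) z := by
  have h1 : AnalyticAt ℝ (fun z : (Fin n → ℝ) × (ℝ × (Fin n → ℝ)) => Φ z.1) z :=
    (hΦ.analyticAt z.1 hz).fun_comp analyticAt_fst
  have h2 : AnalyticAt ℝ (fun z : (Fin n → ℝ) × (ℝ × (Fin n → ℝ)) => jetState k₀ ω x₀ z.2) z :=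
    (analyticAt_jetState_right z.2).fun_comp analyticAt_snd
  have h3 := h1.bilinear_apply h2 (ContinuousLinearMap.id ℝ (CState n →L[ℝ] CState n))
  exact AnalyticAt.clm_const_apply h3 (ContinuousLinearMap.fst ℝ ℝ ((Fin n → ℝ) × ℝ))

theorem isOpen_generalDomain (hΦ : IsFundamentalSolution k₀ Ω ω x₀ r Φ) :
    IsOpen (generalDomain k₀ ω x₀ r Φ) := by
  refine isOpen_iff_mem_nhds.2 fun z hz => ?_
  filter_upwards [continuousAt_fst.eventually_mem (Metric.isOpen_ball.mem_nhds hz.1),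
    (hΦ.analyticAt_general_state hz.1).continuousAt.eventually (lt_mem_nhds hz.2)] with w h1 h2
    using ⟨h1, h2⟩

theorem analyticOnNhd_generalSolution (hΦ : IsFundamentalSolution k₀ Ω ω x₀ r Φ) :
    AnalyticOnNhd ℝ (generalSolution k₀ ω x₀ Φ) (generalDomain k₀ ω x₀ r Φ) := by
  intro z hz
  have h := AnalyticAt.fun_comp (f := fun z : (Fin n → ℝ) × (ℝ × (Fin n → ℝ)) =>
    (Φ z.1 (jetState k₀ ω x₀ z.2)).1) (analyticAt_log hz.2) (hΦ.analyticAt_general_state hz.1)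
  exact h.neg

theorem cEnergy_apply_jetState (hΦ : IsFundamentalSolution k₀ Ω ω x₀ r Φ) (hΩ : IsOpen Ω)
    (hω : IsAnalyticMetric ω Ω) (τ : ℝ × (Fin n → ℝ)) (hx : x ∈ Metric.ball x₀ r) :
    cEnergy k₀ ω x (Φ x (jetState k₀ ω x₀ τ)) = k₀ :=
  (hΦ.cEnergy_apply hΩ hω _ hx).trans (cEnergy_jetState τ)

theorem cSystemAt_generalSolution (hΦ : IsFundamentalSolution k₀ Ω ω x₀ r Φ) (hΩ : IsOpen Ω)
    (hω : IsAnalyticMetric ω Ω) {z : (Fin n → ℝ) × (ℝ × (Fin n → ℝ))}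
    (hz : z ∈ generalDomain k₀ ω x₀ r Φ) :
    CSystemAt k₀ ω (fun y => generalSolution k₀ ω x₀ Φ (y, z.2)) z.1 := by
  have hball := Metric.isOpen_ball.eventually_mem hz.1
  exact cSystemAt_neg_log (s := fun y => Φ y (jetState k₀ ω x₀ z.2))
    (hball.mono fun y hy => (hΦ.analyticAt_apply hy _).differentiableAt)
    (hball.mono fun y hy => hΦ.fderiv_apply hy _) hz.2 (hΦ.cEnergy_apply_jetState hΩ hω _ hz.1)

/-- Transport by `Φ` preserves the energy, so where the first entry stays positive the transported
state is again that of a 1-jet, and `-log` of the first entry has this 1-jet. -/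
theorem apply_jetState_eq (hΦ : IsFundamentalSolution k₀ Ω ω x₀ r Φ) (hΩ : IsOpen Ω)
    (hω : IsAnalyticMetric ω Ω) {z : (Fin n → ℝ) × (ℝ × (Fin n → ℝ))}
    (hz : z ∈ generalDomain k₀ ω x₀ r Φ) :
    Φ z.1 (jetState k₀ ω x₀ z.2) = jetState k₀ ω z.1 (generalSolution k₀ ω x₀ Φ z,
      gradient₁ (fun y => generalSolution k₀ ω x₀ Φ (y, z.2)) z.1) := by
  refine (eq_jetState hz.2 (hΦ.cEnergy_apply_jetState hΩ hω _ hz.1)).trans ?_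
  congr 2
  funext i
  exact (gradient₁_neg_log (s := fun y => Φ y (jetState k₀ ω x₀ z.2))
    (hΦ.analyticAt_apply hz.1 _).differentiableAt (hΦ.fderiv_apply hz.1 _) hz.2 i).symm

/-- The 1-jet at `x` determines the state at `x`; invertibility of `Φ x` gives back the state at
`x₀`, hence its 1-jet `τ`. -/
theorem injOn_generalSolution (hΦ : IsFundamentalSolution k₀ Ω ω x₀ r Φ) (hΩ : IsOpen Ω)
    (hω : IsAnalyticMetric ω Ω) :
    Set.InjOn (fun z => (z.1, generalSolution k₀ ω x₀ Φ z,
      gradient₁ (fun y => generalSolution k₀ ω x₀ Φ (y, z.2)) z.1))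
      (generalDomain k₀ ω x₀ r Φ) := by
  rintro ⟨x, τ⟩ hz ⟨x', τ'⟩ hz' h
  obtain rfl : x = x' := congrArg Prod.fst h
  have h2 := congrArg Prod.snd h
  have h3 : Φ x (jetState k₀ ω x₀ τ) = Φ x (jetState k₀ ω x₀ τ') :=
    (hΦ.apply_jetState_eq hΩ hω hz).trans
      ((congrArg (jetState k₀ ω x) h2).trans (hΦ.apply_jetState_eq hΩ hω hz').symm)
  obtain ⟨u, hu⟩ := hΦ.isUnit x hz.1
  have hinj : Function.Injective (Φ x) := by
    refine Function.LeftInverse.injective (g := (↑u⁻¹ : CState n →L[ℝ] CState n)) fun w => ?_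
    rw [← hu]
    exact DFunLike.congr_fun u.inv_mul w
  exact Prod.ext rfl (jetState_injective (hinj h3))

/-- The state of the null jet is the constant `f = 1`, `p = 0`, `h = 0`, which solves the linear
system. This is why the parameter 0 gives the null solution. -/
theorem apply_jetState_zero (hΦ : IsFundamentalSolution k₀ Ω ω x₀ r Φ)
    (hω : IsAnalyticMetric ω Ω) (hx : x ∈ Metric.ball x₀ r) :
    Φ x (jetState k₀ ω x₀ 0) = (1, 0, 0) := by
  rw [jetState_zero]
  refine (hΦ.eq_apply hω le_rfl hΦ.pos (s := fun _ => ((1, 0, 0) : CState n))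
    (fun y _ => differentiableAt_const _) (fun y _ => ?_) x hx).symm
  refine (fderiv_eq_cConnection_iff (differentiableAt_const _)).2 fun a => ?_
  simp [partialD_const]

/-- A solution of the c system near `x₀` is the general solution for the parameters given by its
1-jet at `x₀`. -/
theorem eq_generalSolution (hΦ : IsFundamentalSolution k₀ Ω ω x₀ r Φ) (hΩ : IsOpen Ω)
    (hω : IsAnalyticMetric ω Ω) {r' : ℝ} (hr' : r' ≤ r) (hr0 : 0 < r')
    {α : (Fin n → ℝ) → ℝ} (hα : AnalyticOnNhd ℝ α (Metric.ball x₀ r'))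
    (hc : ∀ x ∈ Metric.ball x₀ r', CSystemAt k₀ ω α x) (hx : x ∈ Metric.ball x₀ r') :
    (x, (α x₀, gradient₁ α x₀)) ∈ generalDomain k₀ ω x₀ r Φ ∧
      α x = generalSolution k₀ ω x₀ Φ (x, (α x₀, gradient₁ α x₀)) := by
  have hsub := Metric.ball_subset_ball (x := x₀) hr'
  have h1 : jetState k₀ ω x (α x, gradient₁ α x) = Φ x (jetState k₀ ω x₀ (α x₀, gradient₁ α x₀)) :=
    hΦ.eq_apply hω hr' hr0 (s := fun y => jetState k₀ ω y (α y, gradient₁ α y))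
      (fun y hy => (analyticAt_jetState hω (hΦ.subset (hsub hy)) (hα y hy)
        fun i => (hα y hy).partialD i).differentiableAt)
      (fun y hy => fderiv_jetState hΩ hω (hΦ.subset (hsub hy)) (hα y hy) (hc y hy)) x hx
  have h2 : (Φ x (jetState k₀ ω x₀ (α x₀, gradient₁ α x₀))).1 = Real.exp (-α x) :=
    (congrArg Prod.fst h1).symm
  refine ⟨⟨hsub hx, h2 ▸ Real.exp_pos _⟩, ?_⟩
  rw [generalSolution, h2, Real.log_exp, neg_neg]

end IsFundamentalSolution

end GeneralSolution

end

/-! ### Integrals of the pulled-back forms along segments and annihilated curves. -/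

noncomputable section

open Filter Topology

section CurveIntegrals

variable {n : ℕ} {k₀ : ℝ} {Ω U : Set (Fin n → ℝ)} {ω : (Fin n → ℝ) → Matrix (Fin n) (Fin n) ℝ}
  {x₀ x e : Fin n → ℝ}

/-- A path which is the image of a segment by a map whose differential is annihilated by a 1-form
is integrable for this form, with integral zero. -/
theorem curveIntegral_eq_zero_of_fderiv {E : Type*} [NormedAddCommGroup E] [NormedSpace ℝ E]
    {θ : E → E →L[ℝ] ℝ} {s : Set E} (hs : IsOpen s) {v : E → E}
    (hv : DifferentiableOn ℝ v s) (hθ : ∀ y ∈ s, ∀ h, θ (v y) (fderiv ℝ v y h) = 0) {a b p q : E}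
    (hseg : ∀ t ∈ unitInterval, AffineMap.lineMap a b t ∈ s) {γ : Path p q}
    (hγ : ∀ t : unitInterval, γ t = v (AffineMap.lineMap a b (t : ℝ))) :
    CurveIntegrable θ γ ∧ curveIntegral θ γ = 0 := by
  have hext : Set.EqOn γ.extend (fun t => v (AffineMap.lineMap a b t)) unitInterval := by
    intro t ht
    rw [γ.extend_apply ht]
    exact hγ ⟨t, ht⟩
  have hfun : ∀ t ∈ unitInterval, curveIntegralFun θ γ t = 0 := by
    intro t ht
    have h1 : HasDerivWithinAt (fun t => v (AffineMap.lineMap a b t))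
        (fderiv ℝ v (AffineMap.lineMap a b t) (b - a)) unitInterval t :=
      ((hv.differentiableAt (hs.mem_nhds (hseg t ht))).hasFDerivAt.comp_hasDerivAt t
        AffineMap.hasDerivAt_lineMap).hasDerivWithinAt
    rw [curveIntegralFun_def, derivWithin_congr hext (hext ht),
      h1.derivWithin (uniqueDiffOn_Icc_zero_one t ht), hext ht]
    exact hθ _ (hseg t ht) _
  constructor
  · refine (intervalIntegrable_congr fun t ht => ?_).2 (intervalIntegrable_const (c := (0 : ℝ)))
    rw [Set.uIoc_of_le zero_le_one] at ht
    exact hfun t (Set.Ioc_subset_Icc_self ht)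
  · rw [curveIntegral_def, intervalIntegral.integral_congr (g := fun _ => 0) fun t ht => ?_]
    · simp
    · rw [Set.uIcc_of_le zero_le_one] at ht
      exact hfun t ht

theorem oneForm_apply (θ : Fin n → (Fin n → ℝ) → ℝ) (x h : Fin n → ℝ) :
    oneForm θ x h = ∑ i, θ i x * h i := by
  simp [oneForm]

theorem continuousOn_comp_segment {E F : Type*} [NormedAddCommGroup E] [NormedSpace ℝ E]
    [TopologicalSpace F] {s : Set E} {a d : E} (hseg : ∀ t ∈ unitInterval, a + t • d ∈ s)
    {g : E → F} (hg : ∀ y ∈ s, ContinuousAt g y) :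
    ContinuousOn (fun t : ℝ => g (a + t • d)) (Set.uIcc 0 1) := by
  rw [Set.uIcc_of_le zero_le_one]
  intro t ht
  have h1 : ContinuousAt (fun t : ℝ => a + t • d) t := by fun_prop
  exact (ContinuousAt.comp_of_eq (hg _ (hseg t ht)) h1 rfl).continuousWithinAt

theorem curveIntegral_oneForm_segment (θ : Fin n → (Fin n → ℝ) → ℝ) :
    curveIntegral (oneForm θ) (Path.segment x₀ (x₀ + e)) =
      ∫ t in (0 : ℝ)..1, ∑ i, θ i (x₀ + t • e) * e i := by
  rw [curveIntegral_segment]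
  refine intervalIntegral.integral_congr fun t _ => ?_
  simp only [oneForm_apply, AffineMap.lineMap_apply, vsub_eq_sub, vadd_eq_add, add_sub_cancel_left,
    add_comm (t • e)]

theorem curveIntegrable_oneForm_segment {θ : Fin n → (Fin n → ℝ) → ℝ}
    (hseg : ∀ t ∈ unitInterval, x₀ + t • e ∈ U) (hθ : ∀ i, ∀ y ∈ U, ContinuousAt (θ i) y) :
    CurveIntegrable (oneForm θ) (Path.segment x₀ (x₀ + e)) := by
  rw [curveIntegrable_segment]
  have h1 : ContinuousOn (fun t : ℝ => ∑ i, θ i (x₀ + t • e) * e i) (Set.uIcc 0 1) :=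
    continuousOn_finsetSum _ fun i _ =>
      (continuousOn_comp_segment hseg (hθ i)).mul continuousOn_const
  refine h1.intervalIntegrable.congr fun t _ => ?_
  simp only [oneForm_apply, AffineMap.lineMap_apply, vsub_eq_sub, vadd_eq_add, add_sub_cancel_left,
    add_comm (t • e)]

theorem integral_sum_partialD_segment {f : (Fin n → ℝ) → ℝ}
    (hseg : ∀ t ∈ unitInterval, x₀ + t • e ∈ U) (hf : ∀ y ∈ U, AnalyticAt ℝ f y) :
    ∫ t in (0 : ℝ)..1, ∑ i, partialD i f (x₀ + t • e) * e i = f (x₀ + e) - f x₀ := by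
  have h1 : ∀ t ∈ Set.uIcc (0 : ℝ) 1, HasDerivAt (fun t : ℝ => f (x₀ + t • e))
      (∑ i, partialD i f (x₀ + t • e) * e i) t := by
    intro t ht
    rw [Set.uIcc_of_le zero_le_one] at ht
    have h2 : HasDerivAt (fun t : ℝ => x₀ + t • e) e t := by
      simpa using ((hasDerivAt_id t).smul_const e).const_add x₀
    have h3 := (hf _ (hseg t ht)).differentiableAt.hasFDerivAt.comp_hasDerivAt t h2
    refine h3.congr_deriv ?_
    rw [fderiv_apply_eq_sum_partialD]
    exact Finset.sum_congr rfl fun i _ => mul_comm _ _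
  have h2 : ContinuousOn (fun t : ℝ => ∑ i, partialD i f (x₀ + t • e) * e i) (Set.uIcc 0 1) :=
    continuousOn_finsetSum _ fun i _ => (continuousOn_comp_segment hseg fun y hy =>
      ((hf y hy).partialD i).continuousAt).mul continuousOn_const
  rw [intervalIntegral.integral_eq_sub_of_hasDerivAt h1 h2.intervalIntegrable]
  simp

theorem cRHS_symm (hΩ : IsOpen Ω) (hω : IsAnalyticMetric ω Ω) (hx : x ∈ Ω) (i j : Fin n) (c₀ : ℝ)
    (c : Fin n → ℝ) : cRHS k₀ ω i j x c₀ c = cRHS k₀ ω j i x c₀ c := by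
  have h1 : ω x i j = ω x j i := (hω.symm x hx).apply j i
  simp only [cRHS, hω.christoffel_symm hΩ hx _ i j]
  rw [h1, mul_comm (c i)]

/-- For a section which joins the null jet at `x₀` to the jet of a solution `α` of the c system at
the end of a segment, and which has the means of `α` along the segment, the parameters shifted
along the segment are the 1-jet of `α` at `x₀`. -/
theorem shiftedParam_segment (hΩ : IsOpen Ω) (hω : IsAnalyticMetric ω Ω) (hU : U ⊆ Ω)
    (hseg : ∀ t ∈ unitInterval, x₀ + t • e ∈ U) {α ρ₀ : (Fin n → ℝ) → ℝ}
    {ρ : Fin n → (Fin n → ℝ) → ℝ} (hα : ∀ y ∈ U, AnalyticAt ℝ α y)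
    (hρ₀ : ∀ y ∈ U, AnalyticAt ℝ ρ₀ y) (hρ : ∀ i, ∀ y ∈ U, AnalyticAt ℝ (ρ i) y)
    (hc : ∀ y ∈ U, CSystemAt k₀ ω α y) (h₀ : ρ₀ x₀ = 0) (h₀' : ρ₀ (x₀ + e) = α (x₀ + e))
    (h₁ : ∀ i, ρ i x₀ = 0) (h₁' : ∀ i, ρ i (x₀ + e) = partialD i α (x₀ + e))
    (hmean : ∀ i, ∫ t in (0 : ℝ)..1, (ρ i (x₀ + t • e) - gradient₁ α (x₀ + t • e) i) = 0)
    (hforce : ∀ i, ∫ t in (0 : ℝ)..1,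
      (cForce k₀ ω e i (x₀ + t • e) (ρ₀ (x₀ + t • e)) (fun k => ρ k (x₀ + t • e))
        - cForce k₀ ω e i (x₀ + t • e) (α (x₀ + t • e)) (gradient₁ α (x₀ + t • e))) = 0) :
    shiftedParam k₀ ω ρ₀ ρ 0 (Path.segment x₀ (x₀ + e)) = (α x₀, gradient₁ α x₀) := by
  have hint : ∀ {g : (Fin n → ℝ) → ℝ}, (∀ y ∈ U, AnalyticAt ℝ g y) →
      IntervalIntegrable (fun t : ℝ => g (x₀ + t • e)) MeasureTheory.volume 0 1 := fun hg =>
    (continuousOn_comp_segment hseg fun y hy => (hg y hy).continuousAt).intervalIntegrable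
  have hgrad : ∀ i, ∀ y ∈ U, AnalyticAt ℝ (fun y => gradient₁ α y i) y := fun i y hy =>
    (hα y hy).partialD i
  have hsum : ∀ {f : (Fin n → ℝ) → ℝ}, (∀ y ∈ U, AnalyticAt ℝ f y) → ∀ y ∈ U,
      AnalyticAt ℝ (fun y => ∑ i, partialD i f y * e i) y := fun hf y hy =>
    Finset.analyticAt_fun_sum _ fun i _ => ((hf y hy).partialD i).mul analyticAt_const
  refine Prod.ext ?_ (funext fun i => ?_)
  · change 0 + curveIntegral (oneForm (potentialA ρ₀ ρ)) _ = α x₀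
    -- Comparison with `α`: the exact parts integrate to `(α(x₀ + e) - 0) - (α(x₀ + e) - α(x₀)) =
    -- α(x₀)`, and the remaining term has mean zero.
    have h1 : ∀ t : ℝ, ∑ i, potentialA ρ₀ ρ i (x₀ + t • e) * e i =
        (∑ i, partialD i ρ₀ (x₀ + t • e) * e i - ∑ i, partialD i α (x₀ + t • e) * e i)
          - ∑ i, (ρ i (x₀ + t • e) - gradient₁ α (x₀ + t • e) i) * e i := by
      intro t
      simp only [← Finset.sum_sub_distrib]
      exact Finset.sum_congr rfl fun i _ => by rw [potentialA, gradient₁]; ring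
    have h2 : ∀ i, IntervalIntegrable
        (fun t : ℝ => (ρ i (x₀ + t • e) - gradient₁ α (x₀ + t • e) i) * e i)
        MeasureTheory.volume 0 1 := fun i =>
      ((hint (hρ i)).sub (hint (hgrad i))).mul_const _
    have h3 := hint (g := fun y => ∑ i, (ρ i y - gradient₁ α y i) * e i) fun y hy =>
      Finset.analyticAt_fun_sum _ fun i _ =>
        ((hρ i y hy).sub (hgrad i y hy)).mul analyticAt_const
    rw [zero_add, curveIntegral_oneForm_segment, intervalIntegral.integral_congr fun t _ => h1 t,
      intervalIntegral.integral_sub ((hint (hsum hρ₀)).sub (hint (hsum hα))) h3,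
      intervalIntegral.integral_sub (hint (hsum hρ₀)) (hint (hsum hα)),
      integral_sum_partialD_segment hseg hρ₀, integral_sum_partialD_segment hseg hα,
      intervalIntegral.integral_finsetSum fun i _ => h2 i]
    simp only [intervalIntegral.integral_mul_const, hmean, zero_mul, Finset.sum_const_zero, h₀, h₀']
    ring
  · change 0 + curveIntegral (oneForm fun j => potentialB k₀ ω ρ₀ ρ j i) _ = gradient₁ α x₀ i
    -- For `α` itself the contracted force is the derivative of `∂ᵢα` along the segment, so the same
    -- comparison leaves `∂ᵢα(x₀)` minus a mean error that vanishes by assumption.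
    have hforceα : ∀ t ∈ unitInterval, cForce k₀ ω e i (x₀ + t • e) (α (x₀ + t • e))
        (gradient₁ α (x₀ + t • e)) = ∑ j, partialD j (partialD i α) (x₀ + t • e) * e j := by
      intro t ht
      refine Finset.sum_congr rfl fun j _ => ?_
      rw [cRHS_symm hΩ hω (hU (hseg t ht)), hc _ (hseg t ht) j i]
    have h1 : ∀ t ∈ unitInterval, ∑ j, potentialB k₀ ω ρ₀ ρ j i (x₀ + t • e) * e j =
        (∑ j, partialD j (ρ i) (x₀ + t • e) * e j
          - ∑ j, partialD j (partialD i α) (x₀ + t • e) * e j)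
          - (cForce k₀ ω e i (x₀ + t • e) (ρ₀ (x₀ + t • e)) (fun k => ρ k (x₀ + t • e))
            - cForce k₀ ω e i (x₀ + t • e) (α (x₀ + t • e)) (gradient₁ α (x₀ + t • e))) := by
      intro t ht
      rw [hforceα t ht]
      simp only [cForce, ← Finset.sum_sub_distrib]
      exact Finset.sum_congr rfl fun j _ => by rw [potentialB]; ring
    have hpart : ∀ y ∈ U, AnalyticAt ℝ (partialD i α) y := fun y hy => (hα y hy).partialD i
    have h2 := (hint fun y hy => analyticAt_cForce (k₀ := k₀) hω (hU hy) e i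
      (β := fun y k => ρ k y) (hρ₀ y hy) fun k => hρ k y hy).sub
      (hint fun y hy => analyticAt_cForce (k₀ := k₀) hω (hU hy) e i (hα y hy) fun k => hgrad k y hy)
    rw [zero_add, curveIntegral_oneForm_segment, intervalIntegral.integral_congr fun t ht =>
        h1 t (by rwa [Set.uIcc_of_le zero_le_one] at ht),
      intervalIntegral.integral_sub ((hint (hsum (hρ i))).sub (hint (hsum hpart))) h2,
      intervalIntegral.integral_sub (hint (hsum (hρ i))) (hint (hsum hpart)),
      integral_sum_partialD_segment hseg (hρ i), integral_sum_partialD_segment hseg hpart,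
      hforce i, h₁, h₁', gradient₁]
    ring

/-- Parameters are not shifted further along a path in the image of a map whose differential is
annihilated by the forms. -/
theorem shiftedParam_segment_trans (hω : IsAnalyticMetric ω Ω) (hU : U ⊆ Ω)
    (hUo : IsOpen U) (hseg : ∀ t ∈ unitInterval, x₀ + t • e ∈ U) {ρ₀ : (Fin n → ℝ) → ℝ}
    {ρ : Fin n → (Fin n → ℝ) → ℝ} (hρ₀ : ∀ y ∈ U, AnalyticAt ℝ ρ₀ y)
    (hρ : ∀ i, ∀ y ∈ U, AnalyticAt ℝ (ρ i) y) (τ : ℝ × (Fin n → ℝ))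
    {v : (Fin n → ℝ) → (Fin n → ℝ)} (hv : DifferentiableOn ℝ v U)
    (hann : ∀ x ∈ U, ∀ h : Fin n → ℝ, sigma₀ ρ₀ ρ (v x) (fderiv ℝ v x h) = 0 ∧
      ∀ i, sigma₁ k₀ ω ρ₀ ρ i (v x) (fderiv ℝ v x h) = 0) {a b q : Fin n → ℝ}
    (hseg' : ∀ t ∈ unitInterval, AffineMap.lineMap a b t ∈ U) {γ : Path (x₀ + e) q}
    (hγ : ∀ t : unitInterval, γ t = v (AffineMap.lineMap a b (t : ℝ))) :
    shiftedParam k₀ ω ρ₀ ρ τ ((Path.segment x₀ (x₀ + e)).trans γ) =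
      shiftedParam k₀ ω ρ₀ ρ τ (Path.segment x₀ (x₀ + e)) := by
  have h0 := curveIntegral_eq_zero_of_fderiv hUo hv (fun y hy h => (hann y hy h).1) hseg' hγ
  have h1 := fun i =>
    curveIntegral_eq_zero_of_fderiv hUo hv (fun y hy h => (hann y hy h).2 i) hseg' hγ
  have hs0 : CurveIntegrable (sigma₀ ρ₀ ρ) (Path.segment x₀ (x₀ + e)) :=
    curveIntegrable_oneForm_segment hseg fun i y hy =>
      (((hρ₀ y hy).partialD i).sub (hρ i y hy)).continuousAt
  have hs1 : ∀ i, CurveIntegrable (sigma₁ k₀ ω ρ₀ ρ i) (Path.segment x₀ (x₀ + e)) := fun i =>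
    curveIntegrable_oneForm_segment hseg fun j y hy =>
      (((hρ i y hy).partialD j).sub (analyticAt_cRHS hω (hU hy) i j (β := fun y k => ρ k y)
        (hρ₀ y hy) fun k => hρ k y hy)).continuousAt
  simp only [shiftedParam, curveIntegral_trans hs0 h0.1, h0.2, curveIntegral_trans (hs1 _) (h1 _).1,
    (h1 _).2, add_zero]

end CurveIntegrals

end

/-! ### Construction of the section for a given solution. -/

noncomputable section

open Filter Topology

section Representation

variable {n : ℕ} {k₀ : ℝ} {Ω : Set (Fin n → ℝ)} {ω : (Fin n → ℝ) → Matrix (Fin n) (Fin n) ℝ}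
  {x₀ : Fin n → ℝ}

theorem cForce_smul (c : ℝ) (d : Fin n → ℝ) (i : Fin n) (x : Fin n → ℝ) (c₀ : ℝ)
    (c₁ : Fin n → ℝ) : cForce k₀ ω (c • d) i x c₀ c₁ = c * cForce k₀ ω d i x c₀ c₁ := by
  simp only [cForce, Finset.mul_sum, Pi.smul_apply, smul_eq_mul]
  exact Finset.sum_congr rfl fun j _ => by ring

theorem analyticAt_cos_mul_const (m t : ℝ) : AnalyticAt ℝ (fun t => Real.cos (m * t)) t :=
  Real.analyticAt_cos.fun_comp (analyticAt_const.mul analyticAt_id)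

theorem analyticAt_cutoff (t : ℝ) : AnalyticAt ℝ cutoff t :=
  analyticAt_const.mul ((analyticAt_cos_mul_const _ t).add (analyticAt_cos_mul_const _ t))

theorem analyticAt_bumpFst (t : ℝ) : AnalyticAt ℝ bumpFst t :=
  (analyticAt_cos_mul_const _ t).sub (analyticAt_cos_mul_const _ t)

theorem analyticAt_bumpSnd (t : ℝ) : AnalyticAt ℝ bumpSnd t :=
  (analyticAt_cos_mul_const _ t).sub (analyticAt_cos_mul_const _ t)

theorem integral_cutoff_bump (c a b : ℝ) :
    ∫ t in (0 : ℝ)..1, (-(cutoff t * c) + bumpFst t * a + bumpSnd t * b) = 0 := by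
  rw [← pathIntegral_eq (f := -(c • cutoffPath) + a • bumpFstPath + b • bumpSndPath) fun t => ?_]
  · simp [pathIntegral_cutoffPath, pathIntegral_bumpFstPath, pathIntegral_bumpSndPath]
  · simp only [BoundedContinuousFunction.add_apply, BoundedContinuousFunction.neg_apply,
      BoundedContinuousFunction.smul_apply, smul_eq_mul, cutoffPath_apply,
      bumpFstPath_apply, bumpSndPath_apply]
    ring

/-- On a ball around `x₀`, there are sections which join the null jet to the jet of a given solution
of the c system, along a segment with end `x₀`, such that the shifted parameters are the 1-jet of
the solution at `x₀`. -/
theorem exists_section_shiftedParam_eq (hn : 3 ≤ n) (hΩ : IsOpen Ω) (hω : IsAnalyticMetric ω Ω)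
    {r : ℝ} (hr : 0 < r) (hball : Metric.ball x₀ r ⊆ Ω) {α : (Fin n → ℝ) → ℝ}
    (hα : ∀ x ∈ Metric.ball x₀ r, AnalyticAt ℝ α x)
    (hc : ∀ x ∈ Metric.ball x₀ r, CSystemAt k₀ ω α x) :
    ∃ (e : Fin n → ℝ) (ρ₀ : (Fin n → ℝ) → ℝ) (ρ : Fin n → (Fin n → ℝ) → ℝ),
      (∀ t ∈ unitInterval, x₀ + t • e ∈ Metric.ball x₀ r) ∧
      (∀ x ∈ Metric.ball x₀ r, AnalyticAt ℝ ρ₀ x) ∧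
      (∀ i, ∀ x ∈ Metric.ball x₀ r, AnalyticAt ℝ (ρ i) x) ∧
      ρ₀ x₀ = 0 ∧ (∀ i, ρ i x₀ = 0) ∧ ρ₀ (x₀ + e) = α (x₀ + e) ∧
      (∀ i, ρ i (x₀ + e) = partialD i α (x₀ + e)) ∧
      shiftedParam k₀ ω ρ₀ ρ 0 (Path.segment x₀ (x₀ + e)) = (α x₀, gradient₁ α x₀) := by
  have hx₀ := Metric.mem_ball_self (x := x₀) hr
  obtain ⟨d, hd, hev⟩ :=
    exists_direction_mean_cForce_eq_zero (k₀ := k₀) hn hω (hball hx₀) (hα x₀ hx₀)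
  obtain ⟨m, hm⟩ := Function.ne_iff.1 hd
  have hsmall : ∀ᶠ ε in 𝓝 (0 : ℝ), ‖ε • d‖ < r := by
    have h1 : Tendsto (fun ε : ℝ => ‖ε • d‖) (𝓝 0) (𝓝 0) := by
      simpa using (by fun_prop : Continuous fun ε : ℝ => ‖ε • d‖).tendsto 0
    exact h1.eventually (gt_mem_nhds hr)
  -- A strictly positive `ε` keeps the segment nondegenerate, which is needed to read off its
  -- parameter.
  obtain ⟨ε, ⟨⟨a, b, hab⟩, hεr⟩, hε⟩ :=
    ((((hev.and hsmall).filter_mono nhdsWithin_le_nhds).and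
      (self_mem_nhdsWithin : ∀ᶠ ε in 𝓝[>] (0 : ℝ), ε ∈ Set.Ioi 0))).exists
  have hεm : ε * d m ≠ 0 := mul_ne_zero (ne_of_gt hε) hm
  -- An affine function equal to `t` at `x₀ + t • ε • d`, built from a coordinate with `d m ≠ 0`. It
  -- extends the profiles from the segment to analytic functions on the whole space.
  let ℓ : (Fin n → ℝ) → ℝ := fun x => (ε * d m)⁻¹ * (x m - x₀ m)
  have hℓ : ∀ t : ℝ, ℓ (x₀ + t • ε • d) = t := by
    intro t
    simp only [ℓ, Pi.add_apply, Pi.smul_apply, smul_eq_mul, add_sub_cancel_left]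
    rw [mul_left_comm, inv_mul_cancel₀ hεm, mul_one]
  have hℓ0 : ℓ x₀ = 0 := by simpa using hℓ 0
  have hℓ1 : ℓ (x₀ + ε • d) = 1 := by simpa using hℓ 1
  have hℓan : ∀ x, AnalyticAt ℝ ℓ x := fun x => analyticAt_const.mul
    (((ContinuousLinearMap.proj (R := ℝ) (φ := fun _ : Fin n => ℝ) m).analyticAt x).sub
      analyticAt_const)
  have hcut : ∀ x, AnalyticAt ℝ (fun x => cutoff (ℓ x)) x := fun x =>
    (analyticAt_cutoff _).fun_comp (hℓan x)
  have hfst : ∀ x, AnalyticAt ℝ (fun x => bumpFst (ℓ x)) x := fun x =>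
    (analyticAt_bumpFst _).fun_comp (hℓan x)
  have hsnd : ∀ x, AnalyticAt ℝ (fun x => bumpSnd (ℓ x)) x := fun x =>
    (analyticAt_bumpSnd _).fun_comp (hℓan x)
  let ρ₀ : (Fin n → ℝ) → ℝ := fun x => α x - cutoff (ℓ x) * α x₀
  let ρ : Fin n → (Fin n → ℝ) → ℝ := fun i x => gradient₁ α x i - cutoff (ℓ x) * gradient₁ α x₀ i
    + bumpFst (ℓ x) * a i + bumpSnd (ℓ x) * b i
  have hseg : ∀ t ∈ unitInterval, x₀ + t • ε • d ∈ Metric.ball x₀ r := by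
    intro t ht
    rw [mem_ball_iff_norm, add_sub_cancel_left, norm_smul, Real.norm_of_nonneg ht.1]
    exact (mul_le_of_le_one_left (norm_nonneg _) ht.2).trans_lt hεr
  have hρ₀ : ∀ x ∈ Metric.ball x₀ r, AnalyticAt ℝ ρ₀ x := fun x hx =>
    (hα x hx).sub ((hcut x).mul analyticAt_const)
  have hρ : ∀ i, ∀ x ∈ Metric.ball x₀ r, AnalyticAt ℝ (ρ i) x := fun i x hx =>
    ((((hα x hx).partialD i).sub ((hcut x).mul analyticAt_const)).add
      ((hfst x).mul analyticAt_const)).add ((hsnd x).mul analyticAt_const)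
  have h₀ : ρ₀ x₀ = 0 := by simp [ρ₀, hℓ0, cutoff_zero]
  have h₁ : ∀ i, ρ i x₀ = 0 := fun i => by
    simp [ρ, hℓ0, cutoff_zero, bumpFst_zero, bumpSnd_zero]
  have h₀' : ρ₀ (x₀ + ε • d) = α (x₀ + ε • d) := by simp [ρ₀, hℓ1, cutoff_one]
  have h₁' : ∀ i, ρ i (x₀ + ε • d) = partialD i α (x₀ + ε • d) := fun i => by
    simp [ρ, hℓ1, cutoff_one, bumpFst_one, bumpSnd_one, gradient₁]
  refine ⟨ε • d, ρ₀, ρ, hseg, hρ₀, hρ, h₀, h₁, h₀', h₁',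
    shiftedParam_segment hΩ hω hball hseg hα hρ₀ hρ hc h₀ h₀' h₁ h₁' (fun i => ?_) fun i => ?_⟩
  · refine (intervalIntegral.integral_congr fun t _ => ?_).trans
      (integral_cutoff_bump (gradient₁ α x₀ i) (a i) (b i))
    simp only [ρ, hℓ]
    ring
  -- The force contracted with `ε • d` is `ε` times the one contracted with `d`, whose mean error
  -- was made to vanish.
  · simp only [cForce_smul, ← mul_sub, intervalIntegral.integral_const_mul]
    rw [mul_eq_zero]
    right
    simpa only [ρ₀, ρ, hℓ] using hab i

end Representation

end

theorem theorem1 (n : ℕ) (hn : 4 ≤ n) (k₀ : ℝ) (Ω : Set (Fin n → ℝ)) (hΩ : IsOpen Ω)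
    (x₀ : Fin n → ℝ) (hx₀ : x₀ ∈ Ω) (ω : (Fin n → ℝ) → Matrix (Fin n) (Fin n) ℝ)
    (hω : IsAnalyticMetric ω Ω) (hS : IsSAdmissible k₀ ω Ω) :
    -- the single function `u`, on an open set `W` of pairs `(x, τ')`, and the base parameters `τ`
    ∃ (W : Set ((Fin n → ℝ) × (ℝ × (Fin n → ℝ)))) (u : (Fin n → ℝ) × (ℝ × (Fin n → ℝ)) → ℝ)
      (τ : ℝ × (Fin n → ℝ)),
      IsOpen W ∧ (∀ z ∈ W, z.1 ∈ Ω) ∧ AnalyticOnNhd ℝ u W ∧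
      -- every `u(·, τ')` solves the c system, and `(x, τ')` are coordinates on the 1-jets
      (∀ z ∈ W, CSystemAt k₀ ω (fun y => u (y, z.2)) z.1) ∧
      Set.InjOn (fun z => (z.1, u z, gradient₁ (fun y => u (y, z.2)) z.1)) W ∧
      -- `τ` labels the null solution
      (x₀, τ) ∈ W ∧ u (x₀, τ) = 0 ∧ (∀ x, (x, τ) ∈ W → u (x, τ) = 0) ∧
      -- every analytic solution near `x₀` is represented by `u`
      ∀ (V : Set (Fin n → ℝ)) (α : (Fin n → ℝ) → ℝ), IsOpen V → x₀ ∈ V → V ⊆ Ω →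
        AnalyticOnNhd ℝ α V → (∀ x ∈ V, CSystemAt k₀ ω α x) →
        ∃ U : Set (Fin n → ℝ), IsOpen U ∧ x₀ ∈ U ∧ U ⊆ V ∧ StarConvex ℝ x₀ U ∧
          ∃ x₀' ∈ U, ∃ (ρ₀ : (Fin n → ℝ) → ℝ) (ρ : Fin n → (Fin n → ℝ) → ℝ),
            ContDiffOn ℝ (⊤ : ℕ∞) ρ₀ U ∧ (∀ i, ContDiffOn ℝ (⊤ : ℕ∞) (ρ i) U) ∧
            -- the section starts on the null solution and reaches the 1-jet of `α` at `x₀'`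
            ρ₀ x₀ = 0 ∧ (∀ i, ρ i x₀ = 0) ∧
            ρ₀ x₀' = α x₀' ∧ (∀ i, ρ i x₀' = partialD i α x₀') ∧
            (∀ x ∈ U, (x, shiftedParam k₀ ω ρ₀ ρ τ (Path.segment x₀ x₀')) ∈ W ∧
              α x = u (x, shiftedParam k₀ ω ρ₀ ρ τ (Path.segment x₀ x₀'))) ∧
            -- `x₀'` may be replaced by `v x` when the differential of `v` is annihilated by the
            -- forms `σ`; the integrals go from `x₀` to `x₀'` and on to `v x` in the image of `v`
            ∀ v : (Fin n → ℝ) → (Fin n → ℝ), ContDiffOn ℝ 1 v U → Set.MapsTo v U U →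
              v x₀ = x₀' →
              (∀ x ∈ U, ∀ h : Fin n → ℝ, sigma₀ ρ₀ ρ (v x) (fderiv ℝ v x h) = 0 ∧
                ∀ i, sigma₁ k₀ ω ρ₀ ρ i (v x) (fderiv ℝ v x h) = 0) →
              ∀ x ∈ U, ∀ γ : Path x₀' (v x),
                (∀ t : unitInterval, γ t = v (AffineMap.lineMap x₀ x (t : ℝ))) →
                α x = u (x, shiftedParam k₀ ω ρ₀ ρ τ ((Path.segment x₀ x₀').trans γ)) := by
  obtain ⟨r, Φ, hΦ⟩ := exists_isFundamentalSolution hn hΩ hω hS hx₀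
  have hzero : ∀ x ∈ Metric.ball x₀ r, Φ x (jetState k₀ ω x₀ 0) = (1, 0, 0) := fun x hx =>
    hΦ.apply_jetState_zero hω hx
  have hx₀r := Metric.mem_ball_self (x := x₀) hΦ.pos
  have hnull : ∀ x ∈ Metric.ball x₀ r, generalSolution k₀ ω x₀ Φ (x, 0) = 0 := fun x hx => by
    simp [generalSolution, hzero x hx]
  -- Parameters are 1-jets at `x₀`, so the base parameter of the null solution is 0.
  refine ⟨generalDomain k₀ ω x₀ r Φ, generalSolution k₀ ω x₀ Φ, 0, hΦ.isOpen_generalDomain,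
    fun z hz => hΦ.subset hz.1, hΦ.analyticOnNhd_generalSolution,
    fun z hz => hΦ.cSystemAt_generalSolution hΩ hω hz, hΦ.injOn_generalSolution hΩ hω,
    ⟨hx₀r, by simp [hzero x₀ hx₀r]⟩, hnull x₀ hx₀r, fun x hx => hnull x hx.1, ?_⟩
  intro V α hV hx₀V hVΩ hα hc
  obtain ⟨r', hr', hball⟩ := Metric.isOpen_iff.1 (hV.inter Metric.isOpen_ball) x₀ ⟨hx₀V, hx₀r⟩
  -- `U` is a ball inside `V` and inside the domain of `Φ`; convexity makes it starlike and keeps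
  -- the segments from `x₀` in it.
  have hr'' : 0 < min r' r := lt_min hr' hΦ.pos
  have hUV : Metric.ball x₀ (min r' r) ⊆ V := fun x hx =>
    (hball (Metric.ball_subset_ball (min_le_left _ _) hx)).1
  have hx₀U := Metric.mem_ball_self (x := x₀) hr''
  have hαU : AnalyticOnNhd ℝ α (Metric.ball x₀ (min r' r)) := hα.mono hUV
  have hcU : ∀ x ∈ Metric.ball x₀ (min r' r), CSystemAt k₀ ω α x := fun x hx => hc x (hUV hx)
  obtain ⟨e, ρ₀, ρ, hseg, hρ₀, hρ, h₀, h₁, h₀', h₁', hparam⟩ :=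
    exists_section_shiftedParam_eq (by omega) hΩ hω hr'' (hUV.trans hVΩ) hαU hcU
  have hrep : ∀ x ∈ Metric.ball x₀ (min r' r), _ := fun x hx =>
    hΦ.eq_generalSolution hΩ hω (min_le_right _ _) hr'' hαU hcU hx
  have hstar := (convex_ball x₀ (min r' r)).starConvex hx₀U
  have he : x₀ + e ∈ Metric.ball x₀ (min r' r) := by simpa using hseg 1 unitInterval.one_mem
  refine ⟨Metric.ball x₀ (min r' r), Metric.isOpen_ball, hx₀U, hUV, hstar, x₀ + e, he, ρ₀, ρ,
    fun x hx => (hρ₀ x hx).contDiffAt.contDiffWithinAt,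
    fun i x hx => (hρ i x hx).contDiffAt.contDiffWithinAt, h₀, h₁, h₀', h₁',
    fun x hx => by rw [hparam]; exact hrep x hx, ?_⟩
  intro v hv _ _ hann x hx γ hγ
  -- The curve inside the image of `v` contributes zero, so the parameters are still the 1-jet of
  -- `α` at `x₀`.
  rw [shiftedParam_segment_trans hω (hUV.trans hVΩ) Metric.isOpen_ball hseg hρ₀ hρ 0
    (hv.differentiableOn one_ne_zero) hann
    (fun t ht => (convex_ball x₀ (min r' r)).lineMap_mem hx₀U hx ht) hγ, hparam]
  exact (hrep x hx).2
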